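/- Let $(X,\mu)$ be a probability space, $\varphi:X\to X$ an invertible measurable map with measurable inverse that preserves $\mu$ and is ergodic, and $T^nf:=f\circ\varphi^n$ for $n\in\mathbb Z$. *Seminorms and $Z_k$.* For bounded measurable $f:X\to\mathbb C$ let $\|f\|_{U^1}=|\int f\,d\mu|$ and $\|f\|_{U^{l+1}}^{2^{l+1}}=\limsup_{N\to\infty}\frac1N\sum_{n=1}^N\|T^nf\cdot\overline f\|_{U^l}^{2^l}$ for $l\ge1$. For $k\ge 0$ let $Z_k\subset L^2(X)$ be the orthogonal complement of $\overline{\{f\in L^\infty(X):\|f\|_{U^{k+1}}=0\}}$ (closures are taken in $L^2(X)$). *Conditional notions.* A factor $Y$ of the system is given by a $\varphi$- and $\varphi^{-1}$-invariant sub-$\sigma$-algebra $\Sigma_Y$; write $E_Y=E(\cdot\,|\,\Sigma_Y)$, $L^p(Y)=L^p(X,\Sigma_Y,\mu)$, $\|f\|_{L^2(X|Y)}=(E_Y|f|^2)^{1/2}$ and $L^2(X|Y)=\{f\in L^2(X):\|f\|_{L^2(X|Y)}\in L^\infty(Y)\}$. A subspace of $L^2(X)$ is induced by $Y$ if it equals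 $L^2(Y)$. Let $A(X|Y)$ be the set of conditionally almost periodic functions, i.e. of those $f\in L^2(X|Y)$ such that for every $\varepsilon>0$ there are $m$ and $f_1,\dots,f_m\in L^2(X|Y)$ such that for every $n\in\mathbb Z$ there are $c_1,\dots,c_m\in L^\infty(Y)$ with $\|c_j\|_\infty\le1$ and $\big\|\,\|T^nf-\sum_jc_jf_j\|_{L^2(X|Y)}\big\|_{L^\infty}<\varepsilon$. Let $W(X|Y)$ be the set of conditionally weakly mixing functions, i.e. of those $f\in L^2(X)$ with $\lim_{N\to\infty}\frac1N\sum_{n=1}^N\|E_Y(T^nf\cdot\overline f)\|_{L^1}=0$. *Distal factors.* Let $D_0$ be the space of constants and $D_{k+1}=\overline{A(X|\mathcal D_k)}$ for $k\ge 0$, where $\mathcal D_k$ is the factor inducing $D_k$ (its $\sigma$-algebra is generated by the measurable sets $A$ with $1_A\in D_k$). **Proposition (Distal factors are extensions of Host–Kra–Ziegler factors).** The spaces $D_k$ are well defined, i.e. each $D_k$ is induced by the factor $\mathcal D_k$, and the following holds. 1. $Z_k\subset D_k$ for every $k\ge0$. 2. For every $k\ge0$, every bounded $f\in W(X|\mathcal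 D_k)$ satisfies $\|f\|_{U^{k+2}}=0$. 3. For every $k\ge1$, $\mathcal D_{k-1}$ is characteristic for $k$-term multiple ergodic averages: for all $f_1,\dots,f_k\in L^\infty(X)$, $$\lim_{N\to\infty}\Big\|\frac1N\sum_{n=1}^NT^nf_1\,T^{2n}f_2\cdots T^{kn}f_k-\frac1N\sum_{n=1}^NT^nPf_1\,T^{2n}Pf_2\cdots T^{kn}Pf_k\Big\|_{L^2(X)}=0,\qquad P=E(\cdot\,|\,\mathcal D_{k-1}).$$ -/

import Mathlib

open MeasureTheory Filter Topology
open scoped ENNReal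

noncomputable section

namespace DistalHostKra

/-- The power `T ^ n` (with `n : ℤ`) of the Koopman operator `T f = f ∘ φ` of an invertible
bi-measurable transformation `φ`, on functions. -/
def koopman {X : Type*} [MeasurableSpace X] (φ : X ≃ᵐ X) (n : ℤ) (f : X → ℂ) : X → ℂ :=
  fun x => f (((φ.toEquiv : Equiv.Perm X) ^ n) x)

/-! ### Gowers-Host-Kra seminorms -/

/-- The uniformity seminorms `‖f‖_{U^l}`, `l ≥ 1`, of a bounded function `f`:
`‖f‖_{U^1} = |∫ f|` and
`‖f‖_{U^{l+1}} ^ (2^{l+1}) = limsup_N (1/N) ∑_{n=1}^N ‖T^n f · conj f‖_{U^l} ^ (2^l)`.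
(The index `0` carries no meaning and is never used.) -/
def uniformitySeminorm {X : Type*} [MeasurableSpace X] (φ : X ≃ᵐ X) (μ : Measure X) :
    ℕ → (X → ℂ) → ℝ
  | 0, _ => 0
  | 1, f => ‖∫ x, f x ∂μ‖
  | (l + 2), f =>
      (limsup (fun N : ℕ => (1 / (N : ℝ)) * ∑ n ∈ Finset.Icc 1 N,
        (uniformitySeminorm φ μ (l + 1)
          (fun x => koopman φ (n : ℤ) f x * starRingEnd ℂ (f x))) ^ (2 ^ (l + 1))) atTop)
        ^ ((1 : ℝ) / 2 ^ (l + 2))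

/-- The subspace `Z_k` of `L²(X)`: the orthogonal complement of the (closure of the) set of bounded
functions with vanishing `U^{k+1}` seminorm. (The orthogonal complement of a set agrees with the
one of its closed linear span.) -/
def hostKraSubspace {X : Type*} [MeasurableSpace X]
    (φ : X ≃ᵐ X) (μ : Measure X) (k : ℕ) : Submodule ℂ (Lp ℂ 2 μ) :=
  (Submodule.span ℂ
    {f : Lp ℂ 2 μ | MemLp f ∞ μ ∧ uniformitySeminorm φ μ (k + 1) f = 0})ᗮ

/-! ### Conditional notions relative to a factor

A factor `Y` is given by an invariant sub-`σ`-algebra `m` of the `σ`-algebra of `X`. Functions on `Y`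
are identified with `m`-measurable functions on `X`, and the conditional expectation operator with
`f ↦ μ[f|m]`. -/

/-- The conditional norm `‖f‖_{L²(X|Y)} = (E_Y |f|²)^{1/2}`. -/
def condNorm {X : Type*} (m : MeasurableSpace X) [m0 : MeasurableSpace X]
    (μ : Measure X) (f : X → ℂ) : X → ℝ :=
  fun x => √((μ[fun y => ‖f y‖ ^ 2 | m]) x)

/-- `f ∈ L²(X|Y)`: `f ∈ L²(X)` and its conditional norm is in `L^∞(Y)`. -/
def MemCondL2 {X : Type*} (m : MeasurableSpace X) [m0 : MeasurableSpace X]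
    (μ : Measure X) (f : X → ℂ) : Prop :=
  MemLp f 2 μ ∧ MemLp (condNorm m μ f) ∞ μ

/-- `f ∈ A(X|Y)`: the function `f ∈ L²(X|Y)` is conditionally almost periodic. -/
def IsCondAlmostPeriodic {X : Type*} (m : MeasurableSpace X) [m0 : MeasurableSpace X]
    (φ : X ≃ᵐ X) (μ : Measure X) (f : X → ℂ) : Prop :=
  MemCondL2 m μ f ∧
    ∀ ε : ℝ, 0 < ε → ∃ (r : ℕ) (g : Fin r → X → ℂ), (∀ j, MemCondL2 m μ (g j)) ∧
      ∀ n : ℤ, ∃ c : Fin r → X → ℂ,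
        (∀ j, AEStronglyMeasurable[m] (c j) μ ∧ eLpNorm (c j) ∞ μ ≤ 1) ∧
        eLpNorm (condNorm m μ (fun x => koopman φ n f x - ∑ j, c j x * g j x)) ∞ μ
          < ENNReal.ofReal ε

/-- `f ∈ W(X|Y)`: the function `f ∈ L²(X)` is conditionally weakly mixing, i.e.
`(1/N) ∑_{n=1}^N ‖E_Y(T^n f · conj f)‖_{L¹} → 0`. -/
def IsCondWeaklyMixing {X : Type*} (m : MeasurableSpace X) [m0 : MeasurableSpace X]
    (φ : X ≃ᵐ X) (μ : Measure X) (f : X → ℂ) : Prop :=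
  MemLp f 2 μ ∧
    Tendsto (fun N : ℕ => (1 / (N : ℝ)) * ∑ n ∈ Finset.Icc 1 N,
      ∫ x, ‖(μ[fun y => koopman φ (n : ℤ) f y * starRingEnd ℂ (f y) | m]) x‖ ∂μ) atTop (𝓝 0)

/-! ### Factors and the distal tower -/

/-- The set `D` of `L²` functions is induced by the factor given by the sub-`σ`-algebra `m`:
`m` is `φ`- and `φ⁻¹`-invariant and `D = L²(X, m, μ)`. -/
def IsInducedByFactor {X : Type*} (m : MeasurableSpace X) [m0 : MeasurableSpace X]
    (φ : X ≃ᵐ X) (μ : Measure X) (D : Set (Lp ℂ 2 μ)) : Prop :=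
  m ≤ m0 ∧
  (∀ A : Set X, MeasurableSet[m] A → MeasurableSet[m] (φ ⁻¹' A) ∧ MeasurableSet[m] (φ '' A)) ∧
  D = {f : Lp ℂ 2 μ | AEStronglyMeasurable[m] f μ}

/-- The sub-`σ`-algebra belonging to a set `D` of `L²` functions: it is generated by the measurable
sets whose indicator function belongs to `D`. If `D` is induced by a factor, this is the (unique up to
null sets) sub-`σ`-algebra inducing `D`. -/
@[reducible] def factorOf {X : Type*} [MeasurableSpace X] {μ : Measure X}
    (D : Set (Lp ℂ 2 μ)) :
    MeasurableSpace X :=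
  MeasurableSpace.generateFrom
    {A : Set X | MeasurableSet A ∧ ∃ f ∈ D, f =ᵐ[μ] A.indicator (fun _ => (1 : ℂ))}

/-- The subspaces `D_k` of `L²(X)`: `D_0` consists of the constants and
`D_{k+1}` is the closure in `L²(X)` of `A(X|𝒟_k)`, where `𝒟_k` is the factor inducing `D_k`. -/
def distalSubspace {X : Type*} [MeasurableSpace X]
    (φ : X ≃ᵐ X) (μ : Measure X) : ℕ → Set (Lp ℂ 2 μ)
  | 0 => {f : Lp ℂ 2 μ | ∃ c : ℂ, f =ᵐ[μ] fun _ => c}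
  | (k + 1) =>
      closure {f : Lp ℂ 2 μ | IsCondAlmostPeriodic (factorOf (distalSubspace φ μ k)) φ μ f}

/-- The distal factor `𝒟_k` of order `k`, as a sub-`σ`-algebra. -/
@[reducible] def distalFactor {X : Type*} [MeasurableSpace X]
    (φ : X ≃ᵐ X) (μ : Measure X) (k : ℕ) : MeasurableSpace X :=
  factorOf (distalSubspace φ μ k)

/-! ### Multiple ergodic averages -/

/-- The `k`-term average `(1/N) ∑_{n=1}^N T^n f_1 · T^{2n} f_2 ⋯ T^{kn} f_k`
(`f_{j+1}` is written `f j` for `j : Fin k`). -/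
def multipleAverage {X : Type*} [MeasurableSpace X]
    (φ : X ≃ᵐ X) {k : ℕ} (f : Fin k → X → ℂ) (N : ℕ) : X → ℂ :=
  fun x => (1 / (N : ℂ)) * ∑ n ∈ Finset.Icc 1 N,
    ∏ j : Fin k, koopman φ (((j : ℕ) + 1 : ℤ) * (n : ℤ)) (f j) x

/-- The factor `m` is characteristic for `k`-term multiple ergodic averages: replacing all
functions by their projections onto the factor changes the averages by an `L²` null sequence. -/
def IsCharacteristic {X : Type*} (m : MeasurableSpace X) [m0 : MeasurableSpace X]
    (φ : X ≃ᵐ X) (μ : Measure X) (k : ℕ) : Prop :=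
  ∀ f : Fin k → X → ℂ, (∀ j, MemLp (f j) ∞ μ) →
    Tendsto (fun N : ℕ => eLpNorm (fun x => multipleAverage φ f N x -
      multipleAverage φ (fun j => μ[f j | m]) N x) 2 μ) atTop (𝓝 0)

end DistalHostKra

end

namespace DistalHostKra

variable {X : Type*} [MeasurableSpace X] {μ : Measure X} {φ : X ≃ᵐ X}

/-! ### Powers of an invertible measure preserving map -/

/-! Everything rests on one claim, proved by induction on `k` in
`uniformitySeminorm_eq_zero_of_condExp`: a bounded function whose conditional expectation on `𝒟_k`
vanishes has zero `U^{k+1}` seminorm. For `k = 0` this only says that the integral vanishes. The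
inclusion `Z_k ⊆ D_k` then follows by duality, since a vector orthogonal to all such functions is
measurable with respect to the factor (`aestronglyMeasurable_of_orthogonal`).

The inductive step has two halves. First, a bounded `w` with zero expectation on `𝒟_{k+1}` is
orthogonal to the functions that are almost periodic over `𝒟_k`, and such a `w` is weakly mixing
over `𝒟_k`. Second, a bounded `f` that is weakly mixing over `𝒟_k` has zero `U^{k+2}` seminorm:
split `T^n f · conj f` into its expectation on `𝒟_k`, which is small in `L¹` on average over `n`,
and a remainder with zero `U^{k+1}` seminorm by the induction hypothesis. The quasi-triangle
inequality `uPow_add_le` combines the two pieces.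

The first half is the dichotomy between almost periodicity and weak mixing. For `w` orthogonal to
the almost periodic functions and `g` bounded, consider the averages of `T^n w · E(g · conj (T^n w)
| m)`. Any weak limit `h` along an ultrafilter is almost periodic, whereas the averages are
orthogonal to every almost periodic function. So `h` is orthogonal to itself and vanishes, and
pairing the averages with `g` shows that the `L²` norms squared of `E(g · conj (T^n w) | m)` tend to
`0` on average. That `h` is almost periodic is a conditional form of the compactness of
Hilbert–Schmidt operators, proved without spectral theory. A conditional Gram–Schmidt process
selects from the orbit of `h` vectors that are conditionally at distance at least `√δ` from the
previous ones. If it could run for `r` steps on a set `E` of positive measure, the sum of the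
selected components would be at least `r √δ μ(E)`, while Bessel's inequality and Cauchy–Schwarz
bound it by a multiple of `√r μ(E)` (`sum_norm_integral_corrAverage_le`). For large `r` this is
impossible, so finitely many vectors approximate the whole orbit.

To see that `D_{k+1}` is induced by a factor, bounded almost periodic functions with bounded
generators are used: they form an invariant `*`-algebra, and the `L²` closure of such an algebra is
the `L²` space of a sub-`σ`-algebra, by Weierstrass approximation. The general almost periodic
functions have the same closure, because they too are orthogonal to every bounded `w` of the above
kind (`closure_isCondAlmostPeriodic`).

Characteristicity is the generalised von Neumann theorem `progAverage_bound`: van der Corput's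
inequality and induction on the number of functions bound multiple averages by the uniformity
seminorm of any one of them. Telescoping over the functions then reduces to the case where one of
them has zero expectation on the factor. -/

theorem measurable_zpow (φ : X ≃ᵐ X) (n : ℤ) : Measurable ((φ.toEquiv : Equiv.Perm X) ^ n) := by
  have hnat : ∀ k : ℕ, Measurable ((φ.toEquiv : Equiv.Perm X) ^ k) := fun k => by
    rw [Equiv.Perm.coe_pow]; exact φ.measurable.iterate k
  have hnat' : ∀ k : ℕ, Measurable (((φ.toEquiv : Equiv.Perm X) ^ k)⁻¹ : Equiv.Perm X) := fun k => by
    rw [← inv_pow, Equiv.Perm.coe_pow]; exact φ.symm.measurable.iterate k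
  cases n with
  | ofNat k => simpa using hnat k
  | negSucc k => simpa [zpow_negSucc] using hnat' (k + 1)

theorem measurePreserving_zpow (hφ : MeasurePreserving φ μ μ) (n : ℤ) :
    MeasurePreserving ((φ.toEquiv : Equiv.Perm X) ^ n) μ μ := by
  have hnat : ∀ k : ℕ, MeasurePreserving ((φ.toEquiv : Equiv.Perm X) ^ k) μ μ := fun k => by
    rw [Equiv.Perm.coe_pow]; exact hφ.iterate k
  have hnat' : ∀ k : ℕ,
      MeasurePreserving (((φ.toEquiv : Equiv.Perm X) ^ k)⁻¹ : Equiv.Perm X) μ μ := fun k => by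
    rw [← inv_pow, Equiv.Perm.coe_pow]
    exact (MeasurePreserving.symm φ hφ).iterate k
  cases n with
  | ofNat k => simpa using hnat k
  | negSucc k => simpa [zpow_negSucc] using hnat' (k + 1)

theorem koopman_zero (f : X → ℂ) : koopman φ 0 f = f := by
  funext x; simp [koopman]

theorem koopman_koopman (a b : ℤ) (f : X → ℂ) :
    koopman φ a (koopman φ b f) = koopman φ (a + b) f := by
  funext x
  simp only [koopman]
  rw [add_comm, zpow_add, Equiv.Perm.mul_apply]

theorem ae_zpow (hφ : MeasurePreserving φ μ μ) (n : ℤ) {p : X → Prop} (h : ∀ᵐ x ∂μ, p x) :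
    ∀ᵐ x ∂μ, p (((φ.toEquiv : Equiv.Perm X) ^ n) x) :=
  (measurePreserving_zpow hφ n).quasiMeasurePreserving.ae h

theorem integral_comp_zpow {E : Type*} [NormedAddCommGroup E] [NormedSpace ℝ E]
    (hφ : MeasurePreserving φ μ μ) (n : ℤ) (f : X → E) :
    ∫ x, f (((φ.toEquiv : Equiv.Perm X) ^ n) x) ∂μ = ∫ x, f x ∂μ := by
  have hemb : MeasurableEmbedding ((φ.toEquiv : Equiv.Perm X) ^ n) := by
    refine MeasurableEquiv.measurableEmbedding
      (⟨((φ.toEquiv : Equiv.Perm X) ^ n), measurable_zpow φ n, ?_⟩ : X ≃ᵐ X)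
    have := measurable_zpow φ (-n)
    rw [zpow_neg] at this
    exact this
  exact (measurePreserving_zpow hφ n).integral_comp hemb f

theorem integral_koopman (hφ : MeasurePreserving φ μ μ) (n : ℤ) (f : X → ℂ) :
    ∫ x, koopman φ n f x ∂μ = ∫ x, f x ∂μ :=
  integral_comp_zpow hφ n f

theorem integral_norm_koopman (hφ : MeasurePreserving φ μ μ) (n : ℤ) (f : X → ℂ) :
    ∫ x, ‖koopman φ n f x‖ ∂μ = ∫ x, ‖f x‖ ∂μ :=
  integral_comp_zpow hφ n fun x => ‖f x‖

/-! ### Essentially bounded functions with an explicit bound -/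

/-- `f` is almost everywhere strongly measurable and bounded by `M` almost everywhere. -/
def BoundedBy (μ : Measure X) (M : ℝ) (f : X → ℂ) : Prop :=
  AEStronglyMeasurable f μ ∧ ∀ᵐ x ∂μ, ‖f x‖ ≤ M

namespace BoundedBy

variable {M K : ℝ} {f g : X → ℂ}

theorem mono (hf : BoundedBy μ M f) (h : M ≤ K) : BoundedBy μ K f :=
  ⟨hf.1, hf.2.mono fun _ hx => hx.trans h⟩

theorem congr (hf : BoundedBy μ M f) (h : f =ᵐ[μ] g) : BoundedBy μ M g :=
  ⟨hf.1.congr h, by filter_upwards [hf.2, h] with x hx h1; rwa [← h1]⟩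

theorem add (hf : BoundedBy μ M f) (hg : BoundedBy μ K g) :
    BoundedBy μ (M + K) (fun x => f x + g x) :=
  ⟨hf.1.add hg.1, by
    filter_upwards [hf.2, hg.2] with x h1 h2
    exact (norm_add_le _ _).trans (add_le_add h1 h2)⟩

theorem sub (hf : BoundedBy μ M f) (hg : BoundedBy μ K g) :
    BoundedBy μ (M + K) (fun x => f x - g x) :=
  ⟨hf.1.sub hg.1, by
    filter_upwards [hf.2, hg.2] with x h1 h2
    exact (norm_sub_le _ _).trans (add_le_add h1 h2)⟩

theorem mul (hf : BoundedBy μ M f) (hg : BoundedBy μ K g) :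
    BoundedBy μ (M * K) (fun x => f x * g x) :=
  ⟨hf.1.mul hg.1, by
    filter_upwards [hf.2, hg.2] with x h1 h2
    rw [norm_mul]
    exact mul_le_mul h1 h2 (norm_nonneg _) ((norm_nonneg _).trans h1)⟩

theorem conj (hf : BoundedBy μ M f) : BoundedBy μ M (fun x => starRingEnd ℂ (f x)) :=
  ⟨RCLike.continuous_conj.comp_aestronglyMeasurable hf.1, by
    filter_upwards [hf.2] with x h1
    rwa [RCLike.norm_conj]⟩

theorem const (c : ℂ) : BoundedBy μ ‖c‖ (fun _ => c) :=
  ⟨aestronglyMeasurable_const, ae_of_all _ fun _ => le_rfl⟩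

theorem sum {ι : Type*} (s : Finset ι) {M : ι → ℝ} {f : ι → X → ℂ}
    (h : ∀ i ∈ s, BoundedBy μ (M i) (f i)) :
    BoundedBy μ (∑ i ∈ s, M i) (fun x => ∑ i ∈ s, f i x) := by
  classical
  induction s using Finset.induction_on with
  | empty => simpa using const (μ := μ) (0 : ℂ)
  | insert a s ha ih =>
    simp only [Finset.sum_insert ha]
    exact (h a (by simp)).add (ih fun i hi => h i (by simp [hi]))

theorem prod {ι : Type*} (s : Finset ι) {f : ι → X → ℂ}
    (h : ∀ i ∈ s, BoundedBy μ 1 (f i)) :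
    BoundedBy μ 1 (fun x => ∏ i ∈ s, f i x) := by
  classical
  induction s using Finset.induction_on with
  | empty => simpa using const (μ := μ) (1 : ℂ)
  | insert a s ha ih =>
    simp only [Finset.prod_insert ha]
    simpa using (h a (by simp)).mul (ih fun i hi => h i (by simp [hi]))

theorem koopman (hφ : MeasurePreserving φ μ μ) (n : ℤ) (hf : BoundedBy μ M f) :
    BoundedBy μ M (koopman φ n f) :=
  ⟨hf.1.comp_measurePreserving (measurePreserving_zpow hφ n), ae_zpow hφ n hf.2⟩

theorem memLp [IsFiniteMeasure μ] (hf : BoundedBy μ M f) (p : ℝ≥0∞) : MemLp f p μ :=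
  MemLp.of_bound hf.1 M hf.2

theorem integrable [IsFiniteMeasure μ] (hf : BoundedBy μ M f) : Integrable f μ :=
  (memLp_one_iff_integrable).1 (hf.memLp 1)

theorem nonneg [IsProbabilityMeasure μ] (hf : BoundedBy μ M f) : 0 ≤ M := by
  obtain ⟨x, hx⟩ := hf.2.exists
  exact (norm_nonneg _).trans hx

theorem integral_norm_le [IsProbabilityMeasure μ] (hf : BoundedBy μ M f) :
    ∫ x, ‖f x‖ ∂μ ≤ M := by
  have := integral_mono_ae hf.integrable.norm (integrable_const M) hf.2
  simpa using this

theorem norm_integral_le [IsProbabilityMeasure μ] (hf : BoundedBy μ M f) :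
    ‖∫ x, f x ∂μ‖ ≤ M :=
  (norm_integral_le_integral_norm _).trans hf.integral_norm_le

end BoundedBy

theorem exists_boundedBy_of_memLp_top {f : X → ℂ} (hf : MemLp f ∞ μ) :
    ∃ M : ℝ, 0 ≤ M ∧ BoundedBy μ M f := by
  refine ⟨(eLpNorm f ∞ μ).toReal, ENNReal.toReal_nonneg, hf.1, ?_⟩
  have h2 := hf.2.ne
  rw [eLpNorm_exponent_top] at *
  filter_upwards [enorm_ae_le_eLpNormEssSup f μ] with x hx
  have := ENNReal.toReal_mono h2 hx
  simpa using this

/-! ### Averages and limsups of real sequences -/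

/-- The average of `a 1, …, a N`. -/
noncomputable def avg (a : ℕ → ℝ) (N : ℕ) : ℝ := (1 / (N : ℝ)) * ∑ n ∈ Finset.Icc 1 N, a n

theorem avg_nonneg {a : ℕ → ℝ} (ha : ∀ n, 0 ≤ a n) (N : ℕ) : 0 ≤ avg a N :=
  mul_nonneg (by positivity) (Finset.sum_nonneg fun n _ => ha n)

theorem avg_mono {a b : ℕ → ℝ} (h : ∀ n, a n ≤ b n) (N : ℕ) : avg a N ≤ avg b N :=
  mul_le_mul_of_nonneg_left (Finset.sum_le_sum fun n _ => h n) (by positivity)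

theorem avg_add (a b : ℕ → ℝ) (N : ℕ) : avg (fun n => a n + b n) N = avg a N + avg b N := by
  simp [avg, Finset.sum_add_distrib, mul_add]

theorem avg_const_mul (c : ℝ) (a : ℕ → ℝ) (N : ℕ) : avg (fun n => c * a n) N = c * avg a N := by
  simp only [avg, ← Finset.mul_sum]; ring

theorem avg_const_le {c : ℝ} (hc : 0 ≤ c) (N : ℕ) : avg (fun _ => c) N ≤ c := by
  rcases Nat.eq_zero_or_pos N with rfl | hN
  · simpa [avg] using hc
  · have : (N : ℝ) ≠ 0 := by positivity
    simp [avg, this]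

theorem avg_le {a : ℕ → ℝ} {c : ℝ} (hc : 0 ≤ c) (h : ∀ n, a n ≤ c) (N : ℕ) : avg a N ≤ c :=
  (avg_mono h N).trans (avg_const_le hc N)

theorem avg_finsetSum {ι : Type*} (s : Finset ι) (a : ι → ℕ → ℝ) (N : ℕ) :
    avg (fun n => ∑ i ∈ s, a i n) N = ∑ i ∈ s, avg (a i) N := by
  simp only [avg]
  rw [Finset.sum_comm, Finset.mul_sum]

/-- No upper bound on `u` is needed: if there are no eventual upper bounds, their infimum is the
default value `0`. -/
theorem limsup_nonneg {u : ℕ → ℝ} (h : ∀ n, 0 ≤ u n) : 0 ≤ limsup u atTop := by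
  rw [limsup_eq]
  refine Real.sInf_nonneg fun a ha => ?_
  obtain ⟨n, hn⟩ := (ha : ∀ᶠ n in atTop, u n ≤ a).exists
  exact (h n).trans hn

theorem limsup_le_of_eventually {u : ℕ → ℝ} (h : ∀ n, 0 ≤ u n) {c : ℝ}
    (hc : ∀ᶠ n in atTop, u n ≤ c) : limsup u atTop ≤ c :=
  limsup_le_of_le (isCoboundedUnder_le_of_le atTop h) hc

theorem eventually_lt_of_limsup_lt' {u : ℕ → ℝ} {K : ℝ} (h : ∀ n, u n ≤ K) {c : ℝ}
    (hc : limsup u atTop < c) : ∀ᶠ n in atTop, u n < c :=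
  eventually_lt_of_limsup_lt hc (isBoundedUnder_of ⟨K, h⟩)

theorem limsup_le_add_mul {u v : ℕ → ℝ} {a c K : ℝ} (hc : 0 ≤ c) (hu : ∀ n, 0 ≤ u n)
    (hv : ∀ n, v n ≤ K) (h : ∀ᶠ n in atTop, u n ≤ a + c * v n) :
    limsup u atTop ≤ a + c * limsup v atTop := by
  refine le_of_forall_pos_le_add fun ε hε => ?_
  -- Dividing by `c + 1` instead of `c` covers `c = 0`.
  have hlt : limsup v atTop < limsup v atTop + ε / (c + 1) := by
    have : 0 < ε / (c + 1) := by positivity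
    linarith
  refine limsup_le_of_eventually hu ?_
  filter_upwards [h, eventually_lt_of_limsup_lt' hv hlt] with n h1 h2
  have h3 : c * v n ≤ c * (limsup v atTop + ε / (c + 1)) := mul_le_mul_of_nonneg_left h2.le hc
  have h4 : c * (ε / (c + 1)) ≤ ε := by
    rw [mul_div_assoc', div_le_iff₀ (by positivity)]; nlinarith
  nlinarith

/-! ### Uniformity seminorms -/

/-- The multiplicative derivative `T ^ n f · conj f`. -/
noncomputable def multDeriv (φ : X ≃ᵐ X) (n : ℤ) (f : X → ℂ) : X → ℂ :=
  fun x => koopman φ n f x * starRingEnd ℂ (f x)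

theorem BoundedBy.multDeriv {M : ℝ} {f : X → ℂ} (hφ : MeasurePreserving φ μ μ) (n : ℤ)
    (hf : BoundedBy μ M f) : BoundedBy μ (M * M) (multDeriv φ n f) :=
  (hf.koopman hφ n).mul hf.conj

/-- The power `‖f‖_{U^l} ^ (2 ^ l)` of the uniformity seminorm. -/
noncomputable def uPow (φ : X ≃ᵐ X) (μ : Measure X) (l : ℕ) (f : X → ℂ) : ℝ :=
  uniformitySeminorm φ μ l f ^ (2 ^ l)

theorem uPow_one (f : X → ℂ) : uPow φ μ 1 f = ‖∫ x, f x ∂μ‖ ^ 2 := by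
  simp [uPow, uniformitySeminorm]

theorem uniformitySeminorm_eq (l : ℕ) (f : X → ℂ) :
    uniformitySeminorm φ μ (l + 2) f =
      (limsup (avg fun n => uPow φ μ (l + 1) (multDeriv φ n f)) atTop)
        ^ ((1 : ℝ) / 2 ^ (l + 2)) := rfl

theorem uniformitySeminorm_nonneg : ∀ (l : ℕ) (f : X → ℂ), 0 ≤ uniformitySeminorm φ μ l f
  | 0, _ => le_rfl
  | 1, _ => norm_nonneg _
  | l + 2, f => by
    rw [uniformitySeminorm_eq]
    refine Real.rpow_nonneg (limsup_nonneg (avg_nonneg fun n => ?_)) _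
    exact pow_nonneg (uniformitySeminorm_nonneg (l + 1) _) _

theorem uPow_nonneg (l : ℕ) (f : X → ℂ) : 0 ≤ uPow φ μ l f :=
  pow_nonneg (uniformitySeminorm_nonneg l f) _

/-- The root in the definition cancels against the power because the limsup is nonnegative. All
inductions on the order of the seminorm run on this root-free recursion. -/
theorem uPow_succ (l : ℕ) (f : X → ℂ) :
    uPow φ μ (l + 2) f = limsup (avg fun n => uPow φ μ (l + 1) (multDeriv φ n f)) atTop := by
  have h0 : 0 ≤ limsup (avg fun n => uPow φ μ (l + 1) (multDeriv φ n f)) atTop :=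
    limsup_nonneg (avg_nonneg fun n => uPow_nonneg _ _)
  rw [uPow, uniformitySeminorm_eq, ← Real.rpow_natCast, ← Real.rpow_mul h0]
  have : (1 : ℝ) / 2 ^ (l + 2) * ((2 ^ (l + 2) : ℕ) : ℝ) = 1 := by
    push_cast; field_simp
  rw [this, Real.rpow_one]

theorem uniformitySeminorm_eq_zero_iff (l : ℕ) (f : X → ℂ) :
    uniformitySeminorm φ μ l f = 0 ↔ uPow φ μ l f = 0 := by
  rw [uPow, pow_eq_zero_iff (by positivity)]

theorem uPow_le [IsProbabilityMeasure μ] (hφ : MeasurePreserving φ μ μ) (l : ℕ) :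
    ∀ {f : X → ℂ} {M : ℝ}, BoundedBy μ M f → uPow φ μ (l + 1) f ≤ M ^ (2 ^ (l + 1)) := by
  induction l with
  | zero =>
    intro f M hf
    rw [uPow_one]
    simpa using pow_le_pow_left₀ (norm_nonneg _) hf.norm_integral_le 2
  | succ l ih =>
    intro f M hf
    rw [uPow_succ]
    refine limsup_le_of_eventually (avg_nonneg fun n => uPow_nonneg _ _) ?_
    refine Eventually.of_forall fun N => avg_le (pow_nonneg hf.nonneg _) (fun n => ?_) N
    refine (ih (hf.multDeriv hφ n)).trans_eq ?_
    rw [← pow_two, ← pow_mul]; ring_nf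

/-- A substitute for the triangle inequality, strong enough to discard an `L¹`-small perturbation
`a`. In `T^n (a + b) · conj (a + b)` every term except `T^n b · conj b` contains a factor `a` or
`T^n a`, so these three cross terms together have `L¹` norm at most `3 M ‖a‖₁` and sup norm at most
`3 M²`. The induction hypothesis is applied to them with bound `3 M²`. -/
theorem uPow_add_le [IsProbabilityMeasure μ] (hφ : MeasurePreserving φ μ μ) (l : ℕ) :
    ∀ M : ℝ, ∃ C : ℝ, 0 ≤ C ∧ ∀ a b : X → ℂ, BoundedBy μ M a → BoundedBy μ M b →
      uPow φ μ (l + 1) (fun x => a x + b x) ≤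
        C * ((∫ x, ‖a x‖ ∂μ) + uPow φ μ (l + 1) b) := by
  induction l with
  | zero =>
    intro M
    -- With `p` and `q` the moduli of the two integrals, `(p + q)² ≤ 2 p² + 2 q²` and `p² ≤ M ‖a‖₁`.
    -- The absolute value keeps the constant nonnegative before `M` is known to be.
    refine ⟨2 * |M| + 2, by positivity, fun a b ha hb => ?_⟩
    rw [uPow_one, uPow_one, integral_add ha.integrable hb.integrable]
    have h1 : ‖∫ x, a x ∂μ‖ ≤ ∫ x, ‖a x‖ ∂μ := norm_integral_le_integral_norm _
    have h2 : ‖∫ x, a x ∂μ‖ ≤ M := ha.norm_integral_le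
    have h4 := norm_add_le (∫ x, a x ∂μ) (∫ x, b x ∂μ)
    have h5 := norm_nonneg ((∫ x, a x ∂μ) + (∫ x, b x ∂μ))
    have h6 := norm_nonneg (∫ x, a x ∂μ)
    have h7 := norm_nonneg (∫ x, b x ∂μ)
    have h8 : M = |M| := (abs_of_nonneg ha.nonneg).symm
    rw [← h8]
    set p := ‖∫ x, a x ∂μ‖
    set q := ‖∫ x, b x ∂μ‖
    set I := ∫ x, ‖a x‖ ∂μ
    have h9 : p ^ 2 ≤ M * I := by nlinarith
    have h10 := pow_le_pow_left₀ h5 h4 2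
    nlinarith [sq_nonneg (p - q), ha.nonneg]
  | succ l ih =>
    intro M
    obtain ⟨C, hC, h⟩ := ih (3 * (M * M))
    refine ⟨C * (3 * |M| + 1), by positivity, fun a b ha hb => ?_⟩
    have hM := ha.nonneg
    rw [abs_of_nonneg hM]
    rw [uPow_succ, uPow_succ]
    set I := ∫ x, ‖a x‖ ∂μ with hI
    have hI0 : 0 ≤ I := integral_nonneg fun _ => norm_nonneg _
    have key : ∀ n : ℕ, uPow φ μ (l + 1) (multDeriv φ n fun x => a x + b x) ≤
        C * (3 * M * I) + C * uPow φ μ (l + 1) (multDeriv φ n b) := by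
      intro n
      set c1 : X → ℂ := fun x => koopman φ n a x * starRingEnd ℂ (a x)
      set c2 : X → ℂ := fun x => koopman φ n a x * starRingEnd ℂ (b x)
      set c3 : X → ℂ := fun x => koopman φ n b x * starRingEnd ℂ (a x)
      have e : (multDeriv φ n fun x => a x + b x) =
          fun x => (c1 x + c2 x + c3 x) + multDeriv φ n b x := by
        funext x
        simp only [multDeriv, koopman, map_add, c1, c2, c3]
        ring
      have b1 : BoundedBy μ (M * M) c1 := (ha.koopman hφ n).mul ha.conj
      have b2 : BoundedBy μ (M * M) c2 := (ha.koopman hφ n).mul hb.conj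
      have b3 : BoundedBy μ (M * M) c3 := (hb.koopman hφ n).mul ha.conj
      have bd : BoundedBy μ (3 * (M * M)) fun x => c1 x + c2 x + c3 x :=
        ((b1.add b2).add b3).mono (by linarith)
      rw [e]
      refine (h _ _ bd ((hb.multDeriv hφ n).mono (by nlinarith))).trans ?_
      rw [mul_add]
      refine add_le_add (mul_le_mul_of_nonneg_left ?_ hC) le_rfl
      have hTa := integral_norm_koopman (μ := μ) hφ n a
      have iTa : Integrable (fun x => ‖koopman φ n a x‖) μ := (ha.koopman hφ n).integrable.norm
      have ia : Integrable (fun x => ‖a x‖) μ := ha.integrable.norm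
      have hle : ∫ x, ‖c1 x + c2 x + c3 x‖ ∂μ ≤
          ∫ x, (2 * M * ‖koopman φ n a x‖ + M * ‖a x‖) ∂μ := by
        refine integral_mono_ae bd.integrable.norm
          ((iTa.const_mul _).add (ia.const_mul _)) ?_
        filter_upwards [ha.2, hb.2, (hb.koopman hφ n).2] with x h1 h2 h3
        have n1 : ‖c1 x‖ ≤ ‖koopman φ n a x‖ * M := by
          simp only [c1, norm_mul, RCLike.norm_conj]
          exact mul_le_mul_of_nonneg_left h1 (norm_nonneg _)
        have n2 : ‖c2 x‖ ≤ ‖koopman φ n a x‖ * M := by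
          simp only [c2, norm_mul, RCLike.norm_conj]
          exact mul_le_mul_of_nonneg_left h2 (norm_nonneg _)
        have n3 : ‖c3 x‖ ≤ M * ‖a x‖ := by
          simp only [c3, norm_mul, RCLike.norm_conj]
          exact mul_le_mul_of_nonneg_right h3 (norm_nonneg _)
        have := norm_add₃_le (a := c1 x) (b := c2 x) (c := c3 x)
        linarith
      refine hle.trans_eq ?_
      rw [integral_add (iTa.const_mul _) (ia.const_mul _), integral_const_mul,
        integral_const_mul, hTa]
      ring
    have hlim : limsup (avg fun n => uPow φ μ (l + 1) (multDeriv φ n fun x => a x + b x)) atTop ≤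
        C * (3 * M * I) +
          C * limsup (avg fun n => uPow φ μ (l + 1) (multDeriv φ n b)) atTop := by
      refine limsup_le_add_mul (K := (M * M) ^ 2 ^ (l + 1)) hC
        (avg_nonneg fun n => uPow_nonneg _ _)
        (avg_le (by positivity) fun n => uPow_le hφ l (hb.multDeriv hφ n))
        (Eventually.of_forall fun N => ?_)
      refine (avg_mono key N).trans ?_
      rw [avg_add]
      exact add_le_add (avg_const_le (by positivity) N) (avg_const_mul _ _ _).le
    refine hlim.trans ?_
    have h0 : 0 ≤ limsup (avg fun n => uPow φ μ (l + 1) (multDeriv φ n b)) atTop :=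
      limsup_nonneg (avg_nonneg fun n => uPow_nonneg _ _)
    nlinarith [mul_nonneg (mul_nonneg hC hM) h0, mul_nonneg hC hI0]

theorem uPow_koopman (hφ : MeasurePreserving φ μ μ) (l : ℕ) :
    ∀ (m : ℤ) (f : X → ℂ), uPow φ μ (l + 1) (koopman φ m f) = uPow φ μ (l + 1) f := by
  induction l with
  | zero => intro m f; rw [uPow_one, uPow_one, integral_koopman hφ]
  | succ l ih =>
    intro m f
    rw [uPow_succ, uPow_succ]
    have : ∀ n : ℤ, multDeriv φ n (koopman φ m f) = koopman φ m (multDeriv φ n f) := fun n => by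
      have h := koopman_koopman (φ := φ) n m f
      rw [add_comm, ← koopman_koopman] at h
      funext x
      simp only [multDeriv]
      rw [h]; rfl
    simp only [this, ih]

theorem uPow_conj (l : ℕ) :
    ∀ f : X → ℂ, uPow φ μ (l + 1) (fun x => starRingEnd ℂ (f x)) = uPow φ μ (l + 1) f := by
  induction l with
  | zero => intro f; rw [uPow_one, uPow_one, integral_conj, RCLike.norm_conj]
  | succ l ih =>
    intro f
    rw [uPow_succ, uPow_succ]
    have : ∀ n : ℤ, (multDeriv φ n fun x => starRingEnd ℂ (f x)) =
        fun x => starRingEnd ℂ (multDeriv φ n f x) := fun n => by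
      funext x
      simp [multDeriv, koopman]
    simp only [this, ih]

/-- Applying `T^n` to `T^{-n} f · conj f` gives the conjugate of `T^n f · conj f`, and neither
operation changes the seminorm. Progressions in the negative direction require this. -/
theorem uPow_multDeriv_neg (hφ : MeasurePreserving φ μ μ) (l : ℕ) (n : ℤ) (f : X → ℂ) :
    uPow φ μ (l + 1) (multDeriv φ (-n) f) = uPow φ μ (l + 1) (multDeriv φ n f) := by
  rw [← uPow_koopman hφ l n, ← uPow_conj]
  congr 1
  funext x
  have h : koopman φ n (koopman φ (-n) f) x = f x := by
    rw [koopman_koopman, add_neg_cancel, koopman_zero]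
  simp only [multDeriv, koopman, map_mul, RingHomCompTriple.comp_apply, RingHom.id_apply] at h ⊢
  simp only [h]
  ring

/-! ### The van der Corput inequality -/

theorem norm_sum_shift_sub_le {a : ℕ → ℂ} {K : ℝ} (ha : ∀ n, ‖a n‖ ≤ K) (N h : ℕ) :
    ‖∑ n ∈ Finset.Icc 1 N, a (n + h) - ∑ n ∈ Finset.Icc 1 N, a n‖ ≤ 2 * h * K := by
  induction h with
  | zero => simp
  | succ h ih =>
    have e : ∑ n ∈ Finset.Icc 1 N, a (n + (h + 1)) - ∑ n ∈ Finset.Icc 1 N, a (n + h) =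
        a (N + 1 + h) - a (1 + h) := by
      rw [← Finset.sum_sub_distrib]
      have := Finset.sum_Ico_sub (fun n => a (n + h)) (show 1 ≤ N + 1 by omega)
      rw [← this]
      refine Finset.sum_congr (by ext; simp) fun n _ => ?_
      rw [show n + (h + 1) = n + 1 + h by ring]
    have h1 : ‖a (N + 1 + h) - a (1 + h)‖ ≤ 2 * K := by
      have := norm_sub_le (a (N + 1 + h)) (a (1 + h))
      linarith [ha (N + 1 + h), ha (1 + h)]
    have h2 := norm_sub_le_norm_sub_add_norm_sub (∑ n ∈ Finset.Icc 1 N, a (n + (h + 1)))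
      (∑ n ∈ Finset.Icc 1 N, a (n + h)) (∑ n ∈ Finset.Icc 1 N, a n)
    rw [e] at h2
    push_cast
    linarith

theorem norm_average_sq_le (w : ℕ → ℂ) (N : ℕ) :
    ‖(1 / (N : ℂ)) * ∑ n ∈ Finset.Icc 1 N, w n‖ ^ 2 ≤ avg (fun n => ‖w n‖ ^ 2) N := by
  rcases Nat.eq_zero_or_pos N with rfl | hN
  · simp [avg]
  have hN' : (0 : ℝ) < N := by exact_mod_cast hN
  have h1 : ‖∑ n ∈ Finset.Icc 1 N, w n‖ ^ 2 ≤ N * ∑ n ∈ Finset.Icc 1 N, ‖w n‖ ^ 2 := by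
    refine (pow_le_pow_left₀ (norm_nonneg _) (norm_sum_le _ _) 2).trans ?_
    simpa using sq_sum_le_card_mul_sum_sq (s := Finset.Icc 1 N) (f := fun n => ‖w n‖)
  rw [norm_mul, mul_pow, avg]
  simp only [one_div, norm_inv, Complex.norm_natCast]
  calc ((N : ℝ)⁻¹) ^ 2 * ‖∑ n ∈ Finset.Icc 1 N, w n‖ ^ 2
      ≤ ((N : ℝ)⁻¹) ^ 2 * (N * ∑ n ∈ Finset.Icc 1 N, ‖w n‖ ^ 2) := by gcongr
    _ = (N : ℝ)⁻¹ * ∑ n ∈ Finset.Icc 1 N, ‖w n‖ ^ 2 := by field_simp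

/-- Replacing `z n` by its mean over the window `n, …, n + H - 1` changes the average by at most `2
H / N`. The rest is `‖A‖² ≤ 2 ‖B‖² + 2 ‖B - A‖²` and Cauchy–Schwarz for the average `B` of the
window means. -/
theorem norm_average_sq_le_window {z : ℕ → ℂ} (hz : ∀ n, ‖z n‖ ≤ 1) {H N : ℕ} (hH : 1 ≤ H)
    (hN : 1 ≤ N) :
    ‖(1 / (N : ℂ)) * ∑ n ∈ Finset.Icc 1 N, z n‖ ^ 2 ≤
      2 * avg (fun n => ‖(1 / (H : ℂ)) * ∑ h ∈ Finset.range H, z (n + h)‖ ^ 2) N +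
        8 * (H / N) ^ 2 := by
  have hN' : (0 : ℝ) < N := by exact_mod_cast hN
  have hH' : (0 : ℝ) < H := by exact_mod_cast hH
  have hNc : (N : ℂ) ≠ 0 := by exact_mod_cast hN'.ne'
  have hHc : (H : ℂ) ≠ 0 := by exact_mod_cast hH'.ne'
  set A := (1 / (N : ℂ)) * ∑ n ∈ Finset.Icc 1 N, z n
  set B := (1 / (N : ℂ)) * ∑ n ∈ Finset.Icc 1 N, ((1 / (H : ℂ)) * ∑ h ∈ Finset.range H, z (n + h))
  have e : B - A = (1 / (N : ℂ)) * ((1 / (H : ℂ)) * ∑ h ∈ Finset.range H,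
      (∑ n ∈ Finset.Icc 1 N, z (n + h) - ∑ n ∈ Finset.Icc 1 N, z n)) := by
    rw [Finset.sum_sub_distrib, Finset.sum_const, Finset.card_range, nsmul_eq_mul, Finset.sum_comm]
    simp only [A, B, ← Finset.mul_sum]
    field_simp
  have hd : ‖B - A‖ ≤ 2 * (H / N) := by
    have h1 : ‖∑ h ∈ Finset.range H,
        (∑ n ∈ Finset.Icc 1 N, z (n + h) - ∑ n ∈ Finset.Icc 1 N, z n)‖ ≤ H * (2 * H) := by
      refine (norm_sum_le _ _).trans ?_
      have : ∀ h ∈ Finset.range H,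
          ‖∑ n ∈ Finset.Icc 1 N, z (n + h) - ∑ n ∈ Finset.Icc 1 N, z n‖ ≤ 2 * H := fun h hh => by
        refine (norm_sum_shift_sub_le hz N h).trans ?_
        have : (h : ℝ) ≤ H := by exact_mod_cast (Finset.mem_range.1 hh).le
        linarith
      simpa using Finset.sum_le_card_nsmul _ _ _ this
    rw [e, norm_mul, norm_mul]
    simp only [one_div, norm_inv, Complex.norm_natCast]
    calc (N : ℝ)⁻¹ * ((H : ℝ)⁻¹ * _) ≤ (N : ℝ)⁻¹ * ((H : ℝ)⁻¹ * (H * (2 * H))) := by gcongr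
      _ = 2 * (H / N) := by field_simp
  have hB : ‖B‖ ^ 2 ≤ avg (fun n => ‖(1 / (H : ℂ)) * ∑ h ∈ Finset.range H, z (n + h)‖ ^ 2) N :=
    norm_average_sq_le _ N
  have hA : ‖A‖ ≤ ‖B‖ + ‖B - A‖ := by
    have := norm_sub_le B (B - A)
    rwa [sub_sub_cancel] at this
  have h2 : ‖A‖ ^ 2 ≤ (‖B‖ + ‖B - A‖) ^ 2 := pow_le_pow_left₀ (norm_nonneg _) hA 2
  have h3 : ‖B - A‖ ^ 2 ≤ (2 * (H / N)) ^ 2 := pow_le_pow_left₀ (norm_nonneg _) hd 2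
  nlinarith [sq_nonneg (‖B‖ - ‖B - A‖)]

/-- For fixed `h` the distance to `h` is injective on `h' ≤ h` and on `h' > h`, so each value is
taken at most twice. -/
theorem sum_dist_le {b : ℕ → ℝ} (hb : ∀ d, 0 ≤ b d) (H : ℕ) :
    ∑ h ∈ Finset.range H, ∑ h' ∈ Finset.range H, b (Nat.dist h h') ≤
      2 * H * ∑ d ∈ Finset.range H, b d := by
  have key : ∀ h ∈ Finset.range H, ∑ h' ∈ Finset.range H, b (Nat.dist h h') ≤
      2 * ∑ d ∈ Finset.range H, b d := by
    intro h hh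
    rw [Finset.mem_range] at hh
    have h1 : ∑ h' ∈ (Finset.range H).filter (· ≤ h), b (Nat.dist h h') ≤
        ∑ d ∈ Finset.range H, b d := by
      rw [← Finset.sum_image (f := b) (g := fun h' => Nat.dist h h')]
      · refine Finset.sum_le_sum_of_subset_of_nonneg ?_ fun d _ _ => hb d
        intro d hd
        simp only [Finset.mem_image, Finset.mem_filter, Finset.mem_range, Nat.dist] at hd ⊢
        omega
      · intro a ha c hc hac
        simp only [Finset.coe_filter, Set.mem_ofPred_eq, Nat.dist] at ha hc hac
        omega
    have h2 : ∑ h' ∈ (Finset.range H).filter (¬ · ≤ h), b (Nat.dist h h') ≤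
        ∑ d ∈ Finset.range H, b d := by
      rw [← Finset.sum_image (f := b) (g := fun h' => Nat.dist h h')]
      · refine Finset.sum_le_sum_of_subset_of_nonneg ?_ fun d _ _ => hb d
        intro d hd
        simp only [Finset.mem_image, Finset.mem_filter, Finset.mem_range, Nat.dist] at hd ⊢
        omega
      · intro a ha c hc hac
        simp only [Finset.coe_filter, Set.mem_ofPred_eq, Nat.dist] at ha hc hac
        omega
    rw [← Finset.sum_filter_add_sum_filter_not (Finset.range H) (· ≤ h)]
    linarith
  refine (Finset.sum_le_card_nsmul _ _ _ key).trans_eq ?_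
  simp; ring

theorem integral_norm_sum_sq [IsProbabilityMeasure μ] {ι : Type*} (s : Finset ι)
    {v : ι → X → ℂ} (hv : ∀ i, BoundedBy μ 1 (v i)) :
    ∫ x, ‖∑ i ∈ s, v i x‖ ^ 2 ∂μ =
      ∑ i ∈ s, ∑ j ∈ s, (∫ x, v i x * starRingEnd ℂ (v j x) ∂μ).re := by
  have e : ∀ x, ‖∑ i ∈ s, v i x‖ ^ 2 = ∑ i ∈ s, ∑ j ∈ s, (v i x * starRingEnd ℂ (v j x)).re := by
    intro x
    have : ((‖∑ i ∈ s, v i x‖ ^ 2 : ℝ) : ℂ) = ∑ i ∈ s, ∑ j ∈ s, v i x * starRingEnd ℂ (v j x) := by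
      rw [Complex.ofReal_pow, ← Complex.mul_conj', map_sum, Finset.sum_mul_sum]
    have h := congrArg Complex.re this
    simpa only [Complex.ofReal_re, Complex.re_sum] using h
  have hint : ∀ i j, Integrable (fun x => v i x * starRingEnd ℂ (v j x)) μ := fun i j =>
    ((hv i).mul (hv j).conj).integrable
  have hre : ∀ i j, Integrable (fun x => (v i x * starRingEnd ℂ (v j x)).re) μ :=
    fun i j => (hint i j).re
  simp only [e]
  rw [integral_finsetSum _ fun i _ => integrable_finsetSum _ fun j _ => hre i j]
  refine Finset.sum_congr rfl fun i _ => ?_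
  rw [integral_finsetSum _ fun j _ => hre i j]
  exact Finset.sum_congr rfl fun j _ => integral_re (hint i j)

/-- **van der Corput's inequality** for bounded sequences of functions. -/
theorem vanDerCorput [IsProbabilityMeasure μ] {u : ℕ → X → ℂ} (hu : ∀ n, BoundedBy μ 1 (u n))
    {s : ℕ → ℝ} (hs0 : ∀ d, 0 ≤ s d)
    (hs : ∀ d, ∀ ε > 0, ∀ᶠ N : ℕ in atTop, ‖(1 / (N : ℂ)) * ∑ n ∈ Finset.Icc 1 N,
      ∫ x, u (n + d) x * starRingEnd ℂ (u n x) ∂μ‖ ≤ s d + ε)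
    {H : ℕ} (hH : 1 ≤ H) {ε : ℝ} (hε : 0 < ε) :
    ∀ᶠ N : ℕ in atTop, ∫ x, ‖(1 / (N : ℂ)) * ∑ n ∈ Finset.Icc 1 N, u n x‖ ^ 2 ∂μ ≤
      4 / H + 4 * avg s H + ε := by
  have hH' : (0 : ℝ) < H := by exact_mod_cast hH
  -- The correlation errors enter the final bound as `2 · 4 η = ε / 2`; the other `ε / 2` covers the
  -- boundary term `8 (H / N)²`.
  set η := ε / 16 with hη
  have hη0 : 0 < η := by positivity
  set γ : ℕ → ℕ → ℂ := fun a b => ∫ x, u a x * starRingEnd ℂ (u b x) ∂μ with hγ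
  have hγ1 : ∀ a b, ‖γ a b‖ ≤ 1 := fun a b => by
    simpa using ((hu a).mul (hu b).conj).norm_integral_le
  have hγc : ∀ a b, γ a b = starRingEnd ℂ (γ b a) := fun a b => by
    simp only [hγ, ← integral_conj, map_mul, RingHomCompTriple.comp_apply, RingHom.id_apply]
    congr 1; funext x; ring
  -- The hypothesis on `s` is not used on the diagonal, where the trivial bound `1` serves. Of the
  -- margin `2 η`, one `η` is the error in the hypothesis and the other pays for shifting the
  -- average by `h'`.
  set b : ℕ → ℝ := fun d => (if d = 0 then 1 else s d) + 2 * η with hb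
  have hb0 : ∀ d, 0 ≤ b d := fun d => by
    simp only [hb]; split_ifs
    · positivity
    · linarith [hs0 d]
  -- correlations along a fixed difference
  have hcorr : ∀ h h' : ℕ, h' < H → h' ≤ h → ∀ᶠ N : ℕ in atTop,
      ‖(1 / (N : ℂ)) * ∑ n ∈ Finset.Icc 1 N, γ (n + h) (n + h')‖ ≤ b (Nat.dist h h') := by
    intro h h' hh' hle
    rcases hle.eq_or_lt with rfl | hlt
    · refine Eventually.of_forall fun N => ?_
      have h1 : ‖∑ n ∈ Finset.Icc 1 N, γ (n + h') (n + h')‖ ≤ N := by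
        refine (norm_sum_le _ _).trans ?_
        simpa using Finset.sum_le_card_nsmul (Finset.Icc 1 N) _ 1 fun n _ => hγ1 (n + h') (n + h')
      rw [norm_mul]
      simp only [one_div, norm_inv, Complex.norm_natCast, hb, Nat.dist_self, if_true]
      have : (N : ℝ)⁻¹ * ‖∑ n ∈ Finset.Icc 1 N, γ (n + h') (n + h')‖ ≤ (N : ℝ)⁻¹ * N := by gcongr
      have h2 : (N : ℝ)⁻¹ * N ≤ 1 := inv_mul_le_one
      linarith
    · set d := h - h' with hd
      have hdpos : d ≠ 0 := by omega
      have hdist : Nat.dist h h' = d := by simp [Nat.dist]; omega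
      filter_upwards [hs d η hη0, eventually_ge_atTop (⌈2 * (H : ℝ) / η⌉₊ + 1)] with N h1 h2
      have hN : (0 : ℝ) < N := by
        have : 0 < N := by omega
        exact_mod_cast this
      have h3 : 2 * (H : ℝ) / η ≤ N := by
        have := Nat.le_ceil (2 * (H : ℝ) / η)
        have h4 : ((⌈2 * (H : ℝ) / η⌉₊ : ℕ) : ℝ) ≤ N := Nat.cast_le.2 (by omega)
        linarith
      have h5 := norm_sum_shift_sub_le (a := fun n => γ (n + d) n) (fun n => hγ1 _ _) N h'
      have e : ∀ n, γ (n + h) (n + h') = γ (n + h' + d) (n + h') := fun n => by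
        rw [show n + h' + d = n + h by omega]
      simp only [← e] at h5
      rw [hdist]
      simp only [hb, if_neg hdpos]
      have h6 : ‖(1 / (N : ℂ)) * ∑ n ∈ Finset.Icc 1 N, γ (n + h) (n + h') -
          (1 / (N : ℂ)) * ∑ n ∈ Finset.Icc 1 N, γ (n + d) n‖ ≤ η := by
        rw [← mul_sub, norm_mul]
        simp only [one_div, norm_inv, Complex.norm_natCast]
        rw [inv_mul_le_iff₀ hN]
        rw [div_le_iff₀ hη0] at h3
        have : (h' : ℝ) ≤ H := by exact_mod_cast hh'.le
        linarith
      have h7 := norm_le_norm_add_norm_sub' ((1 / (N : ℂ)) * ∑ n ∈ Finset.Icc 1 N, γ (n + h) (n + h'))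
        ((1 / (N : ℂ)) * ∑ n ∈ Finset.Icc 1 N, γ (n + d) n)
      linarith
  have hcorr' : ∀ h ∈ Finset.range H, ∀ h' ∈ Finset.range H, ∀ᶠ N : ℕ in atTop,
      ‖(1 / (N : ℂ)) * ∑ n ∈ Finset.Icc 1 N, γ (n + h) (n + h')‖ ≤ b (Nat.dist h h') := by
    intro h hh h' hh'
    rw [Finset.mem_range] at hh hh'
    rcases le_total h' h with hle | hle
    · exact hcorr h h' hh' hle
    · filter_upwards [hcorr h' h hh hle] with N hN
      have : ∑ n ∈ Finset.Icc 1 N, γ (n + h) (n + h') =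
          starRingEnd ℂ (∑ n ∈ Finset.Icc 1 N, γ (n + h') (n + h)) := by
        rw [map_sum]; exact Finset.sum_congr rfl fun n _ => hγc _ _
      rw [this, norm_mul, RCLike.norm_conj, ← norm_mul, Nat.dist_comm]
      exact hN
  have hall : ∀ᶠ N : ℕ in atTop, ∀ h ∈ Finset.range H, ∀ h' ∈ Finset.range H,
      ‖(1 / (N : ℂ)) * ∑ n ∈ Finset.Icc 1 N, γ (n + h) (n + h')‖ ≤ b (Nat.dist h h') := by
    rw [Filter.eventually_all_finset]
    intro h hh
    rw [Filter.eventually_all_finset]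
    exact hcorr' h hh
  have htail : Tendsto (fun N : ℕ => 8 * ((H : ℝ) / N) ^ 2) atTop (𝓝 0) := by
    have h1 : Tendsto (fun N : ℕ => (H : ℝ) / N) atTop (𝓝 0) := tendsto_const_div_atTop_nhds_zero_nat _
    simpa using (h1.pow 2).const_mul 8
  filter_upwards [hall, eventually_ge_atTop 1, htail.eventually_lt_const (show 0 < ε / 2 by positivity)]
    with N hN hN1 hN2
  have hbd : ∀ n, BoundedBy μ 1 fun x => (1 / (H : ℂ)) * ∑ h ∈ Finset.range H, u (n + h) x :=
    fun n => by
      have h1 := (BoundedBy.const (μ := μ) (1 / (H : ℂ))).mul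
        (BoundedBy.sum (Finset.range H) (M := fun _ => 1) fun h _ => hu (n + h))
      refine h1.mono ?_
      simp [hH'.ne']
  have hint : ∀ n, Integrable
      (fun x => ‖(1 / (H : ℂ)) * ∑ h ∈ Finset.range H, u (n + h) x‖ ^ 2) μ := fun n =>
    ((hbd n).memLp 2).integrable_norm_pow (by norm_num)
  have hbN : BoundedBy μ 1 fun x => (1 / (N : ℂ)) * ∑ n ∈ Finset.Icc 1 N, u n x := by
    have h1 := (BoundedBy.const (μ := μ) (1 / (N : ℂ))).mul
      (BoundedBy.sum (Finset.Icc 1 N) (M := fun _ => 1) fun h _ => hu h)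
    refine h1.mono ?_
    have : (N : ℝ) ≠ 0 := by positivity
    simp [this]
  have hintavg : Integrable (fun x => avg (fun n => ‖(1 / (H : ℂ)) *
      ∑ h ∈ Finset.range H, u (n + h) x‖ ^ 2) N) μ :=
    (integrable_finsetSum _ fun n _ => hint n).const_mul _
  -- The window inequality is applied at almost every point and then integrated; expanding the
  -- square turns the windowed averages into the correlations `γ`.
  have hstep : ∫ x, ‖(1 / (N : ℂ)) * ∑ n ∈ Finset.Icc 1 N, u n x‖ ^ 2 ∂μ ≤
      ∫ x, (2 * avg (fun n => ‖(1 / (H : ℂ)) * ∑ h ∈ Finset.range H, u (n + h) x‖ ^ 2) N +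
        8 * (H / N) ^ 2) ∂μ := by
    refine integral_mono_ae ((hbN.memLp 2).integrable_norm_pow (by norm_num))
      ((hintavg.const_mul 2).add (integrable_const _)) ?_
    filter_upwards [ae_all_iff.2 fun n => (hu n).2] with x hx
    exact norm_average_sq_le_window hx hH hN1
  refine hstep.trans ?_
  rw [integral_add (hintavg.const_mul 2) (integrable_const _), integral_const_mul]
  have hswap : ∫ x, avg (fun n => ‖(1 / (H : ℂ)) * ∑ h ∈ Finset.range H, u (n + h) x‖ ^ 2) N ∂μ =
      (1 / (H : ℝ)) ^ 2 * ∑ h ∈ Finset.range H, ∑ h' ∈ Finset.range H,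
        ((1 / (N : ℂ)) * ∑ n ∈ Finset.Icc 1 N, γ (n + h) (n + h')).re := by
    simp only [avg]
    rw [integral_const_mul, integral_finsetSum _ fun n _ => hint n]
    have e1 : ∀ n, ∫ x, ‖(1 / (H : ℂ)) * ∑ h ∈ Finset.range H, u (n + h) x‖ ^ 2 ∂μ =
        (1 / (H : ℝ)) ^ 2 * ∑ h ∈ Finset.range H, ∑ h' ∈ Finset.range H, (γ (n + h) (n + h')).re := by
      intro n
      simp only [norm_mul, mul_pow]
      rw [integral_const_mul, integral_norm_sum_sq (Finset.range H) (v := fun h => u (n + h))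
        fun h => hu (n + h)]
      simp [hγ]
    simp only [e1]
    rw [← Finset.mul_sum, ← mul_assoc, mul_comm (1 / (N : ℝ)), mul_assoc]
    congr 1
    rw [Finset.sum_comm, Finset.mul_sum]
    refine Finset.sum_congr rfl fun h _ => ?_
    rw [Finset.sum_comm, Finset.mul_sum]
    refine Finset.sum_congr rfl fun h' _ => ?_
    have : (1 / (N : ℂ)) = ((1 / (N : ℝ) : ℝ) : ℂ) := by push_cast; rfl
    rw [this, Complex.re_ofReal_mul, Complex.re_sum]
  rw [hswap]
  have hsum : ∑ h ∈ Finset.range H, ∑ h' ∈ Finset.range H,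
      ((1 / (N : ℂ)) * ∑ n ∈ Finset.Icc 1 N, γ (n + h) (n + h')).re ≤
        2 * H * ∑ d ∈ Finset.range H, b d := by
    refine le_trans ?_ (sum_dist_le hb0 H)
    exact Finset.sum_le_sum fun h hh => Finset.sum_le_sum fun h' hh' =>
      (Complex.re_le_norm _).trans (hN h hh h' hh')
  have hsumb : ∑ d ∈ Finset.range H, b d ≤ 1 + ∑ d ∈ Finset.Icc 1 H, s d + 2 * η * H := by
    simp only [hb, Finset.sum_add_distrib, Finset.sum_const, Finset.card_range, nsmul_eq_mul]
    have : ∑ d ∈ Finset.range H, (if d = 0 then (1 : ℝ) else s d) ≤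
        1 + ∑ d ∈ Finset.Icc 1 H, s d := by
      obtain ⟨K, rfl⟩ : ∃ K, H = K + 1 := ⟨H - 1, by omega⟩
      rw [Finset.sum_range_succ', if_pos rfl, add_comm]
      simp only [Nat.add_eq_zero_iff, one_ne_zero, and_false, if_false]
      have h2 : ∑ d ∈ Finset.range K, s (d + 1) = ∑ d ∈ Finset.Icc 1 K, s d := by
        rw [Finset.range_eq_Ico, Finset.sum_Ico_add' s 0 K 1]
        rfl
      rw [h2]
      refine add_le_add le_rfl (Finset.sum_le_sum_of_subset_of_nonneg ?_ fun d _ _ => hs0 d)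
      exact Finset.Icc_subset_Icc le_rfl (by omega)
    linarith
  have hfin : (1 / (H : ℝ)) ^ 2 * ∑ h ∈ Finset.range H, ∑ h' ∈ Finset.range H,
        ((1 / (N : ℂ)) * ∑ n ∈ Finset.Icc 1 N, γ (n + h) (n + h')).re ≤
      2 / H + 2 * avg s H + 4 * η := by
    calc _ ≤ (1 / (H : ℝ)) ^ 2 * (2 * H * (1 + ∑ d ∈ Finset.Icc 1 H, s d + 2 * η * H)) := by
          refine mul_le_mul_of_nonneg_left (hsum.trans ?_) (by positivity)
          exact mul_le_mul_of_nonneg_left hsumb (by positivity)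
      _ = 2 / H + 2 * avg s H + 4 * η := by
          rw [avg]; field_simp; ring
  simp only [integral_const, probReal_univ, smul_eq_mul, one_mul]
  have : (4 : ℝ) / H = 2 * (2 / H) := by ring
  linarith

/-! ### Norms and inner products in `L²` as integrals -/

theorem inner_toLp {f g : X → ℂ} (hf : MemLp f 2 μ) (hg : MemLp g 2 μ) :
    inner ℂ (hg.toLp g) (hf.toLp f) = ∫ x, f x * starRingEnd ℂ (g x) ∂μ := by
  rw [L2.inner_def]
  refine integral_congr_ae ?_
  filter_upwards [hf.coeFn_toLp, hg.coeFn_toLp] with x h1 h2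
  rw [h1, h2, RCLike.inner_apply]

theorem inner_Lp (F G : Lp ℂ 2 μ) : inner ℂ G F = ∫ x, F x * starRingEnd ℂ (G x) ∂μ := by
  rw [L2.inner_def]
  simp only [RCLike.inner_apply]

theorem norm_Lp_sq (F : Lp ℂ 2 μ) : ‖F‖ ^ 2 = ∫ x, ‖F x‖ ^ 2 ∂μ := by
  have h := inner_self_eq_norm_sq_to_K (𝕜 := ℂ) F
  rw [inner_Lp] at h
  simp only [Complex.mul_conj'] at h
  have e : (∫ x, (‖F x‖ : ℂ) ^ 2 ∂μ) = ((∫ x, ‖F x‖ ^ 2 ∂μ : ℝ) : ℂ) := by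
    rw [← integral_complex_ofReal]; push_cast; rfl
  rw [e] at h
  exact Complex.ofReal_injective (by rw [h]; push_cast; rfl)

theorem norm_toLp_sq {f : X → ℂ} (hf : MemLp f 2 μ) : ‖hf.toLp f‖ ^ 2 = ∫ x, ‖f x‖ ^ 2 ∂μ := by
  rw [norm_Lp_sq]
  refine integral_congr_ae ?_
  filter_upwards [hf.coeFn_toLp] with x hx
  rw [hx]

theorem norm_integral_mul_le [IsProbabilityMeasure μ] {g a : X → ℂ} (hg : BoundedBy μ 1 g)
    (ha : MemLp a 2 μ) : ‖∫ x, g x * a x ∂μ‖ ^ 2 ≤ ∫ x, ‖a x‖ ^ 2 ∂μ := by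
  have hgc := hg.conj.memLp 2
  have h1 : ∫ x, g x * a x ∂μ = inner ℂ (hgc.toLp _) (ha.toLp a) := by
    rw [inner_toLp]
    simp only [RingHomCompTriple.comp_apply, RingHom.id_apply, mul_comm]
  have h2 := norm_inner_le_norm (𝕜 := ℂ) (hgc.toLp _) (ha.toLp a)
  have h3 : ‖hgc.toLp _‖ ^ 2 ≤ 1 := by
    rw [norm_toLp_sq]
    have : ∫ x, ‖starRingEnd ℂ (g x)‖ ^ 2 ∂μ ≤ ∫ _, (1 : ℝ) ∂μ := by
      refine integral_mono_ae (hgc.integrable_norm_pow (by norm_num)) (integrable_const _) ?_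
      filter_upwards [hg.conj.2] with x hx
      exact pow_le_one₀ (norm_nonneg _) hx
    simpa using this
  rw [h1, ← norm_toLp_sq ha]
  have h4 : ‖hgc.toLp _‖ ≤ 1 := (sq_le_one_iff₀ (norm_nonneg _)).1 h3
  refine pow_le_pow_left₀ (norm_nonneg _) (h2.trans ?_) 2
  exact mul_le_of_le_one_left (norm_nonneg _) h4

/-! ### The mean ergodic theorem -/

/-- By von Neumann's theorem the averages converge in `L²` to the projection onto the invariant
functions. Ergodicity makes the projection a constant, and pairing with `1` identifies the constant
as the integral. -/
theorem tendsto_integral_norm_average_sq [IsProbabilityMeasure μ] (hφ : Ergodic φ μ)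
    {f : X → ℂ} (hf : MemLp f 2 μ) :
    Tendsto (fun N : ℕ => ∫ x, ‖(1 / (N : ℂ)) * ∑ n ∈ Finset.Icc 1 N, koopman φ n f x‖ ^ 2 ∂μ)
      atTop (𝓝 (‖∫ x, f x ∂μ‖ ^ 2)) := by
  have hmp : MeasurePreserving φ μ μ := hφ.toMeasurePreserving
  set F := hf.toLp f
  set U : Lp ℂ 2 μ →L[ℂ] Lp ℂ 2 μ :=
    (Lp.compMeasurePreservingₗᵢ ℂ φ hmp).toContinuousLinearMap
  have hU : ∀ G : Lp ℂ 2 μ, U G =ᵐ[μ] fun x => G (φ x) := fun G =>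
    Lp.coeFn_compMeasurePreserving G hmp
  have hUn : ∀ n : ℕ, (U^[n] F : X → ℂ) =ᵐ[μ] koopman φ n f := by
    intro n
    induction n with
    | zero => simpa [koopman_zero] using hf.coeFn_toLp
    | succ n ih =>
      rw [Function.iterate_succ_apply']
      filter_upwards [hU (U^[n] F), hmp.quasiMeasurePreserving.ae ih] with x h1 h2
      rw [h1, h2]
      simp only [koopman]
      rw [show ((n + 1 : ℕ) : ℤ) = (n : ℤ) + 1 by push_cast; ring, zpow_add, zpow_one]
      rfl
  have key := U.tendsto_birkhoffAverage_orthogonalProjection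
    (LinearIsometry.norm_toContinuousLinearMap_le _) F
  set G := (U.eqLocus (1 : Lp ℂ 2 μ →L[ℂ] Lp ℂ 2 μ)).orthogonalProjectionOnto F with hG
  have hnorm : ∀ N : ℕ, ‖birkhoffAverage ℂ U _root_.id N F‖ ^ 2 =
      ∫ x, ‖(1 / (N : ℂ)) * ∑ n ∈ Finset.Icc 1 N, koopman φ n f x‖ ^ 2 ∂μ := by
    intro N
    -- Birkhoff averages run over `0, …, N - 1`, the averages here over `1, …, N`; composing with
    -- `φ` once changes one into the other and preserves the norm.
    rw [norm_Lp_sq, ← integral_comp_zpow hmp 1]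
    refine integral_congr_ae ?_
    have h0 : ((birkhoffAverage ℂ U _root_.id N F : Lp ℂ 2 μ) : X → ℂ) =ᵐ[μ]
        fun x => (N : ℂ)⁻¹ * ∑ k ∈ Finset.range N, koopman φ k f x := by
      unfold birkhoffAverage birkhoffSum
      have h2 : ((∑ k ∈ Finset.range N, U^[k] F : Lp ℂ 2 μ) : X → ℂ) =ᵐ[μ]
          fun x => ∑ k ∈ Finset.range N, (U^[k] F : Lp ℂ 2 μ) x := by
        filter_upwards [Lp.coeFn_finsetSum (Finset.range N) (fun k => U^[k] F)] with x hx
        rw [hx, Finset.sum_apply]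
      filter_upwards [Lp.coeFn_smul ((N : ℂ)⁻¹) (∑ k ∈ Finset.range N, _root_.id (U^[k] F)),
        h2, ae_all_iff.2 hUn] with x h3 h4 h5
      rw [h3, Pi.smul_apply, smul_eq_mul]
      simp only [_root_.id]
      rw [h4]
      simp only [h5]
    filter_upwards [ae_zpow hmp 1 h0] with x hx
    rw [hx, one_div, Finset.range_eq_Ico]
    have := Finset.sum_Ico_add' (fun k : ℕ => koopman φ k f x) 0 N 1
    rw [zero_add] at this
    have e : Finset.Icc 1 N = Finset.Ico 1 (N + 1) := by ext; simp
    rw [e, ← this]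
    congr 3
  have hlim : Tendsto (fun N : ℕ => ‖birkhoffAverage ℂ U _root_.id N F‖ ^ 2) atTop
      (𝓝 (‖(G : Lp ℂ 2 μ)‖ ^ 2)) := (key.norm).pow 2
  simp only [hnorm] at hlim
  convert hlim using 2
  have hGfix : U G = G := by
    exact G.2
  obtain ⟨c, hc⟩ : ∃ c, ((G : Lp ℂ 2 μ) : X → ℂ) =ᵐ[μ] Function.const X c := by
    refine hφ.ae_eq_const_of_ae_eq_comp_ae (Lp.aestronglyMeasurable _) ?_
    have := hU G
    rw [hGfix] at this
    exact this.symm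
  have h1m : MemLp (fun _ : X => (1 : ℂ)) 2 μ := memLp_const 1
  have h1fix : h1m.toLp _ ∈ U.eqLocus (1 : Lp ℂ 2 μ →L[ℂ] Lp ℂ 2 μ) := by
    change U (h1m.toLp _) = h1m.toLp _
    refine Lp.ext ?_
    filter_upwards [hU (h1m.toLp _), h1m.coeFn_toLp,
      hmp.quasiMeasurePreserving.ae h1m.coeFn_toLp] with x h1 h2 h3
    rw [h1, h2, h3]
  have hin := Submodule.inner_orthogonalProjectionOnto_eq_of_mem_left
    (K := U.eqLocus (1 : Lp ℂ 2 μ →L[ℂ] Lp ℂ 2 μ)) ⟨_, h1fix⟩ F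
  have hin2 : inner ℂ (h1m.toLp _) (G : Lp ℂ 2 μ) = inner ℂ (h1m.toLp _) F := hin
  rw [inner_toLp, inner_Lp] at hin2
  have hL : ∫ x, (G : Lp ℂ 2 μ) x * starRingEnd ℂ (h1m.toLp _ x) ∂μ = c := by
    have : (fun x => (G : Lp ℂ 2 μ) x * starRingEnd ℂ (h1m.toLp _ x)) =ᵐ[μ] fun _ => c := by
      filter_upwards [hc, h1m.coeFn_toLp] with x h1 h2
      rw [h1, h2]; simp
    rw [integral_congr_ae this]; simp
  rw [hL] at hin2
  have hG2 : ‖(G : Lp ℂ 2 μ)‖ ^ 2 = ‖c‖ ^ 2 := by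
    rw [norm_Lp_sq]
    have : (fun x => ‖(G : Lp ℂ 2 μ) x‖ ^ 2) =ᵐ[μ] fun _ => ‖c‖ ^ 2 := by
      filter_upwards [hc] with x h1
      rw [h1]; rfl
    rw [integral_congr_ae this]; simp
  rw [hG2, hin2]
  simp

/-! ### Multiple averages along progressions are controlled by uniformity seminorms -/

/-- The summand `∏_{i=1}^k T^{σ i n} f_i` of an average along the progression `σ, 2σ, …, kσ`. -/
noncomputable def progTerm (φ : X ≃ᵐ X) (σ : ℤ) (k : ℕ) (f : ℕ → X → ℂ) (n : ℕ) : X → ℂ :=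
  fun x => ∏ i ∈ Finset.Icc 1 k, koopman φ (σ * i * n) (f i) x

/-- The average of `∏_{i=1}^k T^{σ i n} f_i` over `1 ≤ n ≤ N`. -/
noncomputable def progAverage (φ : X ≃ᵐ X) (σ : ℤ) (k : ℕ) (f : ℕ → X → ℂ) (N : ℕ) : X → ℂ :=
  fun x => (1 / (N : ℂ)) * ∑ n ∈ Finset.Icc 1 N, progTerm φ σ k f n x

theorem boundedBy_progTerm (hφ : MeasurePreserving φ μ μ) (σ : ℤ) (k : ℕ) {f : ℕ → X → ℂ}
    (hf : ∀ i, BoundedBy μ 1 (f i)) (n : ℕ) : BoundedBy μ 1 (progTerm φ σ k f n) :=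
  BoundedBy.prod _ fun i _ => (hf i).koopman hφ _

theorem BoundedBy.average {u : ℕ → X → ℂ} {M : ℝ} (hM : 0 ≤ M) (hu : ∀ n, BoundedBy μ M (u n))
    (N : ℕ) : BoundedBy μ M fun x => (1 / (N : ℂ)) * ∑ n ∈ Finset.Icc 1 N, u n x := by
  have h1 := (BoundedBy.const (μ := μ) (1 / (N : ℂ))).mul
    (BoundedBy.sum (Finset.Icc 1 N) (M := fun _ => M) fun h _ => hu h)
  refine h1.mono ?_
  rcases Nat.eq_zero_or_pos N with rfl | hN
  · simpa using hM
  · have : (N : ℝ) ≠ 0 := by positivity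
    simp [this]

theorem integral_average {u : ℕ → X → ℂ} (hu : ∀ n, Integrable (u n) μ) (N : ℕ) :
    ∫ x, (1 / (N : ℂ)) * ∑ n ∈ Finset.Icc 1 N, u n x ∂μ =
      (1 / (N : ℂ)) * ∑ n ∈ Finset.Icc 1 N, ∫ x, u n x ∂μ := by
  rw [integral_const_mul, integral_finsetSum _ fun n _ => hu n]

/-- The correlations in van der Corput's inequality are again progression terms, of multiplicative
derivatives. This is what lets the induction in `progAverage_bound` close. -/
theorem progTerm_mul_conj (σ : ℤ) (k : ℕ) (f : ℕ → X → ℂ) (n d : ℕ) (x : X) :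
    progTerm φ σ k f (n + d) x * starRingEnd ℂ (progTerm φ σ k f n x) =
      progTerm φ σ k (fun i => multDeriv φ (σ * i * d) (f i)) n x := by
  simp only [progTerm, map_prod]
  rw [← Finset.prod_mul_distrib]
  refine Finset.prod_congr rfl fun i _ => ?_
  have h := koopman_koopman (φ := φ) (σ * i * n) (σ * i * d) (f i)
  have e : σ * i * n + σ * i * d = σ * i * ((n + d : ℕ) : ℤ) := by push_cast; ring
  rw [e] at h
  rw [← h]
  simp only [multDeriv, koopman]

/-- Dropping the first function of a progression. -/
theorem integral_progTerm_first (hφ : MeasurePreserving φ μ μ) (σ : ℤ) (k : ℕ) (F : ℕ → X → ℂ)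
    (n : ℕ) : ∫ x, progTerm φ σ (k + 1) F n x ∂μ =
      ∫ x, F 1 x * progTerm φ σ k (fun i => F (i + 1)) n x ∂μ := by
  rw [← integral_koopman hφ (-(σ * n))]
  refine integral_congr_ae (ae_of_all _ fun x => ?_)
  have h1 : koopman φ (-(σ * n)) (progTerm φ σ (k + 1) F n) x =
      ∏ i ∈ Finset.Icc 1 (k + 1), koopman φ (σ * (i - 1 : ℤ) * n) (F i) x := by
    simp only [koopman, progTerm]
    refine Finset.prod_congr rfl fun i _ => ?_
    rw [← Equiv.Perm.mul_apply, ← zpow_add]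
    congr 3; ring
  simp only
  rw [h1, ← Finset.mul_prod_Ioc_eq_prod_Icc (by omega)]
  congr 1
  · norm_num [koopman_zero]
  · rw [progTerm, show Finset.Ioc 1 (k + 1) = (Finset.Icc 1 k).map (addRightEmbedding 1) by
      rw [Finset.map_add_right_Icc]; ext; simp; omega, Finset.prod_map]
    refine Finset.prod_congr rfl fun i _ => ?_
    simp

/-- Dropping the last function of a progression. -/
theorem integral_progTerm_last (hφ : MeasurePreserving φ μ μ) (σ : ℤ) (k : ℕ) (F : ℕ → X → ℂ)
    (n : ℕ) : ∫ x, progTerm φ σ (k + 1) F n x ∂μ =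
      ∫ x, F (k + 1) x * progTerm φ (-σ) k (fun i => F (k + 1 - i)) n x ∂μ := by
  rw [← integral_koopman hφ (-(σ * (k + 1) * n))]
  refine integral_congr_ae (ae_of_all _ fun x => ?_)
  have h1 : koopman φ (-(σ * (k + 1) * n)) (progTerm φ σ (k + 1) F n) x =
      ∏ i ∈ Finset.Icc 1 (k + 1), koopman φ (σ * (i - (k + 1) : ℤ) * n) (F i) x := by
    simp only [koopman, progTerm]
    refine Finset.prod_congr rfl fun i _ => ?_
    rw [← Equiv.Perm.mul_apply, ← zpow_add]
    congr 3; ring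
  simp only
  rw [h1, Finset.prod_Icc_succ_top (by omega), mul_comm]
  congr 1
  · norm_num [koopman_zero]
  · rw [progTerm]
    refine Finset.prod_bij' (fun i _ => k + 1 - i) (fun i _ => k + 1 - i) ?_ ?_ ?_ ?_ ?_
    · intro i hi; simp only [Finset.mem_Icc] at hi ⊢; omega
    · intro i hi; simp only [Finset.mem_Icc] at hi ⊢; omega
    · intro i hi; simp only [Finset.mem_Icc] at hi; omega
    · intro i hi; simp only [Finset.mem_Icc] at hi; omega
    · intro i hi
      simp only [Finset.mem_Icc] at hi
      rw [show k + 1 - (k + 1 - i) = i by omega]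
      congr 2
      rw [Nat.cast_sub (by omega)]
      push_cast; ring

/-! ### Power means, and averages along multiples -/

theorem avg_pow_le {a : ℕ → ℝ} (ha : ∀ n, 0 ≤ a n) {p : ℕ} (hp : p ≠ 0) (N : ℕ) :
    avg a N ^ p ≤ avg (fun n => a n ^ p) N := by
  rcases Nat.eq_zero_or_pos N with rfl | hN
  · simp [avg, hp]
  have hN' : (N : ℝ) ≠ 0 := by positivity
  have := Real.pow_arith_mean_le_arith_mean_pow (Finset.Icc 1 N) (fun _ => 1 / (N : ℝ)) a
    (fun _ _ => by positivity) (by simp [hN']) (fun n _ => ha n) p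
  simpa only [avg, Finset.mul_sum] using this

/-- By nonnegativity the sum over multiples of `t` can be completed to all of `1, …, t N`; the
factor `t` is the change of normalisation. -/
theorem avg_multiples_le {a : ℕ → ℝ} (ha : ∀ n, 0 ≤ a n) {t : ℕ} (ht : 1 ≤ t) (N : ℕ) :
    avg (fun n => a (t * n)) N ≤ t * avg a (t * N) := by
  rcases Nat.eq_zero_or_pos N with rfl | hN
  · simp [avg]
  have hN' : (0 : ℝ) < N := by exact_mod_cast hN
  have ht' : (0 : ℝ) < t := by exact_mod_cast ht
  have h1 : ∑ n ∈ Finset.Icc 1 N, a (t * n) ≤ ∑ n ∈ Finset.Icc 1 (t * N), a n := by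
    rw [← Finset.sum_image (f := a) (g := fun n => t * n)]
    · refine Finset.sum_le_sum_of_subset_of_nonneg ?_ fun d _ _ => ha d
      intro d hd
      simp only [Finset.mem_image, Finset.mem_Icc] at hd ⊢
      obtain ⟨n, ⟨h1, h2⟩, rfl⟩ := hd
      exact ⟨Nat.mul_pos ht h1, Nat.mul_le_mul_left t h2⟩
    · intro x _ y _ hxy
      exact Nat.eq_of_mul_eq_mul_left ht hxy
  simp only [avg]
  push_cast
  calc 1 / (N : ℝ) * ∑ n ∈ Finset.Icc 1 N, a (t * n)
      ≤ 1 / (N : ℝ) * ∑ n ∈ Finset.Icc 1 (t * N), a n := by gcongr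
    _ = _ := by field_simp

theorem exists_pow_le_imp_le {y : ℝ} (hy : 0 ≤ y) {p : ℕ} (hp : p ≠ 0) {η : ℝ} (hη : 0 < η) :
    ∃ δ > 0, ∀ x, x ^ p ≤ y ^ p + δ → x ≤ y + η := by
  refine ⟨(y + η) ^ p - y ^ p, sub_pos.2 (pow_lt_pow_left₀ (by linarith) hy hp), fun x hx => ?_⟩
  rw [add_sub_cancel] at hx
  exact le_of_pow_le_pow_left₀ hp (by linarith) hx

/-- The generalised von Neumann theorem. By van der Corput it suffices to bound the correlations,
which are integrals of progressions of derivatives; invariance of `μ` frees one function of its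
shift, and Cauchy–Schwarz leaves a progression with one function fewer. The freed function must not
be the `t`-th. For `t > 1` it is the first; for `t = 1` it is the last, which reverses the direction
of the progression, and this is why both signs of `σ` are carried along. The constant has to be
independent of the functions, since the induction hypothesis is applied to derivatives with varying
`d`. -/
theorem progAverage_bound [IsProbabilityMeasure μ] (hφ : Ergodic φ μ) (k : ℕ) :
    ∃ C : ℝ, 0 ≤ C ∧ ∀ σ : ℤ, (σ = 1 ∨ σ = -1) → ∀ f : ℕ → X → ℂ, (∀ i, BoundedBy μ 1 (f i)) →
      ∀ t : ℕ, 1 ≤ t → t ≤ k + 1 → ∀ ε > 0, ∀ᶠ N : ℕ in atTop,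
        ∫ x, ‖progAverage φ σ (k + 1) f N x‖ ^ 2 ∂μ ≤
          C * uniformitySeminorm φ μ (k + 1) (f t) ^ 2 + ε := by
  have hmp : MeasurePreserving φ μ μ := hφ.toMeasurePreserving
  induction k with
  | zero =>
    refine ⟨1, zero_le_one, fun σ hσ f hf t ht1 ht2 ε hε => ?_⟩
    obtain rfl : t = 1 := by omega
    have hlim := tendsto_integral_norm_average_sq hφ ((hf 1).memLp 2)
    have e : ∀ N : ℕ, ∫ x, ‖progAverage φ σ (0 + 1) f N x‖ ^ 2 ∂μ =
        ∫ x, ‖(1 / (N : ℂ)) * ∑ n ∈ Finset.Icc 1 N, koopman φ n (f 1) x‖ ^ 2 ∂μ := by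
      intro N
      rcases hσ with rfl | rfl
      · simp [progAverage, progTerm]
      -- Composing with `φ^{N+1}` turns the exponents `-1, …, -N` into `N, …, 1`.
      · rw [← integral_comp_zpow hmp (N + 1)]
        refine integral_congr_ae (ae_of_all _ fun x => ?_)
        have hx : progAverage φ (-1) (0 + 1) f N (((φ.toEquiv : Equiv.Perm X) ^ ((N : ℤ) + 1)) x) =
            (1 / (N : ℂ)) * ∑ n ∈ Finset.Icc 1 N, koopman φ n (f 1) x := ?_
        · simp only [hx]
        unfold progAverage
        congr 1
        refine Finset.sum_bij' (fun i _ => N + 1 - i) (fun i _ => N + 1 - i) ?_ ?_ ?_ ?_ ?_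
        · intro i hi; simp only [Finset.mem_Icc] at hi ⊢; omega
        · intro i hi; simp only [Finset.mem_Icc] at hi ⊢; omega
        · intro i hi; simp only [Finset.mem_Icc] at hi; omega
        · intro i hi; simp only [Finset.mem_Icc] at hi; omega
        · intro i hi
          simp only [Finset.mem_Icc] at hi
          simp only [progTerm, zero_add, Finset.Icc_self, Finset.prod_singleton, koopman]
          rw [← Equiv.Perm.mul_apply, ← zpow_add, Nat.cast_sub (by omega)]
          congr 3; push_cast; ring
    simp only [e]
    have := hlim.eventually_lt_const (show ‖∫ x, f 1 x ∂μ‖ ^ 2 < ‖∫ x, f 1 x ∂μ‖ ^ 2 + ε by linarith)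
    filter_upwards [this] with N hN
    simpa [uniformitySeminorm] using hN.le
  | succ k ih =>
    obtain ⟨C, hC, h⟩ := ih
    -- The `4` is from van der Corput, `√C` from Cauchy–Schwarz for the correlations, and `k + 2 ≥
    -- t` pays for averaging derivatives only over multiples of `t`.
    refine ⟨4 * √C * (k + 2), by positivity, fun σ hσ f hf t ht1 ht2 ε hε => ?_⟩
    set F : ℕ → ℕ → X → ℂ := fun d i => multDeriv φ (σ * i * d) (f i) with hF
    have hFb : ∀ d i, BoundedBy μ 1 (F d i) := fun d i => by
      simpa using (hf i).multDeriv hmp (σ * i * d)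
    set s : ℕ → ℝ := fun d => √C * uniformitySeminorm φ μ (k + 1) (F d t) with hs
    have hs0 : ∀ d, 0 ≤ s d := fun d => mul_nonneg (Real.sqrt_nonneg _) (uniformitySeminorm_nonneg _ _)
    have hred : ∀ d : ℕ, ∃ σ' : ℤ, (σ' = 1 ∨ σ' = -1) ∧ ∃ g : X → ℂ, BoundedBy μ 1 g ∧
        ∃ G : ℕ → X → ℂ, (∀ i, BoundedBy μ 1 (G i)) ∧ ∃ t', 1 ≤ t' ∧ t' ≤ k + 1 ∧ G t' = F d t ∧
        ∀ n, ∫ x, progTerm φ σ (k + 2) (F d) n x ∂μ =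
          ∫ x, g x * progTerm φ σ' (k + 1) G n x ∂μ := by
      intro d
      rcases ht1.eq_or_lt with rfl | ht
      · refine ⟨-σ, by rcases hσ with rfl | rfl <;> simp, F d (k + 2), hFb _ _,
          fun i => F d (k + 2 - i), fun i => hFb _ _, k + 1, by omega, le_rfl, ?_,
          fun n => integral_progTerm_last hmp σ (k + 1) (F d) n⟩
        simp only [show k + 2 - (k + 1) = 1 by omega]
      · refine ⟨σ, hσ, F d 1, hFb _ _, fun i => F d (i + 1), fun i => hFb _ _, t - 1, by omega,
          by omega, ?_, fun n => integral_progTerm_first hmp σ (k + 1) (F d) n⟩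
        simp only [show t - 1 + 1 = t by omega]
    have hcorr : ∀ d, ∀ ε > 0, ∀ᶠ N : ℕ in atTop, ‖(1 / (N : ℂ)) * ∑ n ∈ Finset.Icc 1 N,
        ∫ x, progTerm φ σ (k + 2) f (n + d) x *
          starRingEnd ℂ (progTerm φ σ (k + 2) f n x) ∂μ‖ ≤ s d + ε := by
      intro d ε hε
      obtain ⟨σ', hσ', g, hg, G, hG, t', ht1', ht2', hGt, hint⟩ := hred d
      filter_upwards [h σ' hσ' G hG t' ht1' ht2' (ε ^ 2) (by positivity)] with N hN
      have hb : BoundedBy μ 1 (progAverage φ σ' (k + 1) G N) :=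
        BoundedBy.average zero_le_one (boundedBy_progTerm hmp σ' (k + 1) hG) N
      have e : (1 / (N : ℂ)) * ∑ n ∈ Finset.Icc 1 N, ∫ x, progTerm φ σ (k + 2) f (n + d) x *
          starRingEnd ℂ (progTerm φ σ (k + 2) f n x) ∂μ =
          ∫ x, g x * progAverage φ σ' (k + 1) G N x ∂μ := by
        have h1 := integral_average (μ := μ) (u := fun n x => g x * progTerm φ σ' (k + 1) G n x)
          (fun n => (hg.mul (boundedBy_progTerm hmp σ' (k + 1) hG n)).integrable) N
        have h2 : ∀ x, g x * progAverage φ σ' (k + 1) G N x = (1 / (N : ℂ)) *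
            ∑ n ∈ Finset.Icc 1 N, g x * progTerm φ σ' (k + 1) G n x := fun x => by
          rw [progAverage, ← Finset.mul_sum]; ring
        simp only [h2]
        rw [h1]
        simp only [progTerm_mul_conj, ← hint]
        rfl
      rw [e]
      have h3 := (norm_integral_mul_le hg (hb.memLp 2)).trans hN
      rw [hGt] at h3
      refine le_of_pow_le_pow_left₀ two_ne_zero (by linarith [hs0 d]) (h3.trans ?_)
      simp only [hs]
      have h4 : (√C * uniformitySeminorm φ μ (k + 1) (F d t)) ^ 2 =
          C * uniformitySeminorm φ μ (k + 1) (F d t) ^ 2 := by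
        rw [mul_pow, Real.sq_sqrt hC]
      have h5 : 0 ≤ √C * uniformitySeminorm φ μ (k + 1) (F d t) := hs0 d
      nlinarith
    set p := 2 ^ (k + 1) with hp
    have hp0 : p ≠ 0 := by positivity
    set y : ℝ := (k + 2) * uniformitySeminorm φ μ (k + 2) (f t) ^ 2 with hy
    have hy0 : 0 ≤ y := by positivity
    set η : ℝ := ε / (16 * (√C + 1)) with hη
    have hη0 : 0 < η := by positivity
    obtain ⟨δ, hδ, hroot⟩ := exists_pow_le_imp_le hy0 hp0 hη0
    set a : ℕ → ℝ := fun n => uPow φ μ (k + 1) (multDeriv φ n (f t)) with ha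
    have ha0 : ∀ n, 0 ≤ a n := fun n => uPow_nonneg _ _
    have haF : ∀ d, uniformitySeminorm φ μ (k + 1) (F d t) ^ p = a (t * d) := by
      intro d
      change uPow φ μ (k + 1) (multDeriv φ (σ * t * d) (f t)) = _
      rcases hσ with rfl | rfl
      · simp [ha]
      · rw [show (-1 : ℤ) * t * d = -((t : ℤ) * d) by ring, uPow_multDeriv_neg hmp]
        simp [ha]
    have hlimsup : limsup (avg a) atTop = uPow φ μ (k + 2) (f t) := (uPow_succ k (f t)).symm
    have hev : ∀ᶠ N : ℕ in atTop, avg a N < uPow φ μ (k + 2) (f t) + δ / t := by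
      refine eventually_lt_of_limsup_lt' (K := 1) (fun N => avg_le zero_le_one (fun n => ?_) N) ?_
      · simpa using uPow_le hmp k ((hf t).multDeriv hmp n)
      · rw [hlimsup]
        have : (0 : ℝ) < δ / t := div_pos hδ (by exact_mod_cast ht1)
        linarith
    obtain ⟨N0, hN0⟩ := eventually_atTop.1 hev
    -- The window must be long enough for the average of `a` up to `t H` to be near its limsup and
    -- for `4 / H ≤ ε / 4`.
    set H := max N0 (⌈16 / ε⌉₊ + 1) with hH
    have hH1 : 1 ≤ H := le_trans (by omega) (le_max_right _ _)
    have hH2 : N0 ≤ t * H := (le_max_left N0 _).trans (Nat.le_mul_of_pos_left _ ht1)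
    have ht' : (1 : ℝ) ≤ t := by exact_mod_cast ht1
    have hHε : 4 / (H : ℝ) ≤ ε / 4 := by
      have h1 : 16 / ε ≤ H := by
        refine (Nat.le_ceil _).trans ?_
        exact_mod_cast le_trans (by omega : ⌈16 / ε⌉₊ ≤ ⌈16 / ε⌉₊ + 1) (le_max_right _ _)
      have h2 : (0 : ℝ) < H := by exact_mod_cast hH1
      rw [div_le_iff₀ hε] at h1
      rw [div_le_iff₀ h2]
      linarith
    -- The definition of the seminorm controls the average of the powers `2^{k+1}`; the power mean
    -- inequality passes to first powers.
    have havg : avg (fun d => uniformitySeminorm φ μ (k + 1) (F d t)) H ≤ y + η := by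
      apply hroot
      refine (avg_pow_le (fun d => uniformitySeminorm_nonneg _ _) hp0 H).trans ?_
      simp only [haF]
      refine (avg_multiples_le ha0 ht1 H).trans ?_
      have h1 := (hN0 _ hH2).le
      have h2 : (t : ℝ) * avg a (t * H) ≤ t * (uPow φ μ (k + 2) (f t) + δ / t) := by gcongr
      have h3 : (t : ℝ) * (uPow φ μ (k + 2) (f t) + δ / t) = t * uPow φ μ (k + 2) (f t) + δ := by
        field_simp
      -- The square in `y` raised to `p = 2^{k+1}` is the exponent `2^{k+2}`, and `t ≤ k + 2 ≤ (k +
      -- 2)^p`.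
      have h4 : t * uPow φ μ (k + 2) (f t) ≤ y ^ p := by
        rw [hy, mul_pow, ← pow_mul, hp, ← pow_succ']
        refine mul_le_mul_of_nonneg_right ?_ (uPow_nonneg _ _)
        have h5 : (t : ℝ) ≤ k + 2 := by exact_mod_cast ht2
        exact h5.trans (le_self_pow₀ (by linarith) hp0)
      linarith
    have hfin : 4 * avg s H ≤ 4 * √C * (k + 2) * uniformitySeminorm φ μ (k + 2) (f t) ^ 2 + ε / 4 := by
      have h1 : avg s H = √C * avg (fun d => uniformitySeminorm φ μ (k + 1) (F d t)) H :=
        avg_const_mul _ _ _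
      have h2 : √C * avg (fun d => uniformitySeminorm φ μ (k + 1) (F d t)) H ≤ √C * (y + η) := by
        gcongr
      have h3 : √C * η ≤ ε / 16 := by
        rw [hη, mul_div_assoc', div_le_div_iff₀ (by positivity) (by norm_num)]
        nlinarith [Real.sqrt_nonneg C]
      rw [h1]
      have h4 : 4 * √C * (k + 2) * uniformitySeminorm φ μ (k + 2) (f t) ^ 2 = 4 * (√C * y) := by
        rw [hy]; ring
      rw [h4]
      linarith [mul_add (√C) y η]
    filter_upwards [vanDerCorput (u := progTerm φ σ (k + 2) f)
      (boundedBy_progTerm hmp σ (k + 2) hf) hs0 hcorr hH1 (show 0 < ε / 4 by positivity)] with N hN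
    have hN' : ∫ x, ‖progAverage φ σ (k + 1 + 1) f N x‖ ^ 2 ∂μ ≤ 4 / H + 4 * avg s H + ε / 4 := hN
    linarith

/-! ### Closures of algebras of bounded functions are induced by factors -/

/-- A unital algebra of essentially bounded functions, stable under complex conjugation and
under changes on null sets. -/
structure IsBddStarAlg (μ : Measure X) (A : Set (X → ℂ)) : Prop where
  bdd : ∀ f ∈ A, ∃ M, BoundedBy μ M f
  congr : ∀ f ∈ A, ∀ g, f =ᵐ[μ] g → g ∈ A
  const : ∀ c : ℂ, (fun _ => c) ∈ A
  add : ∀ f ∈ A, ∀ g ∈ A, (fun x => f x + g x) ∈ A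
  mul : ∀ f ∈ A, ∀ g ∈ A, (fun x => f x * g x) ∈ A
  conj : ∀ f ∈ A, (fun x => starRingEnd ℂ (f x)) ∈ A

/-- Functions that can be approximated in `L²` by functions from `A`. -/
def l2Closure (μ : Measure X) (A : Set (X → ℂ)) : Set (X → ℂ) :=
  {f | MemLp f 2 μ ∧ ∀ ε : ℝ≥0∞, 0 < ε → ∃ g ∈ A, MemLp g 2 μ ∧ eLpNorm (fun x => f x - g x) 2 μ ≤ ε}

theorem subset_l2Closure {A : Set (X → ℂ)} {f : X → ℂ} (hf : f ∈ A) (hf2 : MemLp f 2 μ) :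
    f ∈ l2Closure μ A :=
  ⟨hf2, fun ε _ => ⟨f, hf, hf2, by simp⟩⟩

theorem l2Closure_congr {A : Set (X → ℂ)} {f g : X → ℂ} (hf : f ∈ l2Closure μ A)
    (h : f =ᵐ[μ] g) : g ∈ l2Closure μ A := by
  refine ⟨hf.1.ae_eq h, fun ε hε => ?_⟩
  obtain ⟨a, ha, ha2, hle⟩ := hf.2 ε hε
  refine ⟨a, ha, ha2, ?_⟩
  have e : (fun x => f x - a x) =ᵐ[μ] fun x => g x - a x := h.mono fun x hx => by simp only [hx]
  rwa [← eLpNorm_congr_ae e]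

theorem l2Closure_closed {A : Set (X → ℂ)} {f : X → ℂ} (hf : MemLp f 2 μ)
    (h : ∀ ε : ℝ≥0∞, 0 < ε → ∃ g ∈ l2Closure μ A, eLpNorm (fun x => f x - g x) 2 μ ≤ ε) :
    f ∈ l2Closure μ A := by
  refine ⟨hf, fun ε hε => ?_⟩
  obtain ⟨g, hg, hfg⟩ := h (ε / 2) (ENNReal.half_pos hε.ne')
  obtain ⟨a, ha, ha2, hga⟩ := hg.2 (ε / 2) (ENNReal.half_pos hε.ne')
  refine ⟨a, ha, ha2, ?_⟩
  have e : (fun x => f x - a x) = (fun x => f x - g x) + fun x => g x - a x := by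
    funext x; simp
  rw [e]
  refine (eLpNorm_add_le (hf.1.sub hg.1.1) (hg.1.1.sub ha2.1) (by norm_num)).trans ?_
  exact (add_le_add hfg hga).trans_eq (ENNReal.add_halves ε)

theorem l2Closure_of_tendsto {A : Set (X → ℂ)} {f : X → ℂ} {u : ℕ → X → ℂ} (hf : MemLp f 2 μ)
    (hu : ∀ n, u n ∈ l2Closure μ A)
    (h : Tendsto (fun n => eLpNorm (fun x => f x - u n x) 2 μ) atTop (𝓝 0)) :
    f ∈ l2Closure μ A := by
  refine l2Closure_closed hf fun ε hε => ?_
  obtain ⟨n, hn⟩ := (h.eventually_lt_const hε).exists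
  exact ⟨u n, hu n, hn.le⟩

theorem eLpNorm_two_eq {f : X → ℂ} (hf : MemLp f 2 μ) :
    eLpNorm f 2 μ = ENNReal.ofReal (√(∫ x, ‖f x‖ ^ 2 ∂μ)) := by
  rw [hf.eLpNorm_eq_integral_rpow_norm two_ne_zero (by norm_num), Real.sqrt_eq_rpow]
  norm_num

theorem tendsto_eLpNorm_of_bounded [IsFiniteMeasure μ] {f : X → ℂ} {u : ℕ → X → ℂ} {M : ℝ}
    (hf : AEStronglyMeasurable f μ) (hu : ∀ n, BoundedBy μ M (u n))
    (h : ∀ᵐ x ∂μ, Tendsto (fun n => u n x) atTop (𝓝 (f x))) :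
    Tendsto (fun n => eLpNorm (fun x => f x - u n x) 2 μ) atTop (𝓝 0) := by
  have hfM : BoundedBy μ M f := ⟨hf, by
    filter_upwards [ae_all_iff.2 fun n => (hu n).2, h] with x h1 h2
    exact le_of_tendsto h2.norm (Eventually.of_forall h1)⟩
  have hb : ∀ n, BoundedBy μ (M + M) fun x => f x - u n x := fun n => hfM.sub (hu n)
  have hint : Tendsto (fun n => ∫ x, ‖f x - u n x‖ ^ 2 ∂μ) atTop (𝓝 (∫ _, (0 : ℝ) ∂μ)) := by
    refine tendsto_integral_of_dominated_convergence (fun _ => (M + M) ^ 2)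
      (fun n => ((hb n).1.norm.pow 2)) (integrable_const _) (fun n => ?_) ?_
    · filter_upwards [(hb n).2] with x hx
      rw [norm_pow, norm_norm]
      exact pow_le_pow_left₀ (norm_nonneg _) hx 2
    · filter_upwards [h] with x hx
      have := ((tendsto_const_nhds (x := f x)).sub hx).norm.pow 2
      simpa using this
  simp only [fun n => eLpNorm_two_eq ((hb n).memLp 2)]
  have := (ENNReal.continuous_ofReal.tendsto _).comp ((Real.continuous_sqrt.tendsto _).comp hint)
  simpa [Function.comp_def] using this

theorem eLpNorm_mul_bounded_le {f g : X → ℂ} {M : ℝ} (hg : BoundedBy μ M g) :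
    eLpNorm (fun x => g x * f x) 2 μ ≤ ENNReal.ofReal M * eLpNorm f 2 μ := by
  refine eLpNorm_le_mul_eLpNorm_of_ae_le_mul ?_ 2
  filter_upwards [hg.2] with x hx
  rw [norm_mul]
  exact mul_le_mul_of_nonneg_right hx (norm_nonneg _)

namespace IsBddStarAlg

variable {A : Set (X → ℂ)}

theorem mem_l2Closure_of_approx {f : X → ℂ} (hf : MemLp f 2 μ)
    {g : ℕ → X → ℂ} (hg : ∀ n, g n ∈ l2Closure μ A) {C : ℝ≥0∞} (hC : C ≠ ∞) {δ : ℕ → ℝ≥0∞}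
    (hδ : Tendsto δ atTop (𝓝 0))
    (h : ∀ n, eLpNorm (fun x => f x - g n x) 2 μ ≤ C * δ n) : f ∈ l2Closure μ A := by
  refine l2Closure_of_tendsto hf hg ?_
  have h0 : Tendsto (fun n => C * δ n) atTop (𝓝 0) := by
    simpa using ENNReal.Tendsto.const_mul hδ (Or.inr hC)
  exact tendsto_of_tendsto_of_tendsto_of_le_of_le tendsto_const_nhds h0 (fun _ => zero_le) h

theorem exists_seq_of_mem_l2Closure (f : X → ℂ) (hf : f ∈ l2Closure μ A) :
    ∃ g : ℕ → X → ℂ, (∀ n, g n ∈ A) ∧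
      Tendsto (fun n => eLpNorm (fun x => f x - g n x) 2 μ) atTop (𝓝 0) := by
  have : ∀ n : ℕ, ∃ g ∈ A, eLpNorm (fun x => f x - g x) 2 μ ≤ (n : ℝ≥0∞)⁻¹ := fun n => by
    obtain ⟨g, hg, _, hle⟩ := hf.2 (n : ℝ≥0∞)⁻¹ (by simp)
    exact ⟨g, hg, hle⟩
  choose g hg hle using this
  exact ⟨g, hg, tendsto_of_tendsto_of_tendsto_of_le_of_le tendsto_const_nhds
    ENNReal.tendsto_inv_nat_nhds_zero (fun _ => zero_le) hle⟩

theorem closure_add (hA : IsBddStarAlg μ A) {f g : X → ℂ} (hf : f ∈ l2Closure μ A)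
    (hg : g ∈ l2Closure μ A) : (fun x => f x + g x) ∈ l2Closure μ A := by
  refine ⟨hf.1.add hg.1, fun ε hε => ?_⟩
  obtain ⟨a, ha, ha2, h1⟩ := hf.2 (ε / 2) (ENNReal.half_pos hε.ne')
  obtain ⟨b, hb, hb2, h2⟩ := hg.2 (ε / 2) (ENNReal.half_pos hε.ne')
  refine ⟨_, hA.add a ha b hb, ha2.add hb2, ?_⟩
  have e : (fun x => f x + g x - (a x + b x)) = (fun x => f x - a x) + fun x => g x - b x := by
    funext x; simp; ring
  rw [e]
  refine (eLpNorm_add_le (hf.1.1.sub ha2.1) (hg.1.1.sub hb2.1) (by norm_num)).trans ?_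
  exact (add_le_add h1 h2).trans_eq (ENNReal.add_halves ε)

theorem polynomial_mem (hA : IsBddStarAlg μ A) {f : X → ℝ} (hf : (fun x => (f x : ℂ)) ∈ A)
    (p : Polynomial ℝ) : (fun x => ((p.eval (f x) : ℝ) : ℂ)) ∈ A := by
  induction p using Polynomial.induction_on' with
  | add p q hp hq =>
    simp only [Polynomial.eval_add, Complex.ofReal_add]
    exact hA.add _ hp _ hq
  | monomial n c =>
    simp only [Polynomial.eval_monomial, Complex.ofReal_mul, Complex.ofReal_pow]
    refine hA.mul _ (hA.const c) _ ?_
    induction n with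
    | zero => simpa using hA.const 1
    | succ n ih =>
      simp only [pow_succ]
      exact hA.mul _ ih _ hf

theorem mem_closure_iff (F : Lp ℂ 2 μ) :
    F ∈ closure {F : Lp ℂ 2 μ | (F : X → ℂ) ∈ A} ↔ ∀ ε : ℝ≥0∞, 0 < ε →
      ∃ G : Lp ℂ 2 μ, (G : X → ℂ) ∈ A ∧ eLpNorm (fun x => F x - G x) 2 μ ≤ ε := by
  rw [EMetric.mem_closure_iff]
  constructor
  · intro h ε hε
    obtain ⟨G, hG, hlt⟩ := h ε hε
    exact ⟨G, hG, by rw [Lp.edist_def] at hlt; exact hlt.le⟩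
  · intro h ε hε
    obtain ⟨δ, hδ, hlt⟩ := exists_between hε
    obtain ⟨G, hG, hle⟩ := h δ hδ
    exact ⟨G, hG, by rw [Lp.edist_def]; exact hle.trans_lt hlt⟩

theorem mem_closure_iff_mem_l2Closure (hA : IsBddStarAlg μ A) (F : Lp ℂ 2 μ) :
    F ∈ closure {F : Lp ℂ 2 μ | (F : X → ℂ) ∈ A} ↔ (F : X → ℂ) ∈ l2Closure μ A := by
  rw [mem_closure_iff]
  constructor
  · intro h
    refine ⟨Lp.memLp F, fun ε hε => ?_⟩
    obtain ⟨G, hG, hle⟩ := h ε hε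
    exact ⟨G, hG, Lp.memLp G, hle⟩
  · intro h ε hε
    obtain ⟨g, hg, hg2, hle⟩ := h.2 ε hε
    refine ⟨hg2.toLp g, hA.congr _ hg _ hg2.coeFn_toLp.symm, ?_⟩
    rwa [eLpNorm_congr_ae (hg2.coeFn_toLp.mono fun x hx => by rw [hx])]

variable [IsProbabilityMeasure μ]

theorem memLp (hA : IsBddStarAlg μ A) {f : X → ℂ} (hf : f ∈ A) : MemLp f 2 μ := by
  obtain ⟨M, hM⟩ := hA.bdd f hf
  exact hM.memLp 2

theorem subset_closure (hA : IsBddStarAlg μ A) {f : X → ℂ} (hf : f ∈ A) : f ∈ l2Closure μ A :=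
  subset_l2Closure hf (hA.memLp hf)

theorem closure_mul_left (hA : IsBddStarAlg μ A) {f g : X → ℂ} (hg : g ∈ A)
    (hf : f ∈ l2Closure μ A) : (fun x => g x * f x) ∈ l2Closure μ A := by
  obtain ⟨M, hM⟩ := hA.bdd g hg
  obtain ⟨a, ha, hlim⟩ := exists_seq_of_mem_l2Closure f hf
  have hmem : ∀ {f : X → ℂ}, MemLp f 2 μ → MemLp (fun x => g x * f x) 2 μ := fun hf =>
    ⟨hM.1.mul hf.1, (eLpNorm_mul_bounded_le hM).trans_lt
      (ENNReal.mul_lt_top ENNReal.ofReal_lt_top hf.2)⟩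
  refine mem_l2Closure_of_approx (hmem hf.1) (fun n => hA.subset_closure (hA.mul g hg _ (ha n)))
    (ENNReal.ofReal_ne_top (r := M)) hlim fun n => ?_
  simp only [← mul_sub]
  exact eLpNorm_mul_bounded_le hM

/-- Approximants from `A` need not be uniformly bounded, so the two factors are not approximated at
once. Only `g` is approximated, by `a n ∈ A`; the products `a n · f` lie in the closure by
`closure_mul_left`, and the bound on `f` controls the error. -/
theorem closure_mul (hA : IsBddStarAlg μ A) {f g : X → ℂ} {M K : ℝ} (hf : f ∈ l2Closure μ A)
    (hg : g ∈ l2Closure μ A) (hfM : BoundedBy μ M f) (hgK : BoundedBy μ K g) :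
    (fun x => f x * g x) ∈ l2Closure μ A := by
  obtain ⟨a, ha, hlim⟩ := exists_seq_of_mem_l2Closure g hg
  refine mem_l2Closure_of_approx ((hfM.mul hgK).memLp 2) (g := fun n x => a n x * f x)
    (fun n => hA.closure_mul_left (ha n) hf) (ENNReal.ofReal_ne_top (r := M)) hlim fun n => ?_
  simp only [mul_comm _ (f _), ← mul_sub]
  exact eLpNorm_mul_bounded_le hfM

/-- Weierstrass approximation of `F` on an interval `[-M, M]` containing almost all values of `f`.
-/
theorem continuous_comp_mem (hA : IsBddStarAlg μ A) {f : X → ℝ} (hf : (fun x => (f x : ℂ)) ∈ A)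
    {F : ℝ → ℝ} (hF : Continuous F) : (fun x => ((F (f x) : ℝ) : ℂ)) ∈ l2Closure μ A := by
  obtain ⟨M, hM⟩ := hA.bdd _ hf
  have hfm : AEStronglyMeasurable f μ := by
    simpa using Complex.continuous_re.comp_aestronglyMeasurable hM.1
  obtain ⟨K, hK⟩ := (isCompact_Icc (a := -M) (b := M)).exists_bound_of_continuousOn hF.continuousOn
  have hb : ∀ᵐ x ∂μ, f x ∈ Set.Icc (-M) M := by
    filter_upwards [hM.2] with x hx
    rw [Complex.norm_real, Real.norm_eq_abs, abs_le] at hx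
    exact hx
  have hbF : BoundedBy μ K fun x => ((F (f x) : ℝ) : ℂ) :=
    ⟨Complex.continuous_ofReal.comp_aestronglyMeasurable (hF.comp_aestronglyMeasurable hfm), by
      filter_upwards [hb] with x hx
      rw [Complex.norm_real]
      exact hK _ hx⟩
  have hp : ∀ n : ℕ, ∃ p : Polynomial ℝ, ∀ x ∈ Set.Icc (-M) M,
      |p.eval x - F x| < 1 / ((n : ℝ) + 1) := fun n =>
    exists_polynomial_near_of_continuousOn _ _ F hF.continuousOn _ (by positivity)
  choose p hp using hp
  have hmem := fun n => hA.polynomial_mem hf (p n)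
  refine l2Closure_of_tendsto (hbF.memLp 2) (fun n => hA.subset_closure (hmem n))
    (tendsto_eLpNorm_of_bounded (M := K + 1) hbF.1 (fun n => ?_) ?_)
  · refine ⟨(hA.memLp (hmem n)).1, ?_⟩
    filter_upwards [hb] with x hx
    rw [Complex.norm_real, Real.norm_eq_abs]
    have h1 := hp n _ hx
    have h2 := hK _ hx
    rw [Real.norm_eq_abs] at h2
    have h3 : 1 / ((n : ℝ) + 1) ≤ 1 := by
      rw [div_le_one (by positivity)]; linarith [Nat.cast_nonneg (α := ℝ) n]
    have h4 := abs_sub_abs_le_abs_sub ((p n).eval (f x)) (F (f x))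
    linarith
  · filter_upwards [hb] with x hx
    refine (Complex.continuous_ofReal.tendsto _).comp ?_
    rw [tendsto_iff_dist_tendsto_zero]
    refine squeeze_zero (fun _ => dist_nonneg) (fun n => (hp n _ hx).le) ?_
    exact tendsto_one_div_add_atTop_nhds_zero_nat

/-- The indicator is the bounded pointwise limit of the continuous functions `min 1 (n (f - a)⁺)` of
`f`. This is the passage from functions in `A` to sets. -/
theorem superlevel_mem (hA : IsBddStarAlg μ A) {f : X → ℝ} (hf : (fun x => (f x : ℂ)) ∈ A)
    (hfm : Measurable f) (a : ℝ) :
    (f ⁻¹' Set.Ioi a).indicator (fun _ => (1 : ℂ)) ∈ l2Closure μ A := by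
  have hmeas : MeasurableSet (f ⁻¹' Set.Ioi a) := hfm measurableSet_Ioi
  have hind : AEStronglyMeasurable ((f ⁻¹' Set.Ioi a).indicator (fun _ => (1 : ℂ))) μ :=
    aestronglyMeasurable_const.indicator hmeas
  set F : ℕ → ℝ → ℝ := fun n t => min 1 (n * max 0 (t - a)) with hF
  have hFc : ∀ n, Continuous (F n) := fun n => by simp only [hF]; fun_prop
  have hmem := fun n => hA.continuous_comp_mem hf (hFc n)
  have hind2 : MemLp ((f ⁻¹' Set.Ioi a).indicator (fun _ => (1 : ℂ))) 2 μ :=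
    (memLp_const 1).indicator hmeas
  refine l2Closure_of_tendsto hind2 hmem (tendsto_eLpNorm_of_bounded (M := 1) hind (fun n => ?_) ?_)
  · refine ⟨(hmem n).1.1, ae_of_all _ fun x => ?_⟩
    rw [Complex.norm_real, Real.norm_eq_abs, abs_of_nonneg]
    · exact min_le_left _ _
    · exact le_min zero_le_one (by positivity)
  · refine ae_of_all _ fun x => ?_
    by_cases hx : a < f x
    · have h1 : (f ⁻¹' Set.Ioi a).indicator (fun _ => (1 : ℂ)) x = 1 :=
        Set.indicator_of_mem (show x ∈ f ⁻¹' Set.Ioi a from hx) _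
      rw [h1]
      refine tendsto_const_nhds.congr' ?_
      filter_upwards [eventually_ge_atTop ⌈1 / (f x - a)⌉₊] with n hn
      have h2 : 1 / (f x - a) ≤ n := (Nat.le_ceil _).trans (by exact_mod_cast hn)
      rw [div_le_iff₀ (sub_pos.2 hx)] at h2
      simp only [hF]
      rw [max_eq_right (sub_pos.2 hx).le, min_eq_left h2, Complex.ofReal_one]
    · have h1 : (f ⁻¹' Set.Ioi a).indicator (fun _ => (1 : ℂ)) x = 0 :=
        Set.indicator_of_notMem (show x ∉ f ⁻¹' Set.Ioi a from hx) _
      rw [h1]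
      refine tendsto_const_nhds.congr fun n => ?_
      simp only [hF]
      rw [max_eq_left (sub_nonpos.2 (not_lt.1 hx))]
      simp

/-- The measurable sets whose indicator function is approximated by functions from `A`. -/
@[reducible]
def closureSigma (hA : IsBddStarAlg μ A) : MeasurableSpace X where
  MeasurableSet' s := MeasurableSet s ∧ s.indicator (fun _ => (1 : ℂ)) ∈ l2Closure μ A
  measurableSet_empty := ⟨MeasurableSet.empty, by
    simpa using hA.subset_closure (hA.const 0)⟩
  measurableSet_compl s hs := ⟨hs.1.compl, by
    have h1 := hA.closure_add (hA.subset_closure (hA.const 1))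
      (hA.closure_mul_left (hA.const (-1)) hs.2)
    refine l2Closure_congr h1 (ae_of_all _ fun x => ?_)
    by_cases hx : x ∈ s <;> simp [hx]⟩
  measurableSet_iUnion s hs := by
    have hind : ∀ t : Set X, MeasurableSet t →
        BoundedBy μ 1 (t.indicator (fun _ => (1 : ℂ))) := fun t ht =>
      ⟨aestronglyMeasurable_const.indicator ht, ae_of_all _ fun x => by
        by_cases hx : x ∈ t <;> simp [hx]⟩
    have hfin : ∀ n, MeasurableSet (⋃ i < n, s i) ∧
        (⋃ i < n, s i).indicator (fun _ => (1 : ℂ)) ∈ l2Closure μ A := by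
      intro n
      induction n with
      | zero => simpa using hA.subset_closure (hA.const 0)
      | succ n ih =>
        rw [Set.biUnion_lt_succ]
        refine ⟨ih.1.union (hs n).1, ?_⟩
        -- The indicator of a union of two sets is the sum of their indicators minus the product.
        have h1 := hA.closure_mul ih.2 (hs n).2 (hind _ ih.1) (hind _ (hs n).1)
        have h2 := hA.closure_add (hA.closure_add ih.2 (hs n).2)
          (hA.closure_mul_left (hA.const (-1)) h1)
        refine l2Closure_congr h2 (ae_of_all _ fun x => ?_)
        by_cases hx : x ∈ ⋃ i < n, s i <;> by_cases hy : x ∈ s n <;>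
          simp [hy, Set.indicator, -Set.mem_iUnion, hx]
    have hm : MeasurableSet (⋃ i, s i) := MeasurableSet.iUnion fun i => (hs i).1
    refine ⟨hm, l2Closure_of_tendsto ((hind _ hm).memLp 2) (fun n => (hfin n).2)
      (tendsto_eLpNorm_of_bounded (hind _ hm).1 (fun n => hind _ (hfin n).1)
        (ae_of_all _ fun x => ?_))⟩
    by_cases hx : x ∈ ⋃ i, s i
    · obtain ⟨i, hi⟩ := Set.mem_iUnion.1 hx
      rw [Set.indicator_of_mem hx]
      refine tendsto_const_nhds.congr' ?_
      filter_upwards [eventually_gt_atTop i] with n hn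
      rw [Set.indicator_of_mem (Set.mem_iUnion₂.2 ⟨i, hn, hi⟩)]
    · rw [Set.indicator_of_notMem hx]
      refine tendsto_const_nhds.congr fun n => ?_
      rw [Set.indicator_of_notMem]
      intro h
      simp only [Set.mem_iUnion] at h hx
      obtain ⟨i, _, hi⟩ := h
      exact hx ⟨i, hi⟩

theorem closureSigma_le (hA : IsBddStarAlg μ A) : hA.closureSigma ≤ ‹MeasurableSpace X› :=
  fun _ hs => hs.1

/-- Stability under conjugation puts the real and imaginary parts of a measurable representative
into `A`; their superlevel sets then belong to `closureSigma`. -/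
theorem aestronglyMeasurable_of_mem (hA : IsBddStarAlg μ A) {f : X → ℂ} (hf : f ∈ A) :
    AEStronglyMeasurable[hA.closureSigma] f μ := by
  obtain ⟨g, hgm, hfg⟩ := (hA.memLp hf).1
  have hg : g ∈ A := hA.congr f hf g hfg
  have hre : (fun x => ((g x).re : ℂ)) ∈ A := by
    have := hA.mul _ (hA.const (1 / 2)) _ (hA.add _ hg _ (hA.conj _ hg))
    refine hA.congr _ this _ (ae_of_all _ fun x => ?_)
    simp only
    rw [Complex.add_conj]; push_cast; ring
  have him : (fun x => ((g x).im : ℂ)) ∈ A := by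
    have := hA.mul _ (hA.const (1 / (2 * Complex.I))) _
      (hA.add _ hg _ (hA.mul _ (hA.const (-1)) _ (hA.conj _ hg)))
    refine hA.congr _ this _ (ae_of_all _ fun x => ?_)
    simp only
    rw [neg_one_mul, ← sub_eq_add_neg, Complex.sub_conj]
    field_simp
    push_cast; ring
  have hre' : Measurable[hA.closureSigma] fun x => (g x).re :=
    measurable_of_Ioi fun a => ⟨(Complex.measurable_re.comp hgm.measurable) measurableSet_Ioi,
      hA.superlevel_mem hre (Complex.measurable_re.comp hgm.measurable) a⟩
  have him' : Measurable[hA.closureSigma] fun x => (g x).im :=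
    measurable_of_Ioi fun a => ⟨(Complex.measurable_im.comp hgm.measurable) measurableSet_Ioi,
      hA.superlevel_mem him (Complex.measurable_im.comp hgm.measurable) a⟩
  have hgZ : Measurable[hA.closureSigma] g := by
    have : g = fun x => ((g x).re : ℂ) + (g x).im * Complex.I := by
      funext x; exact (Complex.re_add_im (g x)).symm
    rw [this]
    exact (Complex.measurable_ofReal.comp hre').add
      ((Complex.measurable_ofReal.comp him').mul_const _)
  exact ⟨g, hgZ.stronglyMeasurable, hfg⟩

/-- Measurability with respect to a sub-`σ`-algebra is closed in `L²`, which gives one direction.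
For the other, the closure contains the indicators of the sets in `closureSigma` and is a closed
linear space, so it contains all of their `L²` space. -/
theorem mem_l2Closure_iff (hA : IsBddStarAlg μ A) {f : X → ℂ} :
    f ∈ l2Closure μ A ↔ MemLp f 2 μ ∧ AEStronglyMeasurable[hA.closureSigma] f μ := by
  constructor
  · intro hf
    refine ⟨hf.1, ?_⟩
    have h1 : hf.1.toLp f ∈ closure {F : Lp ℂ 2 μ | (F : X → ℂ) ∈ A} :=
      (hA.mem_closure_iff_mem_l2Closure _).2 (l2Closure_congr hf hf.1.coeFn_toLp.symm)
    have h2 : closure {F : Lp ℂ 2 μ | (F : X → ℂ) ∈ A} ⊆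
        {F : Lp ℂ 2 μ | AEStronglyMeasurable[hA.closureSigma] F μ} :=
      closure_minimal (fun F hF => hA.aestronglyMeasurable_of_mem hF)
        (isClosed_aestronglyMeasurable hA.closureSigma_le)
    exact (h2 h1).congr hf.1.coeFn_toLp
  · rintro ⟨hf, hfm⟩
    refine MemLp.induction_stronglyMeasurable hA.closureSigma_le (p := 2) (by norm_num)
      (fun f => f ∈ l2Closure μ A) ?_ ?_ ?_ ?_ hf hfm
    · intro c s hs _
      refine l2Closure_congr (hA.closure_mul_left (hA.const c) hs.2) (ae_of_all _ fun x => ?_)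
      by_cases hx : x ∈ s <;> simp [hx]
    · intro f g _ _ _ _ _ hf hg
      exact hA.closure_add hf hg
    · have : {F : lpMeas ℂ ℝ hA.closureSigma 2 μ | ((F : Lp ℂ 2 μ) : X → ℂ) ∈ l2Closure μ A} =
          Subtype.val ⁻¹' closure {F : Lp ℂ 2 μ | (F : X → ℂ) ∈ A} := by
        ext F
        exact (hA.mem_closure_iff_mem_l2Closure _).symm
      exact this ▸ isClosed_closure.preimage continuous_subtype_val
    · intro f g hfg _ hf
      exact l2Closure_congr hf hfg

theorem factorOf_eq (hA : IsBddStarAlg μ A) :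
    factorOf (closure {F : Lp ℂ 2 μ | (F : X → ℂ) ∈ A}) = hA.closureSigma := by
  refine le_antisymm (MeasurableSpace.generateFrom_le ?_) ?_
  · rintro s ⟨hs, F, hF, hFs⟩
    exact ⟨hs, l2Closure_congr ((hA.mem_closure_iff_mem_l2Closure F).1 hF) hFs⟩
  · intro s hs
    refine MeasurableSpace.measurableSet_generateFrom ⟨hs.1, hs.2.1.toLp _, ?_, hs.2.1.coeFn_toLp⟩
    exact (hA.mem_closure_iff_mem_l2Closure _).2 (l2Closure_congr hs.2 hs.2.1.coeFn_toLp.symm)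

theorem l2Closure_koopman (hA : IsBddStarAlg μ A) (hφ : MeasurePreserving φ μ μ)
    (hT : ∀ n : ℤ, ∀ f ∈ A, koopman φ n f ∈ A) (n : ℤ) {f : X → ℂ} (hf : f ∈ l2Closure μ A) :
    koopman φ n f ∈ l2Closure μ A := by
  refine ⟨hf.1.comp_measurePreserving (measurePreserving_zpow hφ n), fun ε hε => ?_⟩
  obtain ⟨g, hg, hg2, hle⟩ := hf.2 ε hε
  refine ⟨koopman φ n g, hT n g hg, hA.memLp (hT n g hg), ?_⟩
  exact (eLpNorm_comp_measurePreserving (hf.1.1.sub hg2.1)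
    (measurePreserving_zpow hφ n)).trans_le hle

/-- The `L²` closure of an invariant algebra of bounded functions is induced by a factor. -/
theorem isInducedByFactor (hA : IsBddStarAlg μ A) (hφ : MeasurePreserving φ μ μ)
    (hT : ∀ n : ℤ, ∀ f ∈ A, koopman φ n f ∈ A) :
    IsInducedByFactor (factorOf (closure {F : Lp ℂ 2 μ | (F : X → ℂ) ∈ A})) φ μ
      (closure {F : Lp ℂ 2 μ | (F : X → ℂ) ∈ A}) := by
  rw [hA.factorOf_eq]
  refine ⟨hA.closureSigma_le, fun s hs => ⟨⟨φ.measurable hs.1, ?_⟩, ?_, ?_⟩, ?_⟩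
  · have := hA.l2Closure_koopman hφ hT 1 hs.2
    rwa [show koopman φ 1 (s.indicator fun _ => (1 : ℂ)) = (φ ⁻¹' s).indicator fun _ => (1 : ℂ)
      by funext x; rfl] at this
  · rw [φ.measurableSet_image]; exact hs.1
  · have := hA.l2Closure_koopman hφ hT (-1) hs.2
    refine l2Closure_congr this (ae_of_all _ fun x => ?_)
    have e : φ '' s = φ.symm ⁻¹' s := φ.toEquiv.image_eq_preimage_symm s
    rw [e]
    rfl
  · ext F
    rw [hA.mem_closure_iff_mem_l2Closure, hA.mem_l2Closure_iff]
    exact ⟨fun h => h.2, fun h => ⟨Lp.memLp F, h⟩⟩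

end IsBddStarAlg

end DistalHostKra

namespace DistalHostKra

variable {X : Type*} {m : MeasurableSpace X} [m0 : MeasurableSpace X] {μ : Measure X} {φ : X ≃ᵐ X}

/-! ### Conditional expectations and conditional inner products -/

/-- Invariance of a sub-`σ`-algebra under an invertible map and its inverse. -/
def IsInvariantSigma (m : MeasurableSpace X) [MeasurableSpace X] (φ : X ≃ᵐ X) : Prop :=
  ∀ A : Set X, MeasurableSet[m] A → MeasurableSet[m] (φ ⁻¹' A) ∧ MeasurableSet[m] (φ '' A)

theorem IsInvariantSigma.measurable_zpow (h : IsInvariantSigma m φ) (n : ℤ) :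
    Measurable[m, m] (⇑((φ.toEquiv : Equiv.Perm X) ^ n)) := by
  have h1 : Measurable[m, m] φ := fun s hs => (h s hs).1
  have h2 : Measurable[m, m] φ.symm := fun s hs => by
    have e : φ '' s = φ.symm ⁻¹' s := φ.toEquiv.image_eq_preimage_symm s
    rw [← e]; exact (h s hs).2
  have hnat : ∀ k : ℕ, Measurable[m, m] (⇑((φ.toEquiv : Equiv.Perm X) ^ k)) := fun k => by
    rw [Equiv.Perm.coe_pow]; exact @Measurable.iterate X m _ h1 k
  have hnat' : ∀ k : ℕ,
      Measurable[m, m] (⇑(((φ.toEquiv : Equiv.Perm X) ^ k)⁻¹)) := fun k => by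
    rw [← inv_pow, Equiv.Perm.coe_pow]; exact @Measurable.iterate X m _ h2 k
  cases n with
  | ofNat k => simpa using hnat k
  | negSucc k => simpa [zpow_negSucc] using hnat' (k + 1)

theorem IsInvariantSigma.aestronglyMeasurable_koopman (h : IsInvariantSigma m φ)
    (hφ : MeasurePreserving φ μ μ) (n : ℤ) {f : X → ℂ} (hf : AEStronglyMeasurable[m] f μ) :
    AEStronglyMeasurable[m] (koopman φ n f) μ := by
  obtain ⟨g, hg, hfg⟩ := hf
  exact ⟨koopman φ n g, hg.comp_measurable (h.measurable_zpow n), ae_zpow hφ n hfg⟩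

theorem condExp_mul_left [IsFiniteMeasure μ] (hm : m ≤ m0) {c g : X → ℂ} {K : ℝ}
    (hc : AEStronglyMeasurable[m] c μ) (hK : ∀ᵐ x ∂μ, ‖c x‖ ≤ K) (hg : Integrable g μ) :
    μ[fun x => c x * g x | m] =ᵐ[μ] fun x => c x * (μ[g | m]) x :=
  condExp_aestronglyMeasurable_bilin_of_bound (ContinuousLinearMap.mul ℝ ℂ) hm hc hg K hK

theorem BoundedBy.condExp [IsFiniteMeasure μ] (hm : m ≤ m0) {f : X → ℂ} {M : ℝ}
    (hf : BoundedBy μ M f) : BoundedBy μ M (μ[f | m]) :=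
  ⟨(stronglyMeasurable_condExp.mono hm).aestronglyMeasurable,
    ae_bdd_norm_condExp_of_ae_bdd_norm hf.2⟩

theorem condExp_conj [IsFiniteMeasure μ] {f : X → ℂ} (hf : Integrable f μ) :
    μ[fun x => starRingEnd ℂ (f x) | m] =ᵐ[μ] fun x => starRingEnd ℂ ((μ[f | m]) x) :=
  ((Complex.conjCLE : ℂ →L[ℝ] ℂ).comp_condExp_comm hf).symm

theorem condExp_ofReal [IsFiniteMeasure μ] {f : X → ℝ} (hf : Integrable f μ) :
    μ[fun x => (f x : ℂ) | m] =ᵐ[μ] fun x => (((μ[f | m]) x : ℝ) : ℂ) :=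
  (Complex.ofRealCLM.comp_condExp_comm hf).symm

/-- Invariance under both `φ` and `φ⁻¹` keeps the preimages under every power `m`-measurable, so the
set integrals that characterise the expectation can be moved by a change of variables. -/
theorem condExp_koopman [IsFiniteMeasure μ] (hm : m ≤ m0) (hinv : IsInvariantSigma m φ)
    (hφ : MeasurePreserving φ μ μ) (n : ℤ) {f : X → ℂ} (hf : Integrable f μ) :
    μ[koopman φ n f | m] =ᵐ[μ] koopman φ n (μ[f | m]) := by
  symm
  have hcomp : ∀ {g : X → ℂ}, Integrable g μ → Integrable (koopman φ n g) μ := fun hg =>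
    (measurePreserving_zpow hφ n).integrable_comp_of_integrable hg
  refine ae_eq_condExp_of_forall_setIntegral_eq hm (hcomp hf)
    (fun s _ _ => (hcomp integrable_condExp).integrableOn) (fun s hs _ => ?_)
    (hinv.aestronglyMeasurable_koopman hφ n stronglyMeasurable_condExp.aestronglyMeasurable)
  have hs' : MeasurableSet[m] (((φ.toEquiv : Equiv.Perm X) ^ (-n)) ⁻¹' s) :=
    hinv.measurable_zpow (-n) hs
  have key : ∀ g : X → ℂ, ∫ x in s, koopman φ n g x ∂μ =
      ∫ x in ((φ.toEquiv : Equiv.Perm X) ^ (-n)) ⁻¹' s, g x ∂μ := by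
    intro g
    rw [← integral_indicator (hm s hs), ← integral_indicator (hm _ hs'),
      ← integral_koopman hφ n ((((φ.toEquiv : Equiv.Perm X) ^ (-n)) ⁻¹' s).indicator g)]
    refine integral_congr_ae (ae_of_all _ fun x => ?_)
    have e : ((φ.toEquiv : Equiv.Perm X) ^ (-n)) (((φ.toEquiv : Equiv.Perm X) ^ n) x) = x := by
      rw [← Equiv.Perm.mul_apply, ← zpow_add]; simp
    have hiff : ((φ.toEquiv : Equiv.Perm X) ^ n) x ∈ ((φ.toEquiv : Equiv.Perm X) ^ (-n)) ⁻¹' s ↔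
        x ∈ s := by rw [Set.mem_preimage, e]
    by_cases hx : x ∈ s
    · simp only [koopman]
      rw [Set.indicator_of_mem hx, Set.indicator_of_mem (hiff.2 hx)]
      rfl
    · simp only [koopman]
      rw [Set.indicator_of_notMem hx, Set.indicator_of_notMem (mt hiff.1 hx)]
  rw [key, key]
  exact setIntegral_condExp hm hf hs'

theorem integral_mul_condExp [IsFiniteMeasure μ] (hm : m ≤ m0) {c g : X → ℂ} {K : ℝ}
    (hc : AEStronglyMeasurable[m] c μ) (hK : ∀ᵐ x ∂μ, ‖c x‖ ≤ K) (hg : Integrable g μ) :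
    ∫ x, c x * g x ∂μ = ∫ x, c x * (μ[g | m]) x ∂μ := by
  rw [← integral_congr_ae (condExp_mul_left hm hc hK hg), integral_condExp hm]

/-- The conditional inner product `E(a · conj b | m)`. -/
noncomputable def condInner (m : MeasurableSpace X) [m0 : MeasurableSpace X] (μ : Measure X)
    (a b : X → ℂ) : X → ℂ :=
  μ[fun x => a x * starRingEnd ℂ (b x) | m]

/-- The conditional square `E(|f|² | m)`. -/
noncomputable def condSq (m : MeasurableSpace X) [m0 : MeasurableSpace X] (μ : Measure X)
    (f : X → ℂ) : X → ℝ :=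
  μ[fun x => ‖f x‖ ^ 2 | m]

theorem measurable_condInner (a b : X → ℂ) : Measurable[m] (condInner m μ a b) :=
  stronglyMeasurable_condExp.measurable

theorem measurable_condSq (f : X → ℂ) : Measurable[m] (condSq m μ f) :=
  stronglyMeasurable_condExp.measurable

theorem aestronglyMeasurable_condInner (a b : X → ℂ) :
    AEStronglyMeasurable[m] (condInner m μ a b) μ :=
  stronglyMeasurable_condExp.aestronglyMeasurable

section Inner

variable {a b c : X → ℂ} {M K L : ℝ}

theorem condSq_nonneg (f : X → ℂ) : ∀ᵐ x ∂μ, 0 ≤ condSq m μ f x :=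
  condExp_nonneg (ae_of_all _ fun _ => by positivity)

theorem condSq_add_le (ha : MemLp a 2 μ) (hb : MemLp b 2 μ) :
    ∀ᵐ x ∂μ, condSq m μ (fun x => a x + b x) x ≤ 2 * condSq m μ a x + 2 * condSq m μ b x := by
  have ia := ha.integrable_norm_pow two_ne_zero
  have ib := hb.integrable_norm_pow two_ne_zero
  have h1 : μ[fun x => ‖a x + b x‖ ^ 2 | m] ≤ᵐ[μ]
      μ[((2 : ℝ) • fun x => ‖a x‖ ^ 2) + (2 : ℝ) • fun x => ‖b x‖ ^ 2 | m] := by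
    refine condExp_mono ((ha.add hb).integrable_norm_pow two_ne_zero)
      ((ia.smul _).add (ib.smul _)) (ae_of_all _ fun x => ?_)
    simp only [Pi.add_apply, Pi.smul_apply, smul_eq_mul]
    have := pow_le_pow_left₀ (norm_nonneg _) (norm_add_le (a x) (b x)) 2
    nlinarith [sq_nonneg (‖a x‖ - ‖b x‖)]
  filter_upwards [h1, condExp_add (ia.smul (2 : ℝ)) (ib.smul (2 : ℝ)) m,
    condExp_smul (2 : ℝ) (fun x => ‖a x‖ ^ 2) m (μ := μ),
    condExp_smul (2 : ℝ) (fun x => ‖b x‖ ^ 2) m (μ := μ)] with x h1 h2 h3 h4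
  rw [h2, Pi.add_apply, h3, h4] at h1
  exact h1

theorem condSq_mul_le (hc : BoundedBy μ L c) (ha : MemLp a 2 μ) :
    ∀ᵐ x ∂μ, condSq m μ (fun x => c x * a x) x ≤ L ^ 2 * condSq m μ a x := by
  have ia := ha.integrable_norm_pow two_ne_zero
  have hca : MemLp (fun x => c x * a x) 2 μ :=
    ⟨hc.1.mul ha.1, (eLpNorm_mul_bounded_le hc).trans_lt
      (ENNReal.mul_lt_top ENNReal.ofReal_lt_top ha.2)⟩
  have h1 : μ[fun x => ‖c x * a x‖ ^ 2 | m] ≤ᵐ[μ] μ[(L ^ 2) • fun x => ‖a x‖ ^ 2 | m] := by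
    refine condExp_mono (hca.integrable_norm_pow two_ne_zero) (ia.smul _) ?_
    filter_upwards [hc.2] with x hx
    simp only [Pi.smul_apply, smul_eq_mul]
    rw [norm_mul, mul_pow]
    gcongr
  filter_upwards [h1, condExp_smul (L ^ 2) (fun x => ‖a x‖ ^ 2) m (μ := μ)] with x h1 h2
  rw [h2] at h1
  exact h1

theorem condSq_congr (h : a =ᵐ[μ] b) : condSq m μ a =ᵐ[μ] condSq m μ b :=
  condExp_congr_ae (h.mono fun x hx => by simp only [hx])

variable [IsProbabilityMeasure μ]

theorem BoundedBy.condInner (hm : m ≤ m0) (ha : BoundedBy μ M a) (hb : BoundedBy μ K b) :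
    BoundedBy μ (M * K) (condInner m μ a b) :=
  (ha.mul hb.conj).condExp hm

theorem condInner_swap (ha : BoundedBy μ M a) (hb : BoundedBy μ K b) :
    condInner m μ b a =ᵐ[μ] fun x => starRingEnd ℂ (condInner m μ a b x) := by
  refine EventuallyEq.trans ?_ (condExp_conj (ha.mul hb.conj).integrable)
  refine condExp_congr_ae (ae_of_all _ fun x => ?_)
  simp only [map_mul, RingHomCompTriple.comp_apply, RingHom.id_apply]
  ring

theorem condInner_mul_left (hm : m ≤ m0) (hc : AEStronglyMeasurable[m] c μ)
    (hL : ∀ᵐ x ∂μ, ‖c x‖ ≤ L) (ha : BoundedBy μ M a) (hb : BoundedBy μ K b) :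
    condInner m μ (fun x => c x * a x) b =ᵐ[μ] fun x => c x * condInner m μ a b x := by
  refine EventuallyEq.trans ?_ (condExp_mul_left hm hc hL (ha.mul hb.conj).integrable)
  exact condExp_congr_ae (ae_of_all _ fun x => by simp only [mul_assoc])

theorem condInner_sub_left (ha : BoundedBy μ M a) (hc : BoundedBy μ L c) (hb : BoundedBy μ K b) :
    condInner m μ (fun x => a x - c x) b =ᵐ[μ]
      fun x => condInner m μ a b x - condInner m μ c b x := by
  refine EventuallyEq.trans ?_
    (condExp_sub (ha.mul hb.conj).integrable (hc.mul hb.conj).integrable m)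
  exact condExp_congr_ae (ae_of_all _ fun x => by simp only [Pi.sub_apply, sub_mul])

theorem condInner_sum_left {ι : Type*} (s : Finset ι) {v : ι → X → ℂ} {B : ι → ℝ}
    (hv : ∀ i ∈ s, BoundedBy μ (B i) (v i)) (hb : BoundedBy μ K b) :
    condInner m μ (fun x => ∑ i ∈ s, v i x) b =ᵐ[μ] fun x => ∑ i ∈ s, condInner m μ (v i) b x := by
  have h := condExp_finsetSum (μ := μ) (s := s) (f := fun i x => v i x * starRingEnd ℂ (b x))
    (fun i hi => ((hv i hi).mul hb.conj).integrable) m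
  refine EventuallyEq.trans ?_ (h.trans ?_)
  · exact condExp_congr_ae (ae_of_all _ fun x => by simp [Finset.sum_mul])
  · exact ae_of_all _ fun x => by simp [condInner]

theorem condInner_self (ha : BoundedBy μ M a) :
    condInner m μ a a =ᵐ[μ] fun x => (condSq m μ a x : ℂ) := by
  refine EventuallyEq.trans ?_ (condExp_ofReal ((ha.memLp 2).integrable_norm_pow two_ne_zero))
  refine condExp_congr_ae (ae_of_all _ fun x => ?_)
  simp only [Complex.mul_conj']
  push_cast; rfl

theorem condSq_le (ha : BoundedBy μ M a) (hm : m ≤ m0) : ∀ᵐ x ∂μ, condSq m μ a x ≤ M ^ 2 := by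
  have h := condExp_mono (m := m) ((ha.memLp 2).integrable_norm_pow two_ne_zero)
    (integrable_const (M ^ 2)) (by
      filter_upwards [ha.2] with x hx
      exact pow_le_pow_left₀ (norm_nonneg _) hx 2)
  rw [condExp_const hm] at h
  exact h

end Inner

/-! ### Bounded conditionally almost periodic functions -/

/-- The orbit of `f` is, up to `ε` in the conditional square, contained in the zonotope spanned by
finitely many bounded functions, with coefficients bounded by `K`. -/
def HasBddZonotope (m : MeasurableSpace X) [m0 : MeasurableSpace X] (φ : X ≃ᵐ X)
    (μ : Measure X) (f : X → ℂ) (K ε : ℝ) : Prop :=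
  ∃ (ι : Type) (_ : Fintype ι) (g : ι → X → ℂ), (∀ j, ∃ B, BoundedBy μ B (g j)) ∧
    ∀ n : ℤ, ∃ c : ι → X → ℂ,
      (∀ j, AEStronglyMeasurable[m] (c j) μ ∧ ∀ᵐ x ∂μ, ‖c j x‖ ≤ K) ∧
      ∀ᵐ x ∂μ, condSq m μ (fun x => koopman φ n f x - ∑ j, c j x * g j x) x ≤ ε

/-- Bounded conditionally almost periodic functions for which the approximating zonotopes can be
spanned by bounded functions. -/
def IsBddAlmostPeriodic (m : MeasurableSpace X) [m0 : MeasurableSpace X] (φ : X ≃ᵐ X)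
    (μ : Measure X) (f : X → ℂ) : Prop :=
  (∃ M, BoundedBy μ M f) ∧ ∀ ε > 0, HasBddZonotope m φ μ f 1 ε

theorem BoundedBy.mk' {c : X → ℂ} {K : ℝ} (hm : m ≤ m0)
    (h : AEStronglyMeasurable[m] c μ ∧ ∀ᵐ x ∂μ, ‖c x‖ ≤ K) : BoundedBy μ K c :=
  ⟨h.1.mono hm, h.2⟩

/-- The bound on the coefficients can be absorbed into the generators, so any positive bound is as
good as `1`. -/
theorem HasBddZonotope.rescale {f : X → ℂ} {K ε : ℝ} (hK : 0 < K)
    (h : HasBddZonotope m φ μ f K ε) : HasBddZonotope m φ μ f 1 ε := by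
  obtain ⟨ι, hι, g, hg, h⟩ := h
  refine ⟨ι, hι, fun j x => (K : ℂ) * g j x, fun j => ?_, fun n => ?_⟩
  · obtain ⟨B, hB⟩ := hg j
    exact ⟨_, (BoundedBy.const (K : ℂ)).mul hB⟩
  · obtain ⟨c, hc, hle⟩ := h n
    refine ⟨fun j x => (K : ℂ)⁻¹ * c j x, fun j => ⟨(hc j).1.const_mul _, ?_⟩, ?_⟩
    · filter_upwards [(hc j).2] with x hx
      rw [norm_mul, norm_inv, Complex.norm_real, Real.norm_of_nonneg hK.le]
      rw [inv_mul_le_iff₀ hK]; linarith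
    · have hKc : (K : ℂ) ≠ 0 := by exact_mod_cast hK.ne'
      have e : ∀ x, ∑ j, (K : ℂ)⁻¹ * c j x * ((K : ℂ) * g j x) = ∑ j, c j x * g j x := fun x =>
        Finset.sum_congr rfl fun j _ => by field_simp
      simpa only [e] using hle

theorem exists_boundedBy_zonotope (hm : m ≤ m0) {ι : Type*} [Fintype ι] {g c : ι → X → ℂ}
    {K : ℝ} (hg : ∀ j, ∃ B, BoundedBy μ B (g j))
    (hc : ∀ j, AEStronglyMeasurable[m] (c j) μ ∧ ∀ᵐ x ∂μ, ‖c j x‖ ≤ K) :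
    ∃ L, BoundedBy μ L fun x => ∑ j, c j x * g j x := by
  choose B hB using hg
  exact ⟨_, BoundedBy.sum Finset.univ fun j _ => (BoundedBy.mk' hm (hc j)).mul (hB j)⟩

namespace IsBddAlmostPeriodic

variable {f g : X → ℂ}

theorem congr (hφ : MeasurePreserving φ μ μ) (hf : IsBddAlmostPeriodic m φ μ f)
    (h : f =ᵐ[μ] g) : IsBddAlmostPeriodic m φ μ g := by
  obtain ⟨⟨M, hM⟩, hz⟩ := hf
  refine ⟨⟨M, hM.congr h⟩, fun ε hε => ?_⟩
  obtain ⟨ι, hι, a, ha, hz⟩ := hz ε hε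
  refine ⟨ι, hι, a, ha, fun n => ?_⟩
  obtain ⟨c, hc, hle⟩ := hz n
  refine ⟨c, hc, ?_⟩
  have e : (fun x => koopman φ n f x - ∑ j, c j x * a j x) =ᵐ[μ]
      fun x => koopman φ n g x - ∑ j, c j x * a j x := by
    filter_upwards [ae_zpow hφ n h] with x hx
    simp only [koopman, hx]
  filter_upwards [hle, condSq_congr (m := m) e] with x h1 h2
  rwa [← h2]

theorem koopman (hφ : MeasurePreserving φ μ μ) (hf : IsBddAlmostPeriodic m φ μ f) (k : ℤ) :
    IsBddAlmostPeriodic m φ μ (koopman φ k f) := by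
  obtain ⟨⟨M, hM⟩, hz⟩ := hf
  refine ⟨⟨M, hM.koopman hφ k⟩, fun ε hε => ?_⟩
  obtain ⟨ι, hι, a, ha, hz⟩ := hz ε hε
  refine ⟨ι, hι, a, ha, fun n => ?_⟩
  rw [koopman_koopman]
  exact hz (n + k)

theorem conj (hf : IsBddAlmostPeriodic m φ μ f) :
    IsBddAlmostPeriodic m φ μ fun x => starRingEnd ℂ (f x) := by
  obtain ⟨⟨M, hM⟩, hz⟩ := hf
  refine ⟨⟨M, hM.conj⟩, fun ε hε => ?_⟩
  obtain ⟨ι, hι, a, ha, hz⟩ := hz ε hε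
  refine ⟨ι, hι, fun j x => starRingEnd ℂ (a j x), fun j => ?_, fun n => ?_⟩
  · obtain ⟨B, hB⟩ := ha j
    exact ⟨B, hB.conj⟩
  · obtain ⟨c, hc, hle⟩ := hz n
    refine ⟨fun j x => starRingEnd ℂ (c j x), fun j =>
      ⟨RCLike.continuous_conj.comp_aestronglyMeasurable (hc j).1, ?_⟩, ?_⟩
    · filter_upwards [(hc j).2] with x hx
      rwa [RCLike.norm_conj]
    · have e : ∀ x, ‖DistalHostKra.koopman φ n (fun x => starRingEnd ℂ (f x)) x -
          ∑ j, starRingEnd ℂ (c j x) * starRingEnd ℂ (a j x)‖ =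
          ‖DistalHostKra.koopman φ n f x - ∑ j, c j x * a j x‖ := by
        intro x
        rw [← RCLike.norm_conj]
        simp [DistalHostKra.koopman, map_sub, map_sum, map_mul]
      unfold condSq at hle ⊢
      simpa only [e] using hle

variable [IsProbabilityMeasure μ]

/-- By invariance of `m`, the function `T^n f` is itself an admissible coefficient for the single
generator `1`. -/
theorem of_measurable (hm : m ≤ m0) (hinv : IsInvariantSigma m φ) (hφ : MeasurePreserving φ μ μ)
    {M : ℝ} (hf : AEStronglyMeasurable[m] f μ) (hM : ∀ᵐ x ∂μ, ‖f x‖ ≤ M) :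
    IsBddAlmostPeriodic m φ μ f := by
  have hfM : BoundedBy μ M f := BoundedBy.mk' hm ⟨hf, hM⟩
  refine ⟨⟨M, hfM⟩, fun ε hε => ?_⟩
  -- `M` may be `0`, and rescaling needs a positive bound.
  refine HasBddZonotope.rescale (K := M + 1) (by linarith [hfM.nonneg]) ?_
  refine ⟨Unit, inferInstance, fun _ _ => 1, fun _ => ⟨_, BoundedBy.const 1⟩, fun n =>
    ⟨fun _ => DistalHostKra.koopman φ n f, fun _ => ⟨hinv.aestronglyMeasurable_koopman hφ n hf, ?_⟩, ?_⟩⟩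
  · exact ((hfM.koopman hφ n).mono (by linarith)).2
  · have e : (fun x => DistalHostKra.koopman φ n f x - ∑ _j : Unit, DistalHostKra.koopman φ n f x * 1) = fun _ => 0 := by
      funext x; simp
    rw [e]
    have hz : condSq m μ (fun _ : X => (0 : ℂ)) = fun _ => 0 := by
      unfold condSq
      simp
    rw [hz]
    exact ae_of_all _ fun _ => hε.le

theorem add (hm : m ≤ m0) (hφ : MeasurePreserving φ μ μ) (hf : IsBddAlmostPeriodic m φ μ f)
    (hg : IsBddAlmostPeriodic m φ μ g) : IsBddAlmostPeriodic m φ μ fun x => f x + g x := by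
  obtain ⟨⟨M, hM⟩, hzf⟩ := hf
  obtain ⟨⟨K, hK⟩, hzg⟩ := hg
  refine ⟨⟨M + K, hM.add hK⟩, fun ε hε => ?_⟩
  obtain ⟨ι, hι, a, ha, hza⟩ := hzf (ε / 4) (by positivity)
  obtain ⟨κ, hκ, b, hb, hzb⟩ := hzg (ε / 4) (by positivity)
  refine ⟨ι ⊕ κ, inferInstance, Sum.elim a b, fun j => ?_, fun n => ?_⟩
  · rcases j with j | j
    · exact ha j
    · exact hb j
  · obtain ⟨c, hc, hlec⟩ := hza n
    obtain ⟨d, hd, hled⟩ := hzb n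
    refine ⟨Sum.elim c d, fun j => ?_, ?_⟩
    · rcases j with j | j
      · exact hc j
      · exact hd j
    · obtain ⟨L, hL⟩ := exists_boundedBy_zonotope hm ha hc
      obtain ⟨L', hL'⟩ := exists_boundedBy_zonotope hm hb hd
      have h1 := condSq_add_le (m := m) (((hM.koopman hφ n).sub hL).memLp 2)
        (((hK.koopman hφ n).sub hL').memLp 2)
      have e : (fun x => DistalHostKra.koopman φ n (fun x => f x + g x) x -
          ∑ j, Sum.elim c d j x * Sum.elim a b j x) = fun x =>
          (DistalHostKra.koopman φ n f x - ∑ j, c j x * a j x) +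
            (DistalHostKra.koopman φ n g x - ∑ j, d j x * b j x) := by
        funext x
        simp only [DistalHostKra.koopman, Fintype.sum_sum_type, Sum.elim_inl, Sum.elim_inr]
        ring
      rw [e]
      filter_upwards [h1, hlec, hled] with x h1 h2 h3
      linarith

/-- Products of generators serve as generators. With `P` and `Q` the approximants of `T^n f` and
`T^n g`, the error is `T^n f (T^n g - Q) + Q (T^n f - P)`. Here bounded generators are essential,
since `Q` must be bounded uniformly in `n`. -/
theorem mul (hm : m ≤ m0) (hφ : MeasurePreserving φ μ μ) (hf : IsBddAlmostPeriodic m φ μ f)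
    (hg : IsBddAlmostPeriodic m φ μ g) : IsBddAlmostPeriodic m φ μ fun x => f x * g x := by
  obtain ⟨⟨M, hM⟩, hzf⟩ := hf
  obtain ⟨⟨K, hK⟩, hzg⟩ := hg
  refine ⟨⟨M * K, hM.mul hK⟩, fun ε hε => ?_⟩
  obtain ⟨κ, hκ, b, hb, hzb⟩ := hzg (ε / (4 * (M ^ 2 + 1))) (by positivity)
  choose B hB using hb
  -- `L` bounds the approximants of `T^n g` for all `n`, and the accuracy required for `f` depends
  -- on it. So `g` is approximated first.
  set L := ∑ j, 1 * B j with hL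
  obtain ⟨ι, hι, a, ha, hza⟩ := hzf (ε / (4 * (L ^ 2 + 1))) (by positivity)
  refine ⟨ι × κ, inferInstance, fun p x => a p.1 x * b p.2 x, fun p => ?_, fun n => ?_⟩
  · obtain ⟨A, hA⟩ := ha p.1
    exact ⟨_, hA.mul (hB p.2)⟩
  · obtain ⟨c, hc, hlec⟩ := hza n
    obtain ⟨d, hd, hled⟩ := hzb n
    refine ⟨fun p x => c p.1 x * d p.2 x, fun p => ⟨(hc p.1).1.mul (hd p.2).1, ?_⟩, ?_⟩
    · filter_upwards [(hc p.1).2, (hd p.2).2] with x h1 h2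
      rw [norm_mul]
      exact mul_le_one₀ h1 (norm_nonneg _) h2
    · have hdb : BoundedBy μ L fun x => ∑ j, d j x * b j x :=
        BoundedBy.sum Finset.univ fun j _ => (BoundedBy.mk' hm (hd j)).mul (hB j)
      obtain ⟨L', hca⟩ := exists_boundedBy_zonotope hm ha hc
      have hgd := (hK.koopman hφ n).sub hdb
      have hfc := (hM.koopman hφ n).sub hca
      have hsum := condSq_add_le (m := m) (((hM.koopman hφ n).mul hgd).memLp 2)
        ((hdb.mul hfc).memLp 2)
      have e : (fun x => DistalHostKra.koopman φ n (fun x => f x * g x) x -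
          ∑ p : ι × κ, c p.1 x * d p.2 x * (a p.1 x * b p.2 x)) = fun x =>
          DistalHostKra.koopman φ n f x *
            (DistalHostKra.koopman φ n g x - ∑ j, d j x * b j x) +
          (∑ j, d j x * b j x) * (DistalHostKra.koopman φ n f x - ∑ j, c j x * a j x) := by
        funext x
        have h1 : ∑ p : ι × κ, c p.1 x * d p.2 x * (a p.1 x * b p.2 x) =
            (∑ j, c j x * a j x) * ∑ j, d j x * b j x := by
          rw [Finset.sum_mul_sum, ← Finset.univ_product_univ, Finset.sum_product]
          exact Finset.sum_congr rfl fun i _ => Finset.sum_congr rfl fun j _ => by ring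
        rw [h1]
        simp only [DistalHostKra.koopman]
        ring
      rw [e]
      filter_upwards [hsum, condSq_mul_le (m := m) (hM.koopman hφ n) (hgd.memLp 2),
        condSq_mul_le (m := m) hdb (hfc.memLp 2), hlec, hled] with x h1 h2 h3 h4 h5
      have h6 : M ^ 2 * (ε / (4 * (M ^ 2 + 1))) ≤ ε / 4 := by
        rw [mul_div_assoc', div_le_div_iff₀ (by positivity) (by norm_num)]
        nlinarith [sq_nonneg M]
      have h7 : L ^ 2 * (ε / (4 * (L ^ 2 + 1))) ≤ ε / 4 := by
        rw [mul_div_assoc', div_le_div_iff₀ (by positivity) (by norm_num)]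
        nlinarith [sq_nonneg L]
      have h8 := mul_le_mul_of_nonneg_left h5 (sq_nonneg M)
      have h9 := mul_le_mul_of_nonneg_left h4 (sq_nonneg L)
      linarith

theorem isBddStarAlg (hm : m ≤ m0) (hinv : IsInvariantSigma m φ) (hφ : MeasurePreserving φ μ μ) :
    IsBddStarAlg μ {f | IsBddAlmostPeriodic m φ μ f} where
  bdd _ hf := hf.1
  congr _ hf _ h := hf.congr hφ h
  const _ := of_measurable hm hinv hφ aestronglyMeasurable_const (ae_of_all _ fun _ => le_rfl)
  add _ hf _ hg := hf.add hm hφ hg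
  mul _ hf _ hg := hf.mul hm hφ hg
  conj _ hf := hf.conj

end IsBddAlmostPeriodic

/-! ### Comparison with the general definition of conditional almost periodicity -/

theorem condNorm_eq (f : X → ℂ) : condNorm m μ f = fun x => √(condSq m μ f x) := rfl

theorem aestronglyMeasurable_condNorm (hm : m ≤ m0) (f : X → ℂ) :
    AEStronglyMeasurable (condNorm m μ f) μ :=
  (Real.continuous_sqrt.comp_stronglyMeasurable
    (stronglyMeasurable_condExp.mono hm)).aestronglyMeasurable

theorem BoundedBy.memCondL2 [IsProbabilityMeasure μ] (hm : m ≤ m0) {f : X → ℂ} {M : ℝ}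
    (hf : BoundedBy μ M f) : MemCondL2 m μ f := by
  refine ⟨hf.memLp 2, memLp_top_of_bound (aestronglyMeasurable_condNorm hm f) M ?_⟩
  filter_upwards [condSq_le hf hm] with x hx
  rw [condNorm_eq, Real.norm_of_nonneg (Real.sqrt_nonneg _)]
  exact Real.sqrt_le_iff.2 ⟨hf.nonneg, hx⟩

theorem eLpNorm_condNorm_lt {f : X → ℂ} {ε : ℝ} (hε : 0 < ε)
    (h : ∀ᵐ x ∂μ, condSq m μ f x ≤ (ε / 2) ^ 2) :
    eLpNorm (condNorm m μ f) ∞ μ < ENNReal.ofReal ε := by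
  have h1 : eLpNorm (condNorm m μ f) ∞ μ ≤ ENNReal.ofReal (ε / 2) := by
    rw [eLpNorm_exponent_top]
    refine eLpNormEssSup_le_of_ae_bound ?_
    filter_upwards [h] with x hx
    rw [condNorm_eq, Real.norm_of_nonneg (Real.sqrt_nonneg _)]
    exact Real.sqrt_le_iff.2 ⟨by positivity, hx⟩
  exact h1.trans_lt ((ENNReal.ofReal_lt_ofReal_iff hε).2 (by linarith))

theorem IsBddAlmostPeriodic.isCondAlmostPeriodic [IsProbabilityMeasure μ] (hm : m ≤ m0)
    {f : X → ℂ} (hf : IsBddAlmostPeriodic m φ μ f) : IsCondAlmostPeriodic m φ μ f := by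
  obtain ⟨⟨M, hM⟩, hz⟩ := hf
  refine ⟨hM.memCondL2 hm, fun ε hε => ?_⟩
  -- Squared because `condSq` is the square of the conditional norm; halved because the definition
  -- asks for a strict inequality.
  obtain ⟨ι, hι, g, hg, h⟩ := hz ((ε / 2) ^ 2) (by positivity)
  have e := Fintype.equivFin ι
  refine ⟨Fintype.card ι, fun j => g (e.symm j), fun j => ?_, fun n => ?_⟩
  · obtain ⟨B, hB⟩ := hg (e.symm j)
    exact hB.memCondL2 hm
  · obtain ⟨c, hc, hle⟩ := h n
    refine ⟨fun j => c (e.symm j), fun j => ⟨(hc _).1, ?_⟩, eLpNorm_condNorm_lt hε ?_⟩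
    · rw [eLpNorm_exponent_top]
      simpa using eLpNormEssSup_le_of_ae_bound (hc (e.symm j)).2
    · have h1 : ∀ x, ∑ j, c (e.symm j) x * g (e.symm j) x = ∑ j, c j x * g j x := fun x =>
        e.symm.sum_comp fun j => c j x * g j x
      simpa only [h1] using hle

/-! ### Conditional orthonormal families -/

/-- Conditional expectation is local on `m`-measurable sets, so functions glued along an
`m`-measurable partition can be treated piece by piece. -/
theorem condExp_eq_on [IsFiniteMeasure μ] {E : Type*} [NormedAddCommGroup E] [NormedSpace ℝ E]
    [CompleteSpace E] {f g : X → E} {s : Set X} (hs : MeasurableSet[m] s)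
    (hf : Integrable f μ) (hg : Integrable g μ) (h : ∀ x ∈ s, f x = g x) :
    ∀ᵐ x ∂μ, x ∈ s → (μ[f | m]) x = (μ[g | m]) x := by
  have e : s.indicator f = s.indicator g := by
    funext x
    by_cases hx : x ∈ s
    · rw [Set.indicator_of_mem hx, Set.indicator_of_mem hx, h x hx]
    · rw [Set.indicator_of_notMem hx, Set.indicator_of_notMem hx]
  have h1 := condExp_indicator (m := m) hf hs
  have h2 := condExp_indicator (m := m) hg hs
  rw [e] at h1
  filter_upwards [h1, h2] with x h1 h2 hx
  rw [h1, Set.indicator_of_mem hx, Set.indicator_of_mem hx] at h2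
  exact h2

/-- A family of bounded functions that is conditionally orthogonal, with conditional norms
`0` or `1`. -/
structure IsCondOrthonormal (m : MeasurableSpace X) [m0 : MeasurableSpace X] (μ : Measure X)
    (e : ℕ → X → ℂ) : Prop where
  measurable : ∀ i, Measurable (e i)
  bdd : ∀ i, ∃ K, BoundedBy μ K (e i)
  orth : ∀ i j, i ≠ j → condInner m μ (e i) (e j) =ᵐ[μ] 0
  norm : ∀ i v, (∃ K, BoundedBy μ K v) →
    (fun x => condInner m μ v (e i) x * condInner m μ (e i) (e i) x) =ᵐ[μ] condInner m μ v (e i)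

/-- The residual of `v` after conditional projection onto the span of `e 0, …, e (r - 1)`. -/
noncomputable def residual (m : MeasurableSpace X) [m0 : MeasurableSpace X] (μ : Measure X)
    (e : ℕ → X → ℂ) (r : ℕ) (v : X → ℂ) : X → ℂ :=
  fun x => v x - ∑ i ∈ Finset.range r, condInner m μ v (e i) x * e i x

namespace IsCondOrthonormal

variable [IsProbabilityMeasure μ] {e : ℕ → X → ℂ} {v w : X → ℂ} {M K : ℝ}

theorem exists_boundedBy_residual (he : IsCondOrthonormal m μ e) (hm : m ≤ m0) (r : ℕ) (M : ℝ) :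
    ∃ R, 0 ≤ R ∧ ∀ v, BoundedBy μ M v → BoundedBy μ R (residual m μ e r v) := by
  choose K hK using he.bdd
  refine ⟨|M + ∑ i ∈ Finset.range r, M * K i * K i|, abs_nonneg _, fun v hv => ?_⟩
  exact (hv.sub (BoundedBy.sum _ fun i _ => (hv.condInner hm (hK i)).mul (hK i))).mono
    (le_abs_self _)

theorem condInner_residual (he : IsCondOrthonormal m μ e) (hm : m ≤ m0) (r : ℕ)
    (hv : BoundedBy μ M v) (hw : BoundedBy μ K w) :
    ∀ᵐ x ∂μ, condInner m μ (residual m μ e r v) w x = condInner m μ v w x -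
      ∑ i ∈ Finset.range r, condInner m μ v (e i) x * condInner m μ (e i) w x := by
  choose B hB using he.bdd
  have hci : ∀ i, BoundedBy μ (M * B i) (condInner m μ v (e i)) := fun i =>
    hv.condInner hm (hB i)
  have h1 := condInner_sub_left (m := m) hv
    (BoundedBy.sum (Finset.range r) fun i _ => (hci i).mul (hB i)) hw
  have h2 := condInner_sum_left (m := m) (Finset.range r)
    (fun i _ => (hci i).mul (hB i)) hw
  have h3 : ∀ᵐ x ∂μ, ∀ i, condInner m μ (fun x => condInner m μ v (e i) x * e i x) w x =
      condInner m μ v (e i) x * condInner m μ (e i) w x :=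
    ae_all_iff.2 fun i => condInner_mul_left hm (aestronglyMeasurable_condInner v (e i))
      (hci i).2 (hB i) hw
  filter_upwards [h1, h2, h3] with x h1 h2 h3
  have h4 : condInner m μ (residual m μ e r v) w x = _ := h1
  rw [h4, h2]
  simp only [h3]

/-- Orthogonality leaves only the term of index `j`, and the `norm` identity makes it cancel the
component of `v` also at points where `e j` vanishes conditionally. -/
theorem condInner_residual_basis (he : IsCondOrthonormal m μ e) (hm : m ≤ m0) {r j : ℕ}
    (hj : j < r) (hv : BoundedBy μ M v) :
    condInner m μ (residual m μ e r v) (e j) =ᵐ[μ] 0 := by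
  obtain ⟨B, hB⟩ := he.bdd j
  have horth : ∀ᵐ x ∂μ, ∀ i, i ≠ j → condInner m μ (e i) (e j) x = 0 :=
    ae_all_iff.2 fun i => by
      by_cases hij : i = j
      · exact ae_of_all _ fun x h => absurd hij h
      · exact (he.orth i j hij).mono fun x hx _ => hx
  filter_upwards [he.condInner_residual hm r hv hB, horth, he.norm j v ⟨M, hv⟩] with x h1 h2 h3
  rw [h1, Finset.sum_eq_single j (fun i _ hij => by rw [h2 i hij, mul_zero])
    (fun h => absurd (Finset.mem_range.2 hj) h), h3, sub_self]
  rfl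

/-- The residual is orthogonal to every subtracted direction, so `v` may be replaced by its residual
in the first slot. -/
theorem condInner_residual_self (he : IsCondOrthonormal m μ e) (hm : m ≤ m0) (r : ℕ)
    (hv : BoundedBy μ M v) :
    ∀ᵐ x ∂μ, condInner m μ v (residual m μ e r v) x = (condSq m μ (residual m μ e r v) x : ℂ) := by
  obtain ⟨R, _, hR⟩ := he.exists_boundedBy_residual hm r M
  choose B hB using he.bdd
  have h0 : ∀ᵐ x ∂μ, ∀ i, i < r → condInner m μ (e i) (residual m μ e r v) x = 0 :=
    ae_all_iff.2 fun i => by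
      by_cases hi : i < r
      · filter_upwards [condInner_swap (m := m) (hR v hv) (hB i),
          he.condInner_residual_basis hm hi hv] with x h1 h2 _
        rw [h1, h2]; simp
      · exact ae_of_all _ fun x h => absurd h hi
  filter_upwards [he.condInner_residual hm r hv (hR v hv), h0, condInner_self (m := m) (hR v hv)]
    with x h1 h2 h3
  rw [← h3, h1, Finset.sum_eq_zero, sub_zero]
  intro i hi
  rw [h2 i (Finset.mem_range.1 hi), mul_zero]

/-- The difference of the two sides is the conditional square of the residual. -/
theorem bessel (he : IsCondOrthonormal m μ e) (hm : m ≤ m0) (r : ℕ) (hv : BoundedBy μ M v) :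
    ∀ᵐ x ∂μ, ∑ i ∈ Finset.range r, ‖condInner m μ v (e i) x‖ ^ 2 ≤ condSq m μ v x := by
  obtain ⟨R, _, hR⟩ := he.exists_boundedBy_residual hm r M
  choose B hB using he.bdd
  have h0 : ∀ᵐ x ∂μ, ∀ i, condInner m μ (e i) v x = starRingEnd ℂ (condInner m μ v (e i) x) :=
    ae_all_iff.2 fun i => condInner_swap hv (hB i)
  filter_upwards [he.condInner_residual hm r hv hv, h0, condInner_self (m := m) hv,
    he.condInner_residual_self hm r hv, condInner_swap (m := m) (hR v hv) hv,
    condSq_nonneg (m := m) (μ := μ) (residual m μ e r v)] with x h1 h2 h3 h4 h5 h6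
  have h7 : (condSq m μ (residual m μ e r v) x : ℂ) =
      condSq m μ v x - ∑ i ∈ Finset.range r, (‖condInner m μ v (e i) x‖ : ℂ) ^ 2 := by
    have : (condSq m μ (residual m μ e r v) x : ℂ) =
        starRingEnd ℂ (condInner m μ (residual m μ e r v) v x) := by rw [← h4, h5]
    rw [this, h1, h3]
    simp only [h2, Complex.mul_conj', map_sub, map_sum, map_pow, Complex.conj_ofReal]
  have h8 : condSq m μ (residual m μ e r v) x =
      condSq m μ v x - ∑ i ∈ Finset.range r, ‖condInner m μ v (e i) x‖ ^ 2 := by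
    exact_mod_cast h7
  linarith

end IsCondOrthonormal

/-! ### The conditional Gram-Schmidt process with selection -/

/-- The outcome of `r` steps of the conditional Gram-Schmidt process with selection for the
sequence `H`: on `S`, every step `i` has selected an index `N i` such that the component of
`H (N i)` in the direction `e i` is at least `√δ`; outside of `S` all residuals are small. -/
structure IsSelection (m : MeasurableSpace X) [m0 : MeasurableSpace X] (μ : Measure X)
    (H : ℕ → X → ℂ) (δ : ℝ) (r : ℕ) (e : ℕ → X → ℂ) (S : Set X) (N : ℕ → X → ℕ) : Prop where
  orthonormal : IsCondOrthonormal m μ e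
  zero : ∀ i, r ≤ i → e i = 0
  measurableSet : MeasurableSet[m] S
  measurable : ∀ i, Measurable[m] (N i)
  selected : ∀ i < r, ∀ᵐ x ∂μ, x ∈ S → √δ ≤ (condInner m μ (H (N i x)) (e i) x).re
  small : ∀ n, ∀ᵐ x ∂μ, x ∉ S → condSq m μ (residual m μ e r (H n)) x ≤ δ

theorem measurable_eval_nat {E : Type*} [MeasurableSpace E] {R : ℕ → X → E} {ν : X → ℕ}
    (hR : ∀ n, Measurable (R n)) (hν : Measurable ν) : Measurable fun x => R (ν x) x := by
  have h : Measurable fun p : ℕ × X => R p.1 p.2 := measurable_from_prod_countable_right hR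
  exact h.comp (hν.prodMk measurable_id)

theorem condInner_zero_right (v : X → ℂ) : condInner m μ v 0 = 0 := by
  simp only [condInner, Pi.zero_apply, map_zero, mul_zero]
  exact condExp_zero

theorem isSelection_zero [IsProbabilityMeasure μ] (H : ℕ → X → ℂ) (δ : ℝ) :
    IsSelection m μ H δ 0 (fun _ => 0) Set.univ (fun _ _ => 0) where
  orthonormal :=
    { measurable := fun _ => measurable_zero
      bdd := fun _ => ⟨_, BoundedBy.const 0⟩
      orth := fun _ _ _ => by rw [condInner_zero_right]
      norm := fun _ v _ => by
        simp only [show (fun _ : X => (0 : ℂ)) = 0 from rfl, condInner_zero_right, Pi.zero_apply,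
          mul_zero]
        rfl }
  zero _ _ := rfl
  measurableSet := MeasurableSet.univ
  measurable _ := measurable_const
  selected i hi := absurd hi (Nat.not_lt_zero i)
  small _ := ae_of_all _ fun x hx => absurd (Set.mem_univ x) hx

theorem measurable_sInf_nat {q : ℕ → X → ℝ} (hq : ∀ n, Measurable (q n)) (δ : ℝ) :
    Measurable fun x => sInf {n | δ < q n x} := by
  refine measurable_to_nat fun x => ?_
  set k := sInf {n | δ < q n x} with hk
  have hmeas : ∀ n, MeasurableSet {y | δ < q n y} := fun n => measurableSet_lt measurable_const (hq n)
  -- The infimum of the empty set is `0`, so the fibre over `0` also contains the points where no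
  -- index qualifies.
  have e : (fun x => sInf {n | δ < q n x}) ⁻¹' {k} =
      ({y | δ < q k y} ∩ ⋂ n < k, {y | δ < q n y}ᶜ) ∪
        (if k = 0 then ⋂ n, {y | δ < q n y}ᶜ else ∅) := by
    ext y
    simp only [Set.mem_preimage, Set.mem_singleton_iff, Set.mem_union, Set.mem_inter_iff,
      Set.mem_iInter, Set.mem_compl_iff]
    constructor
    · intro hy
      rcases Set.eq_empty_or_nonempty {n | δ < q n y} with h | h
      · right
        have hk0 : k = 0 := by rw [← hy, h, Nat.sInf_empty]
        rw [if_pos hk0]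
        simp only [Set.mem_iInter, Set.mem_compl_iff]
        intro n hn
        have : n ∈ {n | δ < q n y} := hn
        rw [h] at this
        exact this
      · left
        refine ⟨?_, fun n hn hn' => ?_⟩
        · have := Nat.sInf_mem h
          rw [hy] at this
          exact this
        · rw [← hy] at hn
          exact Nat.notMem_of_lt_sInf hn hn'
    · rintro (⟨h1, h2⟩ | h)
      · refine le_antisymm (Nat.sInf_le h1) ?_
        by_contra hlt
        push Not at hlt
        exact h2 _ hlt (Nat.sInf_mem (s := {n | δ < q n y}) ⟨k, h1⟩)
      · split_ifs at h with hk0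
        · rw [hk0]
          have : {n | δ < q n y} = ∅ := by
            ext n
            simp only [Set.mem_iInter, Set.mem_compl_iff] at h
            exact ⟨fun hn => h n hn, fun hn => hn.elim⟩
          rw [this, Nat.sInf_empty]
        · exact h.elim
  rw [e]
  refine MeasurableSet.union ((hmeas k).inter
    (MeasurableSet.iInter fun n => MeasurableSet.iInter fun _ => (hmeas n).compl)) ?_
  split_ifs
  · exact MeasurableSet.iInter fun n => (hmeas n).compl
  · exact MeasurableSet.empty

/-- At each point of `S` where some residual has conditional square above `δ`, the first such
residual is normalised; elsewhere the new vector is `0`. The selected index is an `m`-measurable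
function with countably many values, so the conditional inner products of the glued vector are those
of its pieces. At a point lost from `S` all residuals are at most `δ`, and they do not change there,
because the new vector vanishes. -/
theorem IsSelection.succ [IsProbabilityMeasure μ] (hm : m ≤ m0) {H : ℕ → X → ℂ} {δ C : ℝ}
    (hδ : 0 < δ) (hH : ∀ n, Measurable (H n)) (hC : ∀ n, BoundedBy μ C (H n)) {r : ℕ}
    {e : ℕ → X → ℂ} {S : Set X} {N : ℕ → X → ℕ} (h : IsSelection m μ H δ r e S N) :
    ∃ e' S' N', IsSelection m μ H δ (r + 1) e' S' N' := by
  classical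
  have he := h.orthonormal
  choose B hB using he.bdd
  obtain ⟨R0, hR0, hR0b⟩ := he.exists_boundedBy_residual hm r C
  set R : ℕ → X → ℂ := fun n => residual m μ e r (H n) with hR
  have hRb : ∀ n, BoundedBy μ R0 (R n) := fun n => hR0b _ (hC n)
  have hRm : ∀ n, Measurable (R n) := fun n => by
    refine (hH n).sub (Finset.measurable_sum _ fun i _ => ?_)
    exact ((measurable_condInner _ _).mono hm le_rfl).mul (he.measurable i)
  set q : ℕ → X → ℝ := fun n => condSq m μ (R n) with hq
  have hqm : ∀ n, Measurable[m] (q n) := fun n => measurable_condSq _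
  -- Its default value `0`, where no residual is large, is harmless: the new vector is supported on
  -- `S'`.
  set ν : X → ℕ := fun x => sInf {n | δ < q n x} with hν
  have hνm : Measurable[m] ν := @measurable_sInf_nat X m q hqm δ
  set S' : Set X := S ∩ {x | ∃ n, δ < q n x} with hS'
  have hS'm : MeasurableSet[m] S' := by
    refine h.measurableSet.inter ?_
    have : {x | ∃ n, δ < q n x} = ⋃ n, {x | δ < q n x} := by ext; simp
    rw [this]
    exact MeasurableSet.iUnion fun n => (hqm n) measurableSet_Ioi
  have hqν : ∀ x ∈ S', δ < q (ν x) x := fun x hx => Nat.sInf_mem (s := {n | δ < q n x}) hx.2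
  set c : X → ℝ := fun x => (√(q (ν x) x))⁻¹ with hc
  have hqνm : Measurable[m] fun x => q (ν x) x := @measurable_eval_nat X m ℝ _ q ν hqm hνm
  have hcm : Measurable[m] c := (Real.continuous_sqrt.measurable.comp hqνm).inv
  have hcS : ∀ x ∈ S', c x ≤ (√δ)⁻¹ := fun x hx => by
    simp only [hc]
    exact inv_anti₀ (Real.sqrt_pos.2 hδ) (Real.sqrt_le_sqrt (hqν x hx).le)
  have hc0 : ∀ x, 0 ≤ c x := fun x => inv_nonneg.2 (Real.sqrt_nonneg _)
  set f : X → ℂ := S'.indicator fun x => (c x : ℂ) * R (ν x) x with hf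
  have hfm : Measurable f := by
    refine Measurable.indicator ?_ (hm _ hS'm)
    exact (Complex.measurable_ofReal.comp (hcm.mono hm le_rfl)).mul
      (measurable_eval_nat hRm (hνm.mono hm le_rfl))
  have hfb : BoundedBy μ ((√δ)⁻¹ * R0) f := by
    refine ⟨hfm.aestronglyMeasurable, ?_⟩
    filter_upwards [ae_all_iff.2 fun n => (hRb n).2] with x hx
    by_cases hxS : x ∈ S'
    · rw [hf, Set.indicator_of_mem hxS, norm_mul, Complex.norm_real, Real.norm_of_nonneg (hc0 x)]
      exact mul_le_mul (hcS x hxS) (hx _) (norm_nonneg _) (by positivity)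
    · rw [hf, Set.indicator_of_notMem hxS, norm_zero]; positivity
  -- the glued function behaves like its pieces
  have glue_off : ∀ v K, BoundedBy μ K v → ∀ᵐ x ∂μ, x ∉ S' → condInner m μ f v x = 0 := by
    intro v K hv
    have := condExp_eq_on (μ := μ) hS'm.compl (f := fun x => f x * starRingEnd ℂ (v x))
      (g := fun _ => 0) (hfb.mul hv.conj).integrable (integrable_zero _ _ _) (fun x hx => by
        simp only [hf]; rw [Set.indicator_of_notMem hx, zero_mul])
    filter_upwards [this] with x hx hxS
    have h0 : (μ[fun _ : X => (0 : ℂ) | m]) x = 0 := by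
      have := condExp_zero (μ := μ) (m := m) (E := ℂ)
      exact congrFun this x
    exact (hx hxS).trans h0
  -- On a level set of `ν` the glued vector is a fixed residual times a bounded `m`-measurable
  -- factor, which can be pulled out.
  have glue_on : ∀ v K, BoundedBy μ K v → ∀ᵐ x ∂μ, x ∈ S' →
      condInner m μ f v x = c x * condInner m μ (R (ν x)) v x := by
    intro v K hv
    have hpiece : ∀ n, ∀ᵐ x ∂μ, x ∈ S' ∩ ν ⁻¹' {n} →
        condInner m μ f v x = c x * condInner m μ (R n) v x := by
      intro n
      set A := S' ∩ ν ⁻¹' {n} with hA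
      have hAm : MeasurableSet[m] A := hS'm.inter (hνm (MeasurableSet.singleton n))
      have hcn : BoundedBy μ (√δ)⁻¹ (A.indicator fun x => (c x : ℂ)) ∧
          AEStronglyMeasurable[m] (A.indicator fun x => (c x : ℂ)) μ := by
        have h1 : Measurable[m] (A.indicator fun x => (c x : ℂ)) :=
          (Complex.measurable_ofReal.comp hcm).indicator hAm
        refine ⟨⟨(h1.mono hm le_rfl).aestronglyMeasurable, ae_of_all _ fun x => ?_⟩,
          h1.stronglyMeasurable.aestronglyMeasurable⟩
        by_cases hx : x ∈ A
        · rw [Set.indicator_of_mem hx, Complex.norm_real, Real.norm_of_nonneg (hc0 x)]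
          exact hcS x hx.1
        · rw [Set.indicator_of_notMem hx, norm_zero]; positivity
      have h1 := condExp_eq_on (μ := μ) hAm (f := fun x => f x * starRingEnd ℂ (v x))
        (g := fun x => A.indicator (fun x => (c x : ℂ)) x * R n x * starRingEnd ℂ (v x))
        (hfb.mul hv.conj).integrable ((hcn.1.mul (hRb n)).mul hv.conj).integrable
        (fun x hx => by
          have hxn : ν x = n := hx.2
          simp only [hf]
          rw [Set.indicator_of_mem hx.1, Set.indicator_of_mem hx, hxn])
      have h2 := condInner_mul_left (m := m) hm hcn.2 hcn.1.2 (hRb n) hv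
      filter_upwards [h1, h2] with x h1 h2 hx
      have h3 := h1 hx
      rw [Set.indicator_of_mem hx] at h2
      exact h3.trans h2
    filter_upwards [ae_all_iff.2 hpiece] with x hx hxS
    exact hx (ν x) ⟨hxS, rfl⟩
  have hfe : ∀ j, condInner m μ f (e j) =ᵐ[μ] 0 := by
    intro j
    by_cases hj : j < r
    · have h1 : ∀ᵐ x ∂μ, ∀ n, condInner m μ (R n) (e j) x = 0 :=
        ae_all_iff.2 fun n => he.condInner_residual_basis hm hj (hC n)
      filter_upwards [glue_off _ _ (hB j), glue_on _ _ (hB j), h1] with x h2 h3 h1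
      by_cases hx : x ∈ S'
      · rw [h3 hx, h1, mul_zero]; rfl
      · exact h2 hx
    · rw [h.zero j (not_lt.1 hj), condInner_zero_right]
  have hef : ∀ j, condInner m μ (e j) f =ᵐ[μ] 0 := fun j => by
    filter_upwards [condInner_swap (m := m) hfb (hB j), hfe j] with x h1 h2
    rw [h1, h2]; simp
  -- components along the new vector
  have hvf_off : ∀ v K, BoundedBy μ K v → ∀ᵐ x ∂μ, x ∉ S' → condInner m μ v f x = 0 := by
    intro v K hv
    filter_upwards [glue_off v K hv, condInner_swap (m := m) hfb hv] with x h1 h2 hx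
    rw [h2, h1 hx, map_zero]
  have hRf : ∀ᵐ x ∂μ, x ∈ S' → condInner m μ (R (ν x)) f x = c x * q (ν x) x := by
    have h1 : ∀ᵐ x ∂μ, ∀ n, x ∈ S' → condInner m μ f (R n) x = c x * condInner m μ (R (ν x)) (R n) x :=
      ae_all_iff.2 fun n => glue_on _ _ (hRb n)
    have h2 : ∀ᵐ x ∂μ, ∀ n, condInner m μ (R n) f x = starRingEnd ℂ (condInner m μ f (R n) x) :=
      ae_all_iff.2 fun n => condInner_swap hfb (hRb n)
    have h3 : ∀ᵐ x ∂μ, ∀ n, condInner m μ (R n) (R n) x = (q n x : ℂ) :=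
      ae_all_iff.2 fun n => condInner_self (hRb n)
    filter_upwards [h1, h2, h3] with x h1 h2 h3 hx
    rw [h2, h1 _ hx, h3, map_mul, Complex.conj_ofReal, Complex.conj_ofReal]
  -- The selected vector has the same component along the new direction as its residual, because its
  -- inner product with the residual is the square of the residual.
  have hHf : ∀ᵐ x ∂μ, x ∈ S' → condInner m μ (H (ν x)) f x = c x * q (ν x) x := by
    have h1 : ∀ᵐ x ∂μ, ∀ n, x ∈ S' → condInner m μ f (H n) x = c x * condInner m μ (R (ν x)) (H n) x :=
      ae_all_iff.2 fun n => glue_on _ _ (hC n)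
    have h2 : ∀ᵐ x ∂μ, ∀ n, condInner m μ (H n) f x = starRingEnd ℂ (condInner m μ f (H n) x) :=
      ae_all_iff.2 fun n => condInner_swap hfb (hC n)
    have h3 : ∀ᵐ x ∂μ, ∀ n, condInner m μ (H n) (R n) x = (q n x : ℂ) :=
      ae_all_iff.2 fun n => he.condInner_residual_self hm r (hC n)
    have h4 : ∀ᵐ x ∂μ, ∀ n, condInner m μ (R n) (H n) x = starRingEnd ℂ (condInner m μ (H n) (R n) x) :=
      ae_all_iff.2 fun n => condInner_swap (hC n) (hRb n)
    filter_upwards [h1, h2, h3, h4] with x h1 h2 h3 h4 hx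
    rw [h2, h1 _ hx, h4, h3, map_mul, Complex.conj_ofReal, Complex.conj_ofReal, Complex.conj_ofReal]
  have hcq : ∀ x ∈ S', c x * q (ν x) x = √(q (ν x) x) := fun x hx => by
    have h0 : 0 < √(q (ν x) x) := Real.sqrt_pos.2 (hδ.trans (hqν x hx))
    have h1 : q (ν x) x = √(q (ν x) x) * √(q (ν x) x) :=
      (Real.mul_self_sqrt (hδ.trans (hqν x hx)).le).symm
    calc c x * q (ν x) x = (√(q (ν x) x))⁻¹ * (√(q (ν x) x) * √(q (ν x) x)) := by
          rw [← h1]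
      _ = √(q (ν x) x) := by rw [← mul_assoc, inv_mul_cancel₀ h0.ne', one_mul]
  have hff : ∀ᵐ x ∂μ, x ∈ S' → condInner m μ f f x = 1 := by
    filter_upwards [glue_on _ _ hfb, hRf] with x h1 h2 hx
    rw [h1 hx, h2 hx]
    have h0 : 0 < √(q (ν x) x) := Real.sqrt_pos.2 (hδ.trans (hqν x hx))
    have h3 := hcq x hx
    have h4 : c x * (c x * q (ν x) x) = 1 := by rw [h3]; exact inv_mul_cancel₀ h0.ne'
    exact_mod_cast h4
  refine ⟨Function.update e r f, S', Function.update N r ν, ?_⟩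
  have hne : ∀ i, i < r → Function.update e r f i = e i := fun i hi =>
    Function.update_of_ne hi.ne _ _
  have hres : ∀ n, residual m μ (Function.update e r f) (r + 1) (H n) =
      fun x => R n x - condInner m μ (H n) f x * f x := by
    intro n
    funext x
    simp only [hR, residual]
    rw [Finset.sum_range_succ, Function.update_self, ← sub_sub]
    congr 2
    exact Finset.sum_congr rfl fun i hi => by rw [hne i (Finset.mem_range.1 hi)]
  refine ⟨⟨fun i => ?_, fun i => ?_, fun i j hij => ?_, fun i v hv => ?_⟩, fun i hi => ?_, hS'm,
    fun i => ?_, fun i hi => ?_, fun n => ?_⟩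
  · by_cases hi : i = r
    · subst hi; rwa [Function.update_self]
    · rw [Function.update_of_ne hi]; exact he.measurable i
  · by_cases hi : i = r
    · subst hi; rw [Function.update_self]; exact ⟨_, hfb⟩
    · rw [Function.update_of_ne hi]; exact he.bdd i
  · by_cases hi : i = r
    · subst hi
      rw [Function.update_self, Function.update_of_ne (Ne.symm hij)]
      exact hfe j
    · by_cases hj : j = r
      · subst hj
        rw [Function.update_self, Function.update_of_ne hij]
        exact hef i
      · rw [Function.update_of_ne hi, Function.update_of_ne hj]
        exact he.orth i j hij
  · by_cases hi : i = r
    · subst hi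
      rw [Function.update_self]
      obtain ⟨K, hK⟩ := hv
      filter_upwards [hff, hvf_off v K hK] with x h1 h2
      by_cases hx : x ∈ S'
      · rw [h1 hx, mul_one]
      · rw [h2 hx, zero_mul]
    · rw [Function.update_of_ne hi]; exact he.norm i v hv
  · rw [Function.update_of_ne (by omega)]
    exact h.zero i (by omega)
  · by_cases hi : i = r
    · subst hi; rw [Function.update_self]; exact hνm
    · rw [Function.update_of_ne hi]; exact h.measurable i
  · rcases (Nat.lt_succ_iff.1 hi).lt_or_eq with hi | rfl
    · rw [Function.update_of_ne hi.ne, Function.update_of_ne hi.ne]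
      filter_upwards [h.selected i hi] with x hx hxS
      exact hx hxS.1
    · rw [Function.update_self, Function.update_self]
      filter_upwards [hHf] with x hx hxS
      rw [hx hxS, ← Complex.ofReal_mul, hcq x hxS, Complex.ofReal_re]
      exact Real.sqrt_le_sqrt (hqν x hxS).le
  · rw [hres]
    have hb : BoundedBy μ _ fun x => R n x - condInner m μ (H n) f x * f x :=
      (hRb n).sub (((hC n).condInner hm hfb).mul hfb)
    have h1 := condExp_eq_on (μ := μ) hS'm.compl
      (f := fun x => ‖R n x - condInner m μ (H n) f x * f x‖ ^ 2) (g := fun x => ‖R n x‖ ^ 2)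
      ((hb.memLp 2).integrable_norm_pow two_ne_zero)
      (((hRb n).memLp 2).integrable_norm_pow two_ne_zero) (fun x hx => by
        have : f x = 0 := by rw [hf]; exact Set.indicator_of_notMem hx _
        simp only [this, mul_zero, sub_zero])
    filter_upwards [h1, h.small n] with x h1 h2 hx
    have h3 : condSq m μ (fun x => R n x - condInner m μ (H n) f x * f x) x = q n x := h1 hx
    rw [h3]
    by_cases hxS : x ∈ S
    · by_contra hlt
      exact hx ⟨hxS, n, not_le.1 hlt⟩
    · exact h2 hxS

theorem exists_isSelection [IsProbabilityMeasure μ] (hm : m ≤ m0) {H : ℕ → X → ℂ} {δ C : ℝ}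
    (hδ : 0 < δ) (hH : ∀ n, Measurable (H n)) (hC : ∀ n, BoundedBy μ C (H n)) (r : ℕ) :
    ∃ e S N, IsSelection m μ H δ r e S N := by
  induction r with
  | zero => exact ⟨_, _, _, isSelection_zero H δ⟩
  | succ r ih =>
    obtain ⟨e, S, N, h⟩ := ih
    exact h.succ hm hδ hH hC

/-! ### Weak limits along ultrafilters -/

/-- Testing against the phase of `h` on the set `‖h‖ > C` shows that the integral of `‖h‖ - C` over
this set is at most `0`. -/
theorem bound_of_norm_integral_le [IsProbabilityMeasure μ] {h : X → ℂ} {C : ℝ}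
    (hh : MemLp h 2 μ) (hm : Measurable h)
    (hle : ∀ s : Set X, MeasurableSet s →
      ‖∫ x, h x * starRingEnd ℂ (s.indicator (fun x => h x / ‖h x‖) x) ∂μ‖ ≤ C * μ.real s) :
    ∀ᵐ x ∂μ, ‖h x‖ ≤ C := by
  set s : Set X := {x | C < ‖h x‖} with hs
  have hsm : MeasurableSet s := measurableSet_lt measurable_const hm.norm
  have e : ∀ x, h x * starRingEnd ℂ (s.indicator (fun x => h x / ‖h x‖) x) =
      ((s.indicator (fun x => ‖h x‖) x : ℝ) : ℂ) := by
    intro x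
    by_cases hx : x ∈ s
    · rw [Set.indicator_of_mem hx, Set.indicator_of_mem hx, map_div₀, Complex.conj_ofReal,
        mul_div_assoc', Complex.mul_conj']
      rcases eq_or_ne (‖h x‖ : ℂ) 0 with h0 | h0
      · rw [h0]; simp
      · field_simp
    · rw [Set.indicator_of_notMem hx, Set.indicator_of_notMem hx]; simp
  have hint : Integrable (fun x => ‖h x‖) μ := (hh.integrable (by norm_num)).norm
  have h1 := hle s hsm
  simp only [e] at h1
  rw [integral_complex_ofReal, Complex.norm_real, integral_indicator hsm, Real.norm_of_nonneg
    (integral_nonneg fun _ => norm_nonneg _)] at h1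
  have h2 : ∫ x in s, (‖h x‖ - C) ∂μ ≤ 0 := by
    rw [integral_sub hint.integrableOn (integrable_const C).integrableOn]
    simp only [integral_const, smul_eq_mul, measureReal_restrict_apply_univ]
    linarith
  have hnn : 0 ≤ᵐ[μ.restrict s] fun x => ‖h x‖ - C := by
    filter_upwards [ae_restrict_mem hsm] with x hx
    exact sub_nonneg.2 (le_of_lt hx)
  have h3 : ∫ x in s, (‖h x‖ - C) ∂μ = 0 := le_antisymm h2 (integral_nonneg_of_ae hnn)
  rw [integral_eq_zero_iff_of_nonneg_ae hnn
    (hint.integrableOn.sub (integrable_const C).integrableOn)] at h3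
  have h4 := (ae_restrict_iff' hsm).1 h3
  filter_upwards [h4] with x hx
  by_contra hlt
  have hxs : x ∈ s := not_le.1 hlt
  have := hx hxs
  simp only [Pi.zero_apply] at this
  linarith [show C < ‖h x‖ from hxs]

/-- Banach–Alaoglu in `L²`, taken along an ultrafilter so that no subsequences are needed. The
uniform bound survives because it is detected by integrals against phases supported on sets. -/
theorem exists_weak_limit [IsProbabilityMeasure μ] {u : ℕ → X → ℂ} {C : ℝ}
    (hu : ∀ N, BoundedBy μ C (u N)) (𝒰 : Ultrafilter ℕ) :
    ∃ h : X → ℂ, Measurable h ∧ BoundedBy μ C h ∧ ∀ v, MemLp v 2 μ →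
      Tendsto (fun N => ∫ x, u N x * starRingEnd ℂ (v x) ∂μ) 𝒰
        (𝓝 (∫ x, h x * starRingEnd ℂ (v x) ∂μ)) := by
  have hC : 0 ≤ C := (hu 0).nonneg
  set L : ℕ → Lp ℂ 2 μ := fun N => ((hu N).memLp 2).toLp (u N) with hL
  have hLn : ∀ N, ‖L N‖ ≤ C := fun N => by
    refine le_of_pow_le_pow_left₀ two_ne_zero hC ?_
    rw [norm_toLp_sq]
    have := integral_mono_ae (((hu N).memLp 2).integrable_norm_pow two_ne_zero)
      (integrable_const (μ := μ) (C ^ 2)) (by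
        filter_upwards [(hu N).2] with x hx
        exact pow_le_pow_left₀ (norm_nonneg _) hx 2)
    simpa using this
  set F : ℕ → WeakDual ℂ (Lp ℂ 2 μ) := fun N =>
    StrongDual.toWeakDual (InnerProductSpace.toDual ℂ (Lp ℂ 2 μ) (L N)) with hF
  have hK := WeakDual.isCompact_closedBall (𝕜 := ℂ) (E := Lp ℂ 2 μ) 0 C
  obtain ⟨y, _, hy⟩ := hK.ultrafilter_le_nhds (𝒰.map F) (by
    rw [le_principal_iff, Ultrafilter.mem_coe, Ultrafilter.mem_map]
    refine Filter.mem_of_superset Filter.univ_mem fun N _ => ?_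
    simp only [hF, Set.mem_preimage, Metric.mem_closedBall, dist_zero_right]
    have : ‖InnerProductSpace.toDual ℂ (Lp ℂ 2 μ) (L N)‖ = ‖L N‖ := LinearIsometryEquiv.norm_map _ _
    exact this.le.trans (hLn N))
  set G : Lp ℂ 2 μ := (InnerProductSpace.toDual ℂ (Lp ℂ 2 μ)).symm (WeakDual.toStrongDual y) with hG
  have hlim : ∀ v : Lp ℂ 2 μ, Tendsto (fun N => inner ℂ (L N) v) 𝒰 (𝓝 (inner ℂ G v)) := by
    intro v
    have h1 : Tendsto F 𝒰 (𝓝 y) := hy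
    have h2 := ((WeakDual.eval_continuous v).tendsto y).comp h1
    have e : inner ℂ G v = y v := by
      rw [hG, InnerProductSpace.toDual_symm_apply]
      rfl
    rw [e]
    exact h2
  have hGm : MemLp (G : X → ℂ) 2 μ := Lp.memLp G
  have hmeas : Measurable (G : X → ℂ) := (Lp.stronglyMeasurable G).measurable
  have hlim' : ∀ v, MemLp v 2 μ → Tendsto (fun N => ∫ x, u N x * starRingEnd ℂ (v x) ∂μ) 𝒰
        (𝓝 (∫ x, G x * starRingEnd ℂ (v x) ∂μ)) := by
    intro v hv
    have h1 := (RCLike.continuous_conj (K := ℂ)).tendsto _ |>.comp (hlim (hv.toLp v))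
    have e1 : ∀ N, ∫ x, u N x * starRingEnd ℂ (v x) ∂μ =
        starRingEnd ℂ (inner ℂ (L N) (hv.toLp v)) := fun N => by
      rw [inner_conj_symm, hL, inner_toLp]
    have e2 : ∫ x, G x * starRingEnd ℂ (v x) ∂μ = starRingEnd ℂ (inner ℂ G (hv.toLp v)) := by
      rw [inner_conj_symm, inner_Lp]
      refine integral_congr_ae ?_
      filter_upwards [hv.coeFn_toLp] with x hx
      rw [hx]
    simp only [e1, e2]
    exact h1
  refine ⟨G, hmeas, ⟨hGm.1, bound_of_norm_integral_le hGm hmeas fun s hs => ?_⟩, hlim'⟩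
  have hvb : BoundedBy μ 1 (s.indicator fun x => G x / ‖G x‖) := by
    refine ⟨((hmeas.div (Complex.measurable_ofReal.comp hmeas.norm)).indicator
      hs).aestronglyMeasurable, ae_of_all _ fun x => ?_⟩
    by_cases hx : x ∈ s
    · rw [Set.indicator_of_mem hx, norm_div, Complex.norm_real, norm_norm]
      exact div_self_le_one _
    · rw [Set.indicator_of_notMem hx]; simp
  refine le_of_tendsto (hlim' _ (hvb.memLp 2)).norm (Eventually.of_forall fun N => ?_)
  refine (norm_integral_le_integral_norm _).trans ?_
  have hsi : Integrable (s.indicator fun _ : X => C) μ := (integrable_const C).indicator hs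
  have h1 : ∫ x, ‖u N x * starRingEnd ℂ (s.indicator (fun x => G x / ‖G x‖) x)‖ ∂μ ≤
      ∫ x, s.indicator (fun _ => C) x ∂μ := by
    refine integral_mono_ae ((hu N).mul hvb.conj).integrable.norm hsi ?_
    filter_upwards [(hu N).2] with x hx
    by_cases hxs : x ∈ s
    · simp only [Set.indicator_of_mem hxs]
      rw [norm_mul, RCLike.norm_conj, norm_div, Complex.norm_real, norm_norm]
      exact (mul_le_of_le_one_right (norm_nonneg _) (div_self_le_one _)).trans hx
    · simp [Set.indicator_of_notMem hxs]
  refine h1.trans_eq ?_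
  rw [integral_indicator hs]
  simp [mul_comm]

/-! ### Correlation averages -/

/-- The average of `T^n f · E(g · conj (T^n f) | m)` over `1 ≤ n ≤ N`. -/
noncomputable def corrAverage (m : MeasurableSpace X) [m0 : MeasurableSpace X] (φ : X ≃ᵐ X)
    (μ : Measure X) (f g : X → ℂ) (N : ℕ) : X → ℂ :=
  fun x => (1 / (N : ℂ)) * ∑ n ∈ Finset.Icc 1 N,
    koopman φ n f x * condInner m μ g (koopman φ n f) x

/-- The first `r` index functions take countably many joint values, and a countable union of null
sets is null. -/
theorem exists_pos_fiber {S : Set X} (hS : μ S ≠ 0) (r : ℕ) (N : ℕ → X → ℕ) :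
    ∃ ρ : ℕ → ℕ, μ (S ∩ ⋂ i ∈ Finset.range r, N i ⁻¹' {ρ i}) ≠ 0 := by
  by_contra hcon
  push Not at hcon
  apply hS
  have hcov : S ⊆ ⋃ ρ : Fin r → ℕ,
      S ∩ ⋂ i ∈ Finset.range r, N i ⁻¹' {if h : i < r then ρ ⟨i, h⟩ else 0} := by
    intro x hx
    refine Set.mem_iUnion.2 ⟨fun i => N i x, hx, ?_⟩
    simp only [Set.mem_iInter, Finset.mem_range, Set.mem_preimage, Set.mem_singleton_iff]
    intro i hi
    rw [dif_pos hi]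
  exact measure_mono_null hcov (measure_iUnion_null fun ρ => hcon _)

section

variable [IsProbabilityMeasure μ] {f g : X → ℂ} {M K : ℝ}

theorem boundedBy_corrAverage (hm : m ≤ m0) (hφ : MeasurePreserving φ μ μ)
    (hf : BoundedBy μ M f) (hg : BoundedBy μ K g) (N : ℕ) :
    BoundedBy μ (M * (K * M)) (corrAverage m φ μ f g N) :=
  BoundedBy.average (by have := hf.nonneg; have := hg.nonneg; positivity)
    (fun n => (hf.koopman hφ n).mul (hg.condInner hm (hf.koopman hφ n))) N

theorem integral_corrAverage (hm : m ≤ m0) (hφ : MeasurePreserving φ μ μ)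
    (hf : BoundedBy μ M f) (hg : BoundedBy μ K g) {v : X → ℂ} {L : ℝ} (hv : BoundedBy μ L v)
    (N : ℕ) :
    ∫ x, corrAverage m φ μ f g N x * starRingEnd ℂ (v x) ∂μ =
      (1 / (N : ℂ)) * ∑ n ∈ Finset.Icc 1 N, ∫ x, koopman φ n f x *
        condInner m μ g (koopman φ n f) x * starRingEnd ℂ (v x) ∂μ := by
  rw [← integral_average (u := fun n x => koopman φ n f x *
        condInner m μ g (koopman φ n f) x * starRingEnd ℂ (v x))
    (fun n => (((hf.koopman hφ n).mul (hg.condInner hm (hf.koopman hφ n))).mul hv.conj).integrable)]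
  refine integral_congr_ae (ae_of_all _ fun x => ?_)
  simp only [corrAverage]
  rw [mul_assoc, Finset.sum_mul]

theorem tendsto_average_shift_sub {a : ℤ → ℂ} {D : ℝ} (ha : ∀ n, ‖a n‖ ≤ D) (k : ℤ) :
    Tendsto (fun N : ℕ => (1 / (N : ℂ)) * ∑ n ∈ Finset.Icc 1 N, a (n + k) -
      (1 / (N : ℂ)) * ∑ n ∈ Finset.Icc 1 N, a n) atTop (𝓝 0) := by
  have hb : ∀ N : ℕ, ‖∑ n ∈ Finset.Icc 1 N, a (n + k) - ∑ n ∈ Finset.Icc 1 N, a n‖ ≤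
      2 * k.natAbs * D := by
    intro N
    rcases le_total 0 k with hk | hk
    · obtain ⟨j, rfl⟩ := Int.eq_ofNat_of_zero_le hk
      have := norm_sum_shift_sub_le (a := fun n : ℕ => a n) (fun n => ha n) N j
      simpa using this
    · obtain ⟨j, hj⟩ := Int.eq_ofNat_of_zero_le (neg_nonneg.2 hk)
      obtain rfl : k = -j := by omega
      have := norm_sum_shift_sub_le (a := fun n : ℕ => a (n + -j)) (fun n => ha _) N j
      rw [norm_sub_rev]
      simpa using this
  rw [tendsto_zero_iff_norm_tendsto_zero]
  refine squeeze_zero (fun _ => norm_nonneg _) (g := fun N : ℕ => (2 * k.natAbs * D) / N)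
    (fun N => ?_) (tendsto_const_div_atTop_nhds_zero_nat _)
  rw [← mul_sub, norm_mul, one_div, norm_inv, Complex.norm_natCast, div_eq_inv_mul]
  exact mul_le_mul_of_nonneg_left (hb N) (by positivity)

/-- Weak limits of correlation averages commute with the dynamics. -/
theorem tendsto_integral_corrAverage_koopman (hm : m ≤ m0) (hinv : IsInvariantSigma m φ)
    (hφ : MeasurePreserving φ μ μ) (hf : BoundedBy μ M f) (hg : BoundedBy μ K g)
    {𝒰 : Ultrafilter ℕ} (h𝒰 : (𝒰 : Filter ℕ) ≤ atTop) {h : X → ℂ}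
    (hlim : ∀ v, MemLp v 2 μ →
      Tendsto (fun N => ∫ x, corrAverage m φ μ f g N x * starRingEnd ℂ (v x) ∂μ) 𝒰
        (𝓝 (∫ x, h x * starRingEnd ℂ (v x) ∂μ)))
    (k : ℤ) {v : X → ℂ} {L : ℝ} (hv : BoundedBy μ L v) :
    Tendsto (fun N => ∫ x, corrAverage m φ μ f (koopman φ k g) N x * starRingEnd ℂ (v x) ∂μ) 𝒰
      (𝓝 (∫ x, koopman φ k h x * starRingEnd ℂ (v x) ∂μ)) := by
  have hgk := hg.koopman hφ k
  set a : ℤ → ℂ := fun n => ∫ x, koopman φ n f x *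
    condInner m μ (koopman φ k g) (koopman φ n f) x * starRingEnd ℂ (v x) ∂μ with ha
  have hab : ∀ n, ‖a n‖ ≤ M * (K * M) * L := fun n =>
    (((hf.koopman hφ n).mul (hgk.condInner hm (hf.koopman hφ n))).mul hv.conj).norm_integral_le
  have hv' : BoundedBy μ L (koopman φ (-k) v) := hv.koopman hφ (-k)
  have h1 := hlim _ (hv'.memLp 2)
  have e1 : ∫ x, h x * starRingEnd ℂ (koopman φ (-k) v x) ∂μ =
      ∫ x, koopman φ k h x * starRingEnd ℂ (v x) ∂μ := by
    rw [← integral_koopman hφ k]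
    refine integral_congr_ae (ae_of_all _ fun x => ?_)
    have := congrFun (koopman_koopman (φ := φ) k (-k) v) x
    rw [add_neg_cancel, koopman_zero] at this
    simp only [koopman] at this ⊢
    rw [this]
  -- Conditional expectation commutes with `T^k`, so moving the shift off the test function replaces
  -- `n` by `n + k`. Shifting the range of a bounded average does not affect its limit.
  have e2 : ∀ N : ℕ, ∫ x, corrAverage m φ μ f g N x * starRingEnd ℂ (koopman φ (-k) v x) ∂μ =
      (1 / (N : ℂ)) * ∑ n ∈ Finset.Icc 1 N, a (n + k) := by
    intro N
    rw [integral_corrAverage hm hφ hf hg hv']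
    congr 1
    refine Finset.sum_congr rfl fun n _ => ?_
    rw [← integral_koopman hφ k]
    refine integral_congr_ae ?_
    have hce := condExp_koopman hm hinv hφ k
      (hg.mul (hf.koopman hφ n).conj).integrable
    filter_upwards [hce] with x hx
    have h2 := congrFun (koopman_koopman (φ := φ) k (-k) v) x
    rw [add_neg_cancel, koopman_zero] at h2
    have h3 := congrFun (koopman_koopman (φ := φ) k n f) x
    rw [add_comm] at h3
    have h4 : condInner m μ (koopman φ k g) (koopman φ (n + k) f) x =
        koopman φ k (condInner m μ g (koopman φ n f)) x := by
      rw [condInner, condInner, ← hx]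
      congr 2
      funext y
      have h5 := congrFun (koopman_koopman (φ := φ) k n f) y
      rw [add_comm] at h5
      rw [← h5]
      rfl
    rw [h4, ← h3]
    simp only [koopman] at h2 ⊢
    rw [h2]
  rw [e1] at h1
  simp only [e2] at h1
  have h2 := h1.sub ((tendsto_average_shift_sub hab k).mono_left h𝒰)
  simp only [sub_sub_cancel, sub_zero] at h2
  refine h2.congr fun N => ?_
  rw [integral_corrAverage hm hφ hf hgk hv]

/-- The correlation of `g` with `T^n f`, cut off to `E`, is `m`-measurable and bounded by `K M`. It
is pulled out of the conditional expectation, which leaves the component of `T^n f` along `e`. -/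
theorem norm_integral_corr_le (hm : m ≤ m0) (hφ : MeasurePreserving φ μ μ)
    (hf : BoundedBy μ M f) (hg : BoundedBy μ K g) {e : X → ℂ} {B : ℝ} (he : BoundedBy μ B e)
    {E : Set X} (hE : MeasurableSet[m] E) (n : ℕ) :
    ‖∫ x, koopman φ n f x * condInner m μ g (koopman φ n f) x *
      starRingEnd ℂ (E.indicator e x) ∂μ‖ ≤
        K * M * ∫ x in E, ‖condInner m μ (koopman φ n f) e x‖ ∂μ := by
  have hfn := hf.koopman hφ n
  have hD := hg.condInner hm hfn
  set c : X → ℂ := E.indicator (condInner m μ g (koopman φ n f)) with hc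
  have hcm : AEStronglyMeasurable[m] c μ :=
    ((measurable_condInner g (koopman φ n f)).indicator hE).stronglyMeasurable.aestronglyMeasurable
  have hcb : ∀ᵐ x ∂μ, ‖c x‖ ≤ K * M := by
    filter_upwards [hD.2] with x hx
    exact (Set.indicator_le_self' (f := fun x => ‖condInner m μ g (koopman φ n f) x‖)
      (fun _ _ => norm_nonneg _) x |>.trans' (by rw [hc, norm_indicator_eq_indicator_norm])).trans hx
  have e1 : ∀ x, koopman φ n f x * condInner m μ g (koopman φ n f) x *
      starRingEnd ℂ (E.indicator e x) = c x * (koopman φ n f x * starRingEnd ℂ (e x)) := by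
    intro x
    by_cases hx : x ∈ E
    · simp only [hc, Set.indicator_of_mem hx]; ring
    · simp only [hc, Set.indicator_of_notMem hx, map_zero, mul_zero, zero_mul]
  simp only [e1]
  rw [integral_mul_condExp hm hcm hcb (hfn.mul he.conj).integrable]
  refine (norm_integral_le_integral_norm _).trans ?_
  have hci := hfn.condInner hm he
  rw [← integral_indicator (hm _ hE), ← integral_const_mul]
  refine integral_mono_ae ((BoundedBy.mk' hm ⟨hcm, hcb⟩).mul hci).integrable.norm
    ((hci.integrable.norm.indicator (hm _ hE)).const_mul _) ?_
  filter_upwards [hcb] with x hx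
  by_cases hxE : x ∈ E
  · simp only [Set.indicator_of_mem hxE]
    rw [norm_mul]
    exact mul_le_mul_of_nonneg_right hx (norm_nonneg _)
  · simp [hc, Set.indicator_of_notMem hxE]

/-- The Hilbert–Schmidt estimate. For each `n`, Cauchy–Schwarz and Bessel bound the sum of the `r`
components of `T^n f` pointwise by `√r M`. Growth like `√r` instead of `r` is what stops the
selection process; the functions `G i` may differ from one `i` to the next. -/
theorem sum_norm_integral_corrAverage_le (hm : m ≤ m0) (hφ : MeasurePreserving φ μ μ)
    (hf : BoundedBy μ M f) {r : ℕ} {G : ℕ → X → ℂ} (hG : ∀ i, BoundedBy μ K (G i))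
    {e : ℕ → X → ℂ} (he : IsCondOrthonormal m μ e) {E : Set X} (hE : MeasurableSet[m] E) (N : ℕ) :
    ∑ i ∈ Finset.range r, ‖∫ x, corrAverage m φ μ f (G i) N x *
      starRingEnd ℂ (E.indicator (e i) x) ∂μ‖ ≤ K * M * (√r * M) * μ.real E := by
  choose B hB using he.bdd
  have hM := hf.nonneg
  have hK := (hG 0).nonneg
  have hEB : ∀ i, BoundedBy μ (B i) (E.indicator (e i)) := fun i =>
    ⟨(hB i).1.indicator (hm _ hE), by
      filter_upwards [(hB i).2] with x hx
      exact (norm_indicator_le_norm_self _ _).trans hx⟩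
  have hterm : ∀ n : ℕ, ∑ i ∈ Finset.range r, ‖∫ x, koopman φ n f x *
      condInner m μ (G i) (koopman φ n f) x * starRingEnd ℂ (E.indicator (e i) x) ∂μ‖ ≤
        K * M * (√r * M) * μ.real E := by
    intro n
    have hfn := hf.koopman hφ n
    have hint : ∀ i, Integrable (fun x => ‖condInner m μ (koopman φ n f) (e i) x‖) (μ.restrict E) :=
      fun i => (hfn.condInner hm (hB i)).integrable.norm.integrableOn
    refine (Finset.sum_le_sum fun i _ => norm_integral_corr_le hm hφ hf (hG i) (hB i) hE n).trans ?_
    rw [← Finset.mul_sum, ← integral_finsetSum _ fun i _ => hint i]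
    have h1 : ∫ x in E, ∑ i ∈ Finset.range r, ‖condInner m μ (koopman φ n f) (e i) x‖ ∂μ ≤
        ∫ _ in E, √r * M ∂μ := by
      refine integral_mono_ae (integrable_finsetSum _ fun i _ => hint i) (integrable_const _) ?_
      refine ae_restrict_of_ae ?_
      filter_upwards [he.bessel hm r hfn, condSq_le (m := m) hfn hm] with x h1 h2
      have h3 := sq_sum_le_card_mul_sum_sq (s := Finset.range r)
        (f := fun i => ‖condInner m μ (koopman φ n f) (e i) x‖)
      rw [Finset.card_range] at h3
      refine le_of_pow_le_pow_left₀ two_ne_zero (by positivity) (h3.trans ?_)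
      rw [mul_pow, Real.sq_sqrt (Nat.cast_nonneg r)]
      exact mul_le_mul_of_nonneg_left (h1.trans h2) (Nat.cast_nonneg r)
    refine (mul_le_mul_of_nonneg_left h1 (mul_nonneg hK hM)).trans_eq ?_
    simp only [integral_const, smul_eq_mul, measureReal_restrict_apply_univ]
    ring
  have hle : ∀ i, ‖∫ x, corrAverage m φ μ f (G i) N x * starRingEnd ℂ (E.indicator (e i) x) ∂μ‖ ≤
      avg (fun n => ‖∫ x, koopman φ n f x * condInner m μ (G i) (koopman φ n f) x *
        starRingEnd ℂ (E.indicator (e i) x) ∂μ‖) N := by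
    intro i
    rw [integral_corrAverage hm hφ hf (hG i) (hEB i), norm_mul, avg]
    simp only [one_div, norm_inv, Complex.norm_natCast]
    exact mul_le_mul_of_nonneg_left (norm_sum_le _ _) (by positivity)
  refine (Finset.sum_le_sum fun i _ => hle i).trans ?_
  rw [← avg_finsetSum]
  exact avg_le (by positivity) hterm N

/-- Weak limits of correlation averages are conditionally almost periodic. -/
theorem isBddAlmostPeriodic_of_weak_limit (hm : m ≤ m0) (hinv : IsInvariantSigma m φ)
    (hφ : MeasurePreserving φ μ μ) (hf : BoundedBy μ M f) (hg : BoundedBy μ K g)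
    {𝒰 : Ultrafilter ℕ} (h𝒰 : (𝒰 : Filter ℕ) ≤ atTop) {h : X → ℂ} {C : ℝ} (hmeas : Measurable h)
    (hC : BoundedBy μ C h) (hlim : ∀ v, MemLp v 2 μ →
      Tendsto (fun N => ∫ x, corrAverage m φ μ f g N x * starRingEnd ℂ (v x) ∂μ) 𝒰
        (𝓝 (∫ x, h x * starRingEnd ℂ (v x) ∂μ))) :
    IsBddAlmostPeriodic m φ μ h := by
  refine ⟨⟨C, hC⟩, fun δ hδ => ?_⟩
  have hM := hf.nonneg
  have hK := hg.nonneg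
  -- The selection process needs the two-sided orbit of `h` listed as a sequence.
  set dec : ℕ ≃ ℤ := Equiv.intEquivNat.symm
  set H : ℕ → X → ℂ := fun k => koopman φ (dec k) h with hH
  have hHm : ∀ k, Measurable (H k) := fun k => hmeas.comp (measurable_zpow φ _)
  have hHC : ∀ k, BoundedBy μ C (H k) := fun k => hC.koopman hφ _
  set A := K * M * M with hA
  -- Success of `r` steps on a set of positive measure would force `r √δ ≤ A √r`, that is `r ≤ A² /
  -- δ`.
  obtain ⟨r, hr⟩ := exists_nat_gt (A ^ 2 / δ)
  have hr0 : (0 : ℝ) < r := lt_of_le_of_lt (by positivity) hr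
  obtain ⟨e, S, N, hsel⟩ := exists_isSelection hm hδ hHm hHC r
  have he := hsel.orthonormal
  choose B hB using he.bdd
  -- If `S` is null, all residuals of the orbit are small almost everywhere, and the selected
  -- vectors generate the zonotope with the conditional components as coefficients.
  by_cases hS : μ S = 0
  · refine HasBddZonotope.rescale (K := C + 1) (by linarith [hC.nonneg]) ?_
    refine ⟨Fin r, inferInstance, fun i => e i, fun i => ⟨B i, hB i⟩, fun n => ?_⟩
    refine ⟨fun i => condInner m μ (koopman φ n h) (e i), fun i =>
      ⟨aestronglyMeasurable_condInner _ _, ?_⟩, ?_⟩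
    · have hn := hC.koopman hφ n
      filter_upwards [he.bessel hm r hn, condSq_le (m := m) hn hm] with x h1 h2
      have h3 : ‖condInner m μ (koopman φ n h) (e i) x‖ ^ 2 ≤
          ∑ j ∈ Finset.range r, ‖condInner m μ (koopman φ n h) (e j) x‖ ^ 2 :=
        Finset.single_le_sum (f := fun j => ‖condInner m μ (koopman φ n h) (e j) x‖ ^ 2)
          (fun j _ => by positivity) (Finset.mem_range.2 i.2)
      have h4 : ‖condInner m μ (koopman φ n h) (e i) x‖ ≤ C :=
        le_of_pow_le_pow_left₀ two_ne_zero hC.nonneg (h3.trans (h1.trans h2))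
      linarith
    · have h1 := hsel.small (dec.symm n)
      have hSae : ∀ᵐ x ∂μ, x ∉ S := measure_eq_zero_iff_ae_notMem.1 hS
      filter_upwards [h1, hSae] with x h1 h2
      have h3 := h1 h2
      simp only [hH, Equiv.apply_symm_apply] at h3
      have e1 : (fun x => koopman φ n h x - ∑ j : Fin r,
          condInner m μ (koopman φ n h) (e j) x * e j x) = residual m μ e r (koopman φ n h) := by
        funext y
        rw [residual, Fin.sum_univ_eq_sum_range
          (fun j => condInner m μ (koopman φ n h) (e j) y * e j y)]
      rw [e1]
      exact h3
  · exfalso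
    -- Restricting to a set `E` where the selected indices are constant allows integrating against
    -- single orbit elements, and so using the weak limit.
    obtain ⟨ρ, hρ⟩ := exists_pos_fiber hS r N
    set E := S ∩ ⋂ i ∈ Finset.range r, N i ⁻¹' {ρ i} with hE
    have hEm : MeasurableSet[m] E := by
      refine hsel.measurableSet.inter ?_
      exact Finset.measurableSet_biInter _ fun i _ => hsel.measurable i (MeasurableSet.singleton _)
    have hEpos : 0 < μ.real E := by
      rw [measureReal_def]
      exact ENNReal.toReal_pos hρ (measure_ne_top _ _)
    have hEB : ∀ i, BoundedBy μ (B i) (E.indicator (e i)) := fun i =>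
      ⟨(hB i).1.indicator (hm _ hEm), by
        filter_upwards [(hB i).2] with x hx
        exact (norm_indicator_le_norm_self _ _).trans hx⟩
    have hlow : ∀ i ∈ Finset.range r, √δ * μ.real E ≤
        ‖∫ x, koopman φ (dec (ρ i)) h x * starRingEnd ℂ (E.indicator (e i) x) ∂μ‖ := by
      intro i hi
      have e1 : ∫ x, koopman φ (dec (ρ i)) h x * starRingEnd ℂ (E.indicator (e i) x) ∂μ =
          ∫ x in E, condInner m μ (H (ρ i)) (e i) x ∂μ := by
        have h1 := setIntegral_condExp hm ((hHC (ρ i)).mul (hB i).conj).integrable hEm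
        rw [condInner, h1, ← integral_indicator (hm _ hEm)]
        refine integral_congr_ae (ae_of_all _ fun x => ?_)
        by_cases hx : x ∈ E
        · simp only [Set.indicator_of_mem hx, hH]
        · simp only [Set.indicator_of_notMem hx, map_zero, mul_zero]
      rw [e1]
      have hint : Integrable (condInner m μ (H (ρ i)) (e i)) (μ.restrict E) :=
        ((hHC (ρ i)).condInner hm (hB i)).integrable.integrableOn
      refine le_trans ?_ (Complex.re_le_norm _)
      have e2 : (∫ x in E, condInner m μ (H (ρ i)) (e i) x ∂μ).re =
          ∫ x in E, (condInner m μ (H (ρ i)) (e i) x).re ∂μ := (integral_re hint).symm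
      rw [e2]
      have h2 : ∫ _ in E, √δ ∂μ ≤ ∫ x in E, (condInner m μ (H (ρ i)) (e i) x).re ∂μ := by
        refine integral_mono_ae (integrable_const _) hint.re ?_
        refine (ae_restrict_iff' (hm _ hEm)).2 ?_
        filter_upwards [hsel.selected i (Finset.mem_range.1 hi)] with x hx hxE
        have h3 : N i x = ρ i := by
          have := hxE.2
          simp only [Set.mem_iInter] at this
          exact this i hi
        have h4 := hx hxE.1
        rw [h3] at h4
        exact h4
      simpa [mul_comm] using h2
    have htend : Tendsto (fun n : ℕ => ∑ i ∈ Finset.range r,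
        ‖∫ x, corrAverage m φ μ f (koopman φ (dec (ρ i)) g) n x *
          starRingEnd ℂ (E.indicator (e i) x) ∂μ‖) 𝒰
        (𝓝 (∑ i ∈ Finset.range r,
          ‖∫ x, koopman φ (dec (ρ i)) h x * starRingEnd ℂ (E.indicator (e i) x) ∂μ‖)) :=
      tendsto_finsetSum _ fun i _ =>
        (tendsto_integral_corrAverage_koopman hm hinv hφ hf hg h𝒰 hlim (dec (ρ i)) (hEB i)).norm
    have hup := le_of_tendsto htend (Eventually.of_forall fun n =>
      sum_norm_integral_corrAverage_le hm hφ hf (r := r)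
        (G := fun i => koopman φ (dec (ρ i)) g) (fun i => hg.koopman hφ _) he hEm n)
    have hlow' := (Finset.card_nsmul_le_sum _ _ _ hlow).trans hup
    rw [Finset.card_range, nsmul_eq_mul] at hlow'
    have h5 : r * √δ ≤ A * √r := by
      have : (r * √δ) * μ.real E ≤ (A * √r) * μ.real E := by rw [hA]; nlinarith
      exact le_of_mul_le_mul_right this hEpos
    have h6 : (r * √δ) ^ 2 ≤ (A * √r) ^ 2 := pow_le_pow_left₀ (by positivity) h5 2
    rw [mul_pow, mul_pow, Real.sq_sqrt hδ.le, Real.sq_sqrt hr0.le] at h6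
    rw [div_lt_iff₀ hδ] at hr
    nlinarith

end

/-! ### The orthogonal complement of the almost periodic functions -/

/-- `w` is orthogonal to the bounded conditionally almost periodic functions. -/
def IsOrthogonalToAlmostPeriodic (m : MeasurableSpace X) [m0 : MeasurableSpace X] (φ : X ≃ᵐ X)
    (μ : Measure X) (w : X → ℂ) : Prop :=
  ∀ a, IsBddAlmostPeriodic m φ μ a → ∫ x, w x * starRingEnd ℂ (a x) ∂μ = 0

section

variable {w g : X → ℂ} {M K : ℝ}

theorem IsOrthogonalToAlmostPeriodic.shift (hφ : MeasurePreserving φ μ μ)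
    (hw : IsOrthogonalToAlmostPeriodic m φ μ w) (n : ℤ) :
    IsOrthogonalToAlmostPeriodic m φ μ (koopman φ n w) := by
  intro a ha
  rw [← hw _ (ha.koopman hφ (-n)), ← integral_koopman hφ n]
  refine (integral_koopman hφ n _).trans ?_
  rw [← integral_koopman hφ (-n)]
  refine integral_congr_ae (ae_of_all _ fun x => ?_)
  have h := congrFun (koopman_koopman (φ := φ) (-n) n w) x
  rw [neg_add_cancel, koopman_zero] at h
  simp only [DistalHostKra.koopman] at h ⊢
  rw [h]

theorem integral_norm_condInner_le {a b : X → ℂ} (ha : Integrable a μ) (hb : BoundedBy μ M b) :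
    ∫ x, ‖condInner m μ a b x‖ ∂μ ≤ M * ∫ x, ‖a x‖ ∂μ := by
  refine (integral_norm_condExp_le _).trans ?_
  rw [← integral_const_mul]
  refine integral_mono_ae (ha.mul_bdd hb.conj.1 hb.conj.2).norm (ha.norm.const_mul _) ?_
  filter_upwards [hb.2] with x hx
  rw [norm_mul, RCLike.norm_conj, mul_comm]
  exact mul_le_mul_of_nonneg_right hx (norm_nonneg _)

theorem exists_boundedBy_integral_norm_sub_le {g : X → ℂ} (hg : Integrable g μ) {ε : ℝ}
    (hε : 0 < ε) : ∃ (g' : X → ℂ) (K : ℝ), BoundedBy μ K g' ∧ ∫ x, ‖g x - g' x‖ ∂μ ≤ ε := by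
  obtain ⟨s, hs, hs1⟩ := (memLp_one_iff_integrable.2 hg).exists_simpleFunc_eLpNorm_sub_lt
    ENNReal.one_ne_top (ENNReal.ofReal_pos.2 hε).ne'
  obtain ⟨K, hK⟩ := s.exists_forall_norm_le
  refine ⟨s, K, ⟨s.aestronglyMeasurable, ae_of_all _ hK⟩, ?_⟩
  refine (integral_norm_eq_lintegral_enorm (hg.1.sub s.aestronglyMeasurable)).trans_le ?_
  rw [eLpNorm_one_eq_lintegral_enorm] at hs
  exact ENNReal.toReal_le_of_le_ofReal hε.le hs.le

variable [IsProbabilityMeasure μ]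

theorem integral_mul_conj_self_eq_zero {h : X → ℂ} (hh : BoundedBy μ M h)
    (h0 : ∫ x, h x * starRingEnd ℂ (h x) ∂μ = 0) : h =ᵐ[μ] 0 := by
  have e : ∫ x, h x * starRingEnd ℂ (h x) ∂μ = ((∫ x, ‖h x‖ ^ 2 ∂μ : ℝ) : ℂ) := by
    rw [← integral_complex_ofReal]
    refine integral_congr_ae (ae_of_all _ fun x => ?_)
    simp only [Complex.mul_conj']
    push_cast; rfl
  rw [e, Complex.ofReal_eq_zero, integral_eq_zero_iff_of_nonneg (fun _ => by positivity)
    ((hh.memLp 2).integrable_norm_pow two_ne_zero)] at h0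
  filter_upwards [h0] with x hx
  simpa using hx

theorem integral_corr_self (hm : m ≤ m0) (hw : BoundedBy μ M w) (hg : BoundedBy μ K g) :
    ∫ x, w x * condInner m μ g w x * starRingEnd ℂ (g x) ∂μ =
      ((∫ x, ‖condInner m μ g w x‖ ^ 2 ∂μ : ℝ) : ℂ) := by
  have hD := hg.condInner hm hw
  have e1 : ∀ x, w x * condInner m μ g w x * starRingEnd ℂ (g x) =
      condInner m μ g w x * (w x * starRingEnd ℂ (g x)) := fun x => by ring
  simp only [e1]
  rw [integral_mul_condExp hm (aestronglyMeasurable_condInner g w) hD.2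
    (hw.mul hg.conj).integrable, ← integral_complex_ofReal]
  refine integral_congr_ae ?_
  filter_upwards [condInner_swap (m := m) hg hw] with x hx
  rw [condInner] at hx
  simp only [hx, Complex.mul_conj']
  push_cast; rfl

/-- Pairing the correlation averages with `g` gives exactly the averages in question, so it is
enough that every weak limit `h` vanishes. It does, being almost periodic while the averages are
orthogonal to almost periodic functions. -/
theorem tendsto_avg_condInner_sq (hm : m ≤ m0) (hinv : IsInvariantSigma m φ)
    (hφ : MeasurePreserving φ μ μ) (hw : BoundedBy μ M w)
    (horth : IsOrthogonalToAlmostPeriodic m φ μ w) (hg : BoundedBy μ K g) :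
    Tendsto (avg fun n => ∫ x, ‖condInner m μ g (koopman φ n w) x‖ ^ 2 ∂μ) atTop (𝓝 0) := by
  rw [tendsto_iff_ultrafilter]
  intro 𝒰 h𝒰
  obtain ⟨h, hmeas, hC, hlim⟩ := exists_weak_limit
    (fun N => boundedBy_corrAverage hm hφ hw hg N) 𝒰
  have hAP := isBddAlmostPeriodic_of_weak_limit hm hinv hφ hw hg h𝒰 hmeas hC hlim
  -- The coefficient is `m`-measurable and bounded, hence almost periodic; it can be moved to the
  -- side of `h`, and the product is still almost periodic.
  have hzero : ∀ N, ∫ x, corrAverage m φ μ w g N x * starRingEnd ℂ (h x) ∂μ = 0 := by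
    intro N
    rw [integral_corrAverage hm hφ hw hg hC]
    refine mul_eq_zero_of_right _ (Finset.sum_eq_zero fun n _ => ?_)
    have hD := hg.condInner hm (hw.koopman hφ n)
    have hDap : IsBddAlmostPeriodic m φ μ fun x =>
        starRingEnd ℂ (condInner m μ g (koopman φ n w) x) :=
      (IsBddAlmostPeriodic.of_measurable hm hinv hφ (aestronglyMeasurable_condInner _ _) hD.2).conj
    rw [← horth.shift hφ n _ (hDap.mul hm hφ hAP)]
    refine integral_congr_ae (ae_of_all _ fun x => ?_)
    simp only [map_mul, RingHomCompTriple.comp_apply, RingHom.id_apply]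
    ring
  have h1 := hlim h (hC.memLp 2)
  simp only [hzero] at h1
  have h2 : h =ᵐ[μ] 0 :=
    integral_mul_conj_self_eq_zero hC (tendsto_nhds_unique h1 tendsto_const_nhds)
  have h3 := hlim g (hg.memLp 2)
  have h4 : ∫ x, h x * starRingEnd ℂ (g x) ∂μ = 0 := by
    rw [integral_congr_ae (g := fun _ => (0 : ℂ)) (by
      filter_upwards [h2] with x hx
      rw [hx]; simp), integral_zero]
  rw [h4] at h3
  have h5 : ∀ N, ∫ x, corrAverage m φ μ w g N x * starRingEnd ℂ (g x) ∂μ =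
      ((avg (fun n => ∫ x, ‖condInner m μ g (koopman φ n w) x‖ ^ 2 ∂μ) N : ℝ) : ℂ) := by
    intro N
    rw [integral_corrAverage hm hφ hw hg hg, avg]
    push_cast
    congr 1
    exact Finset.sum_congr rfl fun n _ => integral_corr_self hm (hw.koopman hφ n) hg
  simp only [h5] at h3
  have h6 := (Complex.continuous_re.tendsto _).comp h3
  exact h6

theorem tendsto_zero_of_forall_le_add {u : ℕ → ℝ} (hu : ∀ n, 0 ≤ u n)
    (h : ∀ ε > 0, ∃ v : ℕ → ℝ, Tendsto v atTop (𝓝 0) ∧ ∀ n, u n ≤ ε + v n) :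
    Tendsto u atTop (𝓝 0) := by
  rw [Metric.tendsto_atTop']
  intro ε hε
  obtain ⟨v, hv, hle⟩ := h (ε / 2) (by positivity)
  obtain ⟨n, hn⟩ := eventually_atTop.1 (hv.eventually_lt_const (half_pos hε))
  refine ⟨n, fun k hk => ?_⟩
  rw [Real.dist_eq, sub_zero, abs_of_nonneg (hu k)]
  linarith [hle k, hn k hk.le]

theorem tendsto_avg_condInner_of_bounded (hm : m ≤ m0) (hinv : IsInvariantSigma m φ)
    (hφ : MeasurePreserving φ μ μ) (hw : BoundedBy μ M w)
    (horth : IsOrthogonalToAlmostPeriodic m φ μ w) (hg : BoundedBy μ K g) :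
    Tendsto (avg fun n => ∫ x, ‖condInner m μ g (koopman φ n w) x‖ ∂μ) atTop (𝓝 0) := by
  refine tendsto_zero_of_forall_le_add
    (avg_nonneg fun n => integral_nonneg fun _ => norm_nonneg _) fun ε hε => ?_
  -- Squares control first powers through `t ≤ ε + ε⁻¹ t²`.
  have h1 := (tendsto_avg_condInner_sq hm hinv hφ hw horth hg).const_mul ε⁻¹
  rw [mul_zero] at h1
  refine ⟨_, h1, fun N => ?_⟩
  rw [← avg_const_mul]
  refine (avg_mono (b := fun n => ε + ε⁻¹ * ∫ x, ‖condInner m μ g (koopman φ n w) x‖ ^ 2 ∂μ)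
    (fun n => ?_) N).trans ?_
  · have hD := hg.condInner hm (hw.koopman hφ n)
    have hD2 := (hD.memLp 2).integrable_norm_pow two_ne_zero
    have h2 : ∫ x, ‖condInner m μ g (koopman φ n w) x‖ ∂μ ≤
        ∫ x, (ε + ε⁻¹ * ‖condInner m μ g (koopman φ n w) x‖ ^ 2) ∂μ := by
      refine integral_mono hD.integrable.norm ((integrable_const _).add (hD2.const_mul _))
        fun x => ?_
      have : 0 ≤ ε⁻¹ * (‖condInner m μ g (koopman φ n w) x‖ - ε) ^ 2 := by positivity
      have e : ε⁻¹ * (‖condInner m μ g (koopman φ n w) x‖ - ε) ^ 2 =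
          ε⁻¹ * ‖condInner m μ g (koopman φ n w) x‖ ^ 2 + ε -
            2 * ‖condInner m μ g (koopman φ n w) x‖ := by
        field_simp; ring
      have h0 := norm_nonneg (condInner m μ g (koopman φ n w) x)
      simp only
      linarith
    rw [integral_add (integrable_const _) (hD2.const_mul _), integral_const_mul] at h2
    simpa using h2
  · rw [avg_add]
    gcongr
    exact avg_const_le hε.le N

/-- Bounded functions are dense in `L¹`, and correlation with a bounded function is `L¹`-continuous
in `g`. Unbounded `g` occur as generators of general conditionally almost periodic functions. -/
theorem tendsto_avg_condInner (hm : m ≤ m0) (hinv : IsInvariantSigma m φ)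
    (hφ : MeasurePreserving φ μ μ) (hw : BoundedBy μ M w)
    (horth : IsOrthogonalToAlmostPeriodic m φ μ w) (hg : Integrable g μ) :
    Tendsto (avg fun n => ∫ x, ‖condInner m μ g (koopman φ n w) x‖ ∂μ) atTop (𝓝 0) := by
  have hM := hw.nonneg
  refine tendsto_zero_of_forall_le_add
    (avg_nonneg fun n => integral_nonneg fun _ => norm_nonneg _) fun ε hε => ?_
  obtain ⟨g', K, hg', hle⟩ := exists_boundedBy_integral_norm_sub_le hg
    (ε := ε / (M + 1)) (by positivity)
  refine ⟨_, tendsto_avg_condInner_of_bounded hm hinv hφ hw horth hg', fun N => ?_⟩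
  refine (avg_mono (b := fun n => ε + ∫ x, ‖condInner m μ g' (koopman φ n w) x‖ ∂μ)
    (fun n => ?_) N).trans ?_
  · have hwn := hw.koopman hφ n
    have hsub : Integrable (fun x => g x - g' x) μ := hg.sub hg'.integrable
    have h1 := integral_norm_condInner_le (m := m) hsub hwn
    have h2 : condInner m μ g (koopman φ n w) =ᵐ[μ] fun x =>
        condInner m μ (fun x => g x - g' x) (koopman φ n w) x +
          condInner m μ g' (koopman φ n w) x := by
      refine EventuallyEq.trans ?_ (condExp_add (hsub.mul_bdd hwn.conj.1 hwn.conj.2)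
        (hg'.integrable.mul_bdd hwn.conj.1 hwn.conj.2) m)
      refine condExp_congr_ae (ae_of_all _ fun x => ?_)
      simp only [Pi.add_apply]
      ring
    have i1 : Integrable (condInner m μ (fun x => g x - g' x) (koopman φ n w)) μ :=
      integrable_condExp
    have i2 : Integrable (condInner m μ g' (koopman φ n w)) μ := integrable_condExp
    have h3 : ∫ x, ‖condInner m μ g (koopman φ n w) x‖ ∂μ ≤
        ∫ x, (‖condInner m μ (fun x => g x - g' x) (koopman φ n w) x‖ +
          ‖condInner m μ g' (koopman φ n w) x‖) ∂μ := by
      refine integral_mono_ae integrable_condExp.norm (i1.norm.add i2.norm) ?_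
      filter_upwards [h2] with x hx
      rw [hx]
      exact norm_add_le _ _
    rw [integral_add i1.norm i2.norm] at h3
    have h4 : M * (ε / (M + 1)) ≤ ε := by
      rw [mul_div_assoc', div_le_iff₀ (by positivity)]; nlinarith
    have h5 := mul_le_mul_of_nonneg_left hle hM
    linarith
  · rw [avg_add]
    gcongr
    exact avg_const_le hε.le N

/-- Functions orthogonal to the almost periodic ones are conditionally weakly mixing. -/
theorem IsOrthogonalToAlmostPeriodic.isCondWeaklyMixing (hm : m ≤ m0)
    (hinv : IsInvariantSigma m φ) (hφ : MeasurePreserving φ μ μ) (hw : BoundedBy μ M w)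
    (horth : IsOrthogonalToAlmostPeriodic m φ μ w) : IsCondWeaklyMixing m φ μ w := by
  refine ⟨hw.memLp 2, ?_⟩
  refine (tendsto_avg_condInner_of_bounded hm hinv hφ hw horth hw).congr fun N => ?_
  rw [avg]
  congr 1
  refine Finset.sum_congr rfl fun n _ => integral_congr_ae ?_
  filter_upwards [condInner_swap (m := m) (hw.koopman hφ n) hw] with x hx
  simp only [hx, RCLike.norm_conj]
  rfl

theorem integral_norm_le_sqrt {u : X → ℂ} (hu : MemLp u 2 μ) :
    ∫ x, ‖u x‖ ∂μ ≤ √(∫ x, ‖u x‖ ^ 2 ∂μ) := by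
  have h1 : eLpNorm u 1 μ ≤ eLpNorm u 2 μ :=
    eLpNorm_le_eLpNorm_of_exponent_le (by norm_num) hu.1
  rw [eLpNorm_two_eq hu, eLpNorm_one_eq_lintegral_enorm] at h1
  rw [integral_norm_eq_lintegral_enorm hu.1]
  exact ENNReal.toReal_le_of_le_ofReal (Real.sqrt_nonneg _) h1

theorem integral_norm_le_of_condNorm_lt (hm : m ≤ m0) {u : X → ℂ} (hu : MemLp u 2 μ) {ε : ℝ}
    (hε : 0 < ε) (h : eLpNorm (condNorm m μ u) ∞ μ < ENNReal.ofReal ε) :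
    ∫ x, ‖u x‖ ∂μ ≤ ε := by
  refine (integral_norm_le_sqrt hu).trans (Real.sqrt_le_iff.2 ⟨hε.le, ?_⟩)
  rw [← integral_condExp hm]
  have h1 : ∀ᵐ x ∂μ, (μ[fun x => ‖u x‖ ^ 2 | m]) x ≤ ε ^ 2 := by
    rw [eLpNorm_exponent_top] at h
    filter_upwards [enorm_ae_le_eLpNormEssSup (condNorm m μ u) μ, condSq_nonneg (m := m) (μ := μ) u]
      with x hx h0
    have h2 := hx.trans h.le
    rw [condNorm_eq, ← ofReal_norm, ENNReal.ofReal_le_ofReal_iff hε.le,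
      Real.norm_of_nonneg (Real.sqrt_nonneg _)] at h2
    exact (Real.sqrt_le_iff.1 h2).2
  have := integral_mono_ae integrable_condExp (integrable_const (ε ^ 2)) h1
  simpa using this

/-- Functions orthogonal to the bounded almost periodic functions are orthogonal to all
conditionally almost periodic functions. -/
theorem IsOrthogonalToAlmostPeriodic.integral_eq_zero (hm : m ≤ m0)
    (hinv : IsInvariantSigma m φ) (hφ : MeasurePreserving φ μ μ) (hw : BoundedBy μ M w)
    (horth : IsOrthogonalToAlmostPeriodic m φ μ w) {f : X → ℂ}
    (hf : IsCondAlmostPeriodic m φ μ f) : ∫ x, f x * starRingEnd ℂ (w x) ∂μ = 0 := by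
  have hM := hw.nonneg
  rw [← norm_eq_zero]
  refine le_antisymm (le_of_forall_pos_le_add fun δ hδ => ?_) (norm_nonneg _)
  set ε := δ / (M + 1) with hεd
  have hε : 0 < ε := by positivity
  obtain ⟨r, g, hg, happ⟩ := hf.2 ε hε
  -- By invariance the left side is also the pairing of `T^n f` with `T^n w`. Replacing `T^n f` by a
  -- combination of the finitely many generators costs `M ε`, and the coefficients drop out since
  -- they are `m`-measurable and bounded by `1`. Averaging over `n` then kills the sum.
  have key : ∀ n : ℕ, ‖∫ x, f x * starRingEnd ℂ (w x) ∂μ‖ ≤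
      M * ε + ∑ j, ∫ x, ‖condInner m μ (g j) (koopman φ n w) x‖ ∂μ := by
    intro n
    obtain ⟨c, hc, hlt⟩ := happ n
    have hwn := hw.koopman hφ n
    have hcb : ∀ j, ∀ᵐ x ∂μ, ‖c j x‖ ≤ 1 := fun j => by
      have h1 := (hc j).2
      rw [eLpNorm_exponent_top] at h1
      filter_upwards [enorm_ae_le_eLpNormEssSup (c j) μ] with x hx
      have h2 := hx.trans h1
      rw [← ofReal_norm, ENNReal.ofReal_le_one] at h2
      exact h2
    have hcB : ∀ j, BoundedBy μ 1 (c j) := fun j => BoundedBy.mk' hm ⟨(hc j).1, hcb j⟩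
    have hfn : MemLp (koopman φ n f) 2 μ :=
      hf.1.1.comp_measurePreserving (measurePreserving_zpow hφ n)
    have hcg : ∀ j, MemLp (fun x => c j x * g j x) 2 μ := fun j =>
      ⟨(hcB j).1.mul (hg j).1.1, (eLpNorm_mul_bounded_le (hcB j)).trans_lt
        (ENNReal.mul_lt_top ENNReal.ofReal_lt_top (hg j).1.2)⟩
    set u : X → ℂ := fun x => koopman φ n f x - ∑ j, c j x * g j x with hu
    have hu2 : MemLp u 2 μ := hfn.sub (memLp_finsetSum _ fun j _ => hcg j)
    have hui : Integrable u μ := hu2.integrable (by norm_num)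
    have hgi : ∀ j, Integrable (g j) μ := fun j => (hg j).1.integrable (by norm_num)
    have i1 := hui.mul_bdd hwn.conj.1 hwn.conj.2
    have i2 : ∀ j, Integrable (fun x => c j x * (g j x * starRingEnd ℂ (koopman φ n w x))) μ :=
      fun j => ((hgi j).mul_bdd hwn.conj.1 hwn.conj.2).bdd_mul (hcB j).1 (hcb j)
    have e1 : ∫ x, f x * starRingEnd ℂ (w x) ∂μ = (∫ x, u x * starRingEnd ℂ (koopman φ n w x) ∂μ) +
        ∑ j, ∫ x, c j x * (g j x * starRingEnd ℂ (koopman φ n w x)) ∂μ := by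
      rw [← integral_finsetSum _ fun j _ => i2 j,
        ← integral_add i1 (integrable_finsetSum _ fun j _ => i2 j), ← integral_koopman hφ n]
      refine integral_congr_ae (ae_of_all _ fun x => ?_)
      simp only [hu, ← mul_assoc, ← Finset.sum_mul]
      rw [← add_mul, sub_add_cancel]
      rfl
    rw [e1]
    refine (norm_add_le _ _).trans (add_le_add ?_ ((norm_sum_le _ _).trans
      (Finset.sum_le_sum fun j _ => ?_)))
    · refine (norm_integral_le_integral_norm _).trans ?_
      refine le_trans ?_ (mul_le_mul_of_nonneg_left
        (integral_norm_le_of_condNorm_lt hm hu2 hε hlt) hM)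
      rw [← integral_const_mul]
      refine integral_mono_ae i1.norm (hui.norm.const_mul _) ?_
      filter_upwards [hwn.2] with x hx
      rw [norm_mul, RCLike.norm_conj, mul_comm]
      exact mul_le_mul_of_nonneg_right hx (norm_nonneg _)
    · rw [integral_mul_condExp hm (hc j).1 (hcb j) ((hgi j).mul_bdd hwn.conj.1 hwn.conj.2)]
      refine (norm_integral_le_integral_norm _).trans ?_
      refine integral_mono_ae (integrable_condExp.bdd_mul (hcB j).1 (hcb j)).norm
        integrable_condExp.norm ?_
      filter_upwards [hcb j] with x hx
      rw [norm_mul]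
      exact mul_le_of_le_one_left (norm_nonneg _) hx
  have hlim : Tendsto (fun N => M * ε + ∑ j, avg (fun n =>
      ∫ x, ‖condInner m μ (g j) (koopman φ n w) x‖ ∂μ) N) atTop (𝓝 (M * ε + ∑ _j : Fin r, 0)) :=
    tendsto_const_nhds.add (tendsto_finsetSum _ fun j _ =>
      tendsto_avg_condInner hm hinv hφ hw horth ((hg j).1.integrable (by norm_num)))
  rw [Finset.sum_const_zero, add_zero] at hlim
  have h1 : ‖∫ x, f x * starRingEnd ℂ (w x) ∂μ‖ ≤ M * ε := by
    refine ge_of_tendsto hlim ?_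
    filter_upwards [eventually_ge_atTop 1] with N hN
    have h2 := avg_mono key N
    rw [avg_add, avg_finsetSum] at h2
    have hN' : (N : ℝ) ≠ 0 := by positivity
    have e : ∀ c : ℝ, avg (fun _ => c) N = c := fun c => by simp [avg, hN']
    rw [e, e] at h2
    exact h2
  have h4 : M * ε ≤ δ := by
    rw [hεd, mul_div_assoc', div_le_iff₀ (by positivity)]; nlinarith
  linarith

end

/-! ### Density of bounded functions in the orthogonal complement of a factor -/

theorem integral_condExp_mul_comm [IsProbabilityMeasure μ] (hm : m ≤ m0) {f v : X → ℂ} {K : ℝ}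
    (hf : Integrable f μ) (hv : BoundedBy μ K v) :
    ∫ x, (μ[f | m]) x * v x ∂μ = ∫ x, f x * (μ[v | m]) x ∂μ := by
  have hEv := hv.condExp hm
  have h1 := condExp_bilin_of_aestronglyMeasurable_left (m := m) (μ := μ)
    (ContinuousLinearMap.mul ℝ ℂ) (f := μ[f | m]) (g := v)
    stronglyMeasurable_condExp.aestronglyMeasurable
    (integrable_condExp.mul_bdd hv.1 hv.2) hv.integrable
  have h2 := integral_mul_condExp hm (c := μ[v | m]) (g := f)
    stronglyMeasurable_condExp.aestronglyMeasurable hEv.2 hf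
  have h3 : ∫ x, (μ[fun x => (μ[f | m]) x * v x | m]) x ∂μ =
      ∫ x, (μ[f | m]) x * (μ[v | m]) x ∂μ := integral_congr_ae h1
  rw [integral_condExp hm] at h3
  rw [h3]
  simp only [mul_comm (f _)]
  rw [h2]
  simp only [mul_comm]

/-- The test functions `v = 1_s - E(1_s | m)` show that `f` and its conditional expectation have the
same integral over every measurable set `s`. Only bounded test functions occur, as the uniformity
seminorms require. -/
theorem aestronglyMeasurable_of_orthogonal [IsProbabilityMeasure μ] (hm : m ≤ m0) {f : X → ℂ}
    (hf : Integrable f μ) (h : ∀ (v : X → ℂ) (K : ℝ), BoundedBy μ K v → μ[v | m] =ᵐ[μ] 0 →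
      ∫ x, f x * starRingEnd ℂ (v x) ∂μ = 0) : AEStronglyMeasurable[m] f μ := by
  suffices hE : f =ᵐ[μ] μ[f | m] from
    (stronglyMeasurable_condExp.aestronglyMeasurable (μ := μ)).congr hE.symm
  refine Integrable.ae_eq_of_forall_setIntegral_eq _ _ hf integrable_condExp fun s hs _ => ?_
  set v : X → ℂ := s.indicator fun _ => 1 with hv
  have hvb : BoundedBy μ 1 v := by
    refine ⟨aestronglyMeasurable_const.indicator hs, ae_of_all _ fun x => ?_⟩
    exact (norm_indicator_le_norm_self _ _).trans (by simp)
  have hvE := hvb.condExp hm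
  have h0 : μ[fun x => v x - (μ[v | m]) x | m] =ᵐ[μ] 0 := by
    have h1 := condExp_sub hvb.integrable hvE.integrable m
    have h2 := condExp_of_stronglyMeasurable hm (stronglyMeasurable_condExp (μ := μ) (f := v))
      integrable_condExp
    rw [h2] at h1
    exact h1.trans (ae_of_all _ fun x => by simp)
  have h1 := h _ _ (hvb.sub hvE) h0
  have hconj : (fun x => starRingEnd ℂ ((μ[v | m]) x)) =ᵐ[μ] μ[v | m] := by
    have := (condExp_conj (m := m) hvb.integrable).symm
    refine this.trans (condExp_congr_ae (ae_of_all _ fun x => ?_))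
    simp only [hv]
    by_cases hx : x ∈ s <;> simp [hx]
  have e1 : (fun x => f x * starRingEnd ℂ (v x - (μ[v | m]) x)) =ᵐ[μ]
      fun x => f x * v x - f x * (μ[v | m]) x := by
    filter_upwards [hconj] with x hx
    rw [map_sub, hx, mul_sub]
    congr 2
    simp only [hv]
    by_cases hx : x ∈ s <;> simp [hx]
  rw [integral_congr_ae e1, integral_sub (hf.mul_bdd hvb.1 hvb.2) (hf.mul_bdd hvE.1 hvE.2),
    sub_eq_zero, ← integral_condExp_mul_comm hm hf hvb] at h1
  have e2 : ∀ a : X → ℂ, ∫ x, a x * v x ∂μ = ∫ x in s, a x ∂μ := fun a => by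
    rw [← integral_indicator hs]
    refine integral_congr_ae (ae_of_all _ fun x => ?_)
    simp only [hv]
    by_cases hx : x ∈ s <;> simp [hx]
  rw [e2, e2] at h1
  exact h1

end DistalHostKra

namespace DistalHostKra

section

variable {X : Type*} {m : MeasurableSpace X} [m0 : MeasurableSpace X] {μ : Measure X} {φ : X ≃ᵐ X}

/-! ### The closure of the almost periodic functions -/

theorem integral_mul_conj_eq_zero_of_condExp [IsProbabilityMeasure μ] (hm : m ≤ m0)
    {v a : X → ℂ} {M K : ℝ} (hv : BoundedBy μ M v) (hE : μ[v | m] =ᵐ[μ] 0)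
    (ham : AEStronglyMeasurable[m] a μ) (ha : BoundedBy μ K a) :
    ∫ x, v x * starRingEnd ℂ (a x) ∂μ = 0 := by
  simp only [mul_comm (v _)]
  rw [integral_mul_condExp hm (RCLike.continuous_conj.comp_aestronglyMeasurable ham)
    ha.conj.2 hv.integrable]
  rw [integral_congr_ae (g := fun _ => (0 : ℂ)) (by
    filter_upwards [hE] with x hx
    rw [hx]; simp), integral_zero]

theorem isInducedByFactor_almostPeriodic [IsProbabilityMeasure μ] (hm : m ≤ m0)
    (hinv : IsInvariantSigma m φ) (hφ : MeasurePreserving φ μ μ) :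
    IsInducedByFactor (factorOf (closure {F : Lp ℂ 2 μ | IsBddAlmostPeriodic m φ μ F})) φ μ
      (closure {F : Lp ℂ 2 μ | IsBddAlmostPeriodic m φ μ F}) :=
  (IsBddAlmostPeriodic.isBddStarAlg hm hinv hφ).isInducedByFactor hφ
    fun n _ hf => IsBddAlmostPeriodic.koopman hφ hf n

theorem isOrthogonalToAlmostPeriodic_of_condExp [IsProbabilityMeasure μ] (hm : m ≤ m0)
    (hinv : IsInvariantSigma m φ) (hφ : MeasurePreserving φ μ μ) {v : X → ℂ} {M : ℝ}
    (hv : BoundedBy μ M v)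
    (hE : μ[v | factorOf (closure {F : Lp ℂ 2 μ | IsBddAlmostPeriodic m φ μ F})] =ᵐ[μ] 0) :
    IsOrthogonalToAlmostPeriodic m φ μ v := by
  intro a ha
  obtain ⟨K, hK⟩ := ha.1
  have hA := IsBddAlmostPeriodic.isBddStarAlg (μ := μ) hm hinv hφ
  have h1 := hA.aestronglyMeasurable_of_mem ha
  rw [← hA.factorOf_eq] at h1
  exact integral_mul_conj_eq_zero_of_condExp (isInducedByFactor_almostPeriodic hm hinv hφ).1
    hv hE h1 hK

/-- For the nontrivial inclusion a general almost periodic function is tested against the bounded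
functions with zero expectation on the factor generated by the bounded class. No truncation of the
function or of its generators is needed. -/
theorem closure_isCondAlmostPeriodic [IsProbabilityMeasure μ] (hm : m ≤ m0)
    (hinv : IsInvariantSigma m φ) (hφ : MeasurePreserving φ μ μ) :
    closure {F : Lp ℂ 2 μ | IsCondAlmostPeriodic m φ μ F} =
      closure {F : Lp ℂ 2 μ | IsBddAlmostPeriodic m φ μ F} := by
  refine Set.Subset.antisymm (closure_minimal (fun F hF => ?_) isClosed_closure)
    (closure_mono fun F hF => hF.isCondAlmostPeriodic hm)
  obtain ⟨hm', _, hD⟩ := isInducedByFactor_almostPeriodic (μ := μ) hm hinv hφ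
  rw [hD]
  refine aestronglyMeasurable_of_orthogonal hm' ((Lp.memLp F).integrable (by norm_num))
    fun v K hv hE => ?_
  exact (isOrthogonalToAlmostPeriodic_of_condExp hm hinv hφ hv hE).integral_eq_zero hm hinv hφ hv hF

/-- The derivative `T^n f · conj f` is its expectation on the factor plus a part invisible to
`U^{k+1}`. By `uPow_add_le` its seminorm power is at most a constant times the `L¹` norm of the
expectation, and weak mixing says that these norms average to `0`. -/
theorem uniformitySeminorm_eq_zero_of_isCondWeaklyMixing [IsProbabilityMeasure μ] (hm : m ≤ m0)
    (hφ : MeasurePreserving φ μ μ) {k : ℕ}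
    (hk : ∀ (v : X → ℂ) (K : ℝ), BoundedBy μ K v → μ[v | m] =ᵐ[μ] 0 →
      uniformitySeminorm φ μ (k + 1) v = 0)
    {f : X → ℂ} {M : ℝ} (hf : BoundedBy μ M f) (hW : IsCondWeaklyMixing m φ μ f) :
    uniformitySeminorm φ μ (k + 2) f = 0 := by
  rw [uniformitySeminorm_eq_zero_iff, uPow_succ]
  refine le_antisymm ?_ (limsup_nonneg (avg_nonneg fun n => uPow_nonneg _ _))
  obtain ⟨C, hC, hle⟩ := uPow_add_le hφ k (M * M + M * M)
  have hMM : (0 : ℝ) ≤ M * M := mul_self_nonneg M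
  have key : ∀ n : ℕ, uPow φ μ (k + 1) (multDeriv φ n f) ≤
      C * ∫ x, ‖(μ[multDeriv φ n f | m]) x‖ ∂μ := by
    intro n
    have hd := hf.multDeriv hφ n
    have hE := hd.condExp hm
    have h1 := hle (μ[multDeriv φ n f | m]) (fun x => multDeriv φ n f x - (μ[multDeriv φ n f | m]) x)
      (hE.mono (by linarith)) (hd.sub hE)
    have h0 : μ[fun x => multDeriv φ n f x - (μ[multDeriv φ n f | m]) x | m] =ᵐ[μ] 0 := by
      have h2 := condExp_sub hd.integrable hE.integrable m
      rw [condExp_of_stronglyMeasurable hm (stronglyMeasurable_condExp (μ := μ))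
        integrable_condExp] at h2
      exact h2.trans (ae_of_all _ fun x => by simp)
    rw [(uniformitySeminorm_eq_zero_iff _ _).1 (hk _ _ (hd.sub hE) h0), add_zero] at h1
    simpa only [add_sub_cancel] using h1
  have hlim : Tendsto (fun N => C * avg (fun n => ∫ x, ‖(μ[multDeriv φ n f | m]) x‖ ∂μ) N) atTop
      (𝓝 0) := by
    have h1 := hW.2.const_mul C
    rw [mul_zero] at h1
    exact h1
  refine le_of_forall_pos_le_add fun ε hε => ?_
  refine limsup_le_of_eventually (avg_nonneg fun n => uPow_nonneg _ _) ?_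
  filter_upwards [hlim.eventually_lt_const hε] with N hN
  have h1 := avg_mono key N
  rw [avg_const_mul] at h1
  linarith

/-! ### Multiple ergodic averages -/

theorem progAverage_sub {k : ℕ} {A B D : ℕ → X → ℂ} {t : ℕ} (ht : t ∈ Finset.Icc 1 k)
    (hA : ∀ i, i ≠ t → A i = D i) (hB : ∀ i, i ≠ t → B i = D i)
    (hD : D t = fun x => A t x - B t x) (N : ℕ) (x : X) :
    progAverage φ 1 k A N x - progAverage φ 1 k B N x = progAverage φ 1 k D N x := by
  have e : ∀ (E : ℕ → X → ℂ) (n : ℕ), (∀ i, i ≠ t → E i = D i) → progTerm φ 1 k E n x =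
      koopman φ (1 * t * n) (E t) x *
        ∏ i ∈ (Finset.Icc 1 k).erase t, koopman φ (1 * i * n) (D i) x := by
    intro E n hE
    rw [progTerm, ← Finset.mul_prod_erase _ _ ht]
    congr 1
    exact Finset.prod_congr rfl fun i hi => by rw [hE i (Finset.ne_of_mem_erase hi)]
  rw [progAverage, progAverage, progAverage, ← mul_sub, ← Finset.sum_sub_distrib]
  congr 1
  refine Finset.sum_congr rfl fun n _ => ?_
  rw [e A n hA, e B n hB, e D n fun _ _ => rfl, hD, ← sub_mul]
  rfl

theorem multipleAverage_eq_progAverage {k : ℕ} {f : Fin k → X → ℂ} {F : ℕ → X → ℂ}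
    (h : ∀ j : Fin k, F (j + 1) = f j) (N : ℕ) (x : X) :
    multipleAverage φ f N x = progAverage φ 1 k F N x := by
  rw [multipleAverage, progAverage]
  congr 1
  refine Finset.sum_congr rfl fun n _ => ?_
  have e : Finset.Icc 1 k = Finset.Ico (0 + 1) (k + 1) := by ext; simp
  rw [progTerm, e, ← Finset.prod_Ico_add' (fun i : ℕ => koopman φ (1 * i * n) (F i) x) 0 k 1,
    ← Finset.range_eq_Ico, Finset.prod_range]
  refine Finset.prod_congr rfl fun j _ => ?_
  rw [h j]
  push_cast
  rw [one_mul]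

theorem aestronglyMeasurable_progAverage (hφ : MeasurePreserving φ μ μ) {σ : ℤ} {k N : ℕ}
    {F : ℕ → X → ℂ} (hF : ∀ i, AEStronglyMeasurable (F i) μ) :
    AEStronglyMeasurable (progAverage φ σ k F N) μ :=
  (Finset.aestronglyMeasurable_fun_sum _ fun _ _ => Finset.aestronglyMeasurable_fun_prod _ fun i _ =>
    (hF i).comp_measurePreserving (measurePreserving_zpow hφ _)).const_mul _

/-- The functions are divided by their common bound `L` to make `progAverage_bound` applicable;
multilinearity restores the factor `L^{k+1}`. -/
theorem tendsto_eLpNorm_progAverage [IsProbabilityMeasure μ] (hφ : Ergodic φ μ) {k : ℕ}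
    (hk : ∀ (v : X → ℂ) (K : ℝ), BoundedBy μ K v → μ[v | m] =ᵐ[μ] 0 →
      uniformitySeminorm φ μ (k + 1) v = 0)
    {F : ℕ → X → ℂ} {L : ℝ} (hL : 0 < L) (hF : ∀ i, BoundedBy μ L (F i)) {t : ℕ} (ht1 : 1 ≤ t)
    (htk : t ≤ k + 1) (hE : μ[F t | m] =ᵐ[μ] 0) :
    Tendsto (fun N => eLpNorm (progAverage φ 1 (k + 1) F N) 2 μ) atTop (𝓝 0) := by
  obtain ⟨C, hC, hbound⟩ := progAverage_bound hφ k
  have hLc : (L : ℂ) ≠ 0 := by exact_mod_cast hL.ne'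
  set G : ℕ → X → ℂ := fun i x => (L : ℂ)⁻¹ * F i x with hG
  have hGb : ∀ i, BoundedBy μ 1 (G i) := fun i => by
    refine ((BoundedBy.const ((L : ℂ)⁻¹)).mul (hF i)).mono (le_of_eq ?_)
    rw [norm_inv, Complex.norm_real, Real.norm_of_nonneg hL.le, inv_mul_cancel₀ hL.ne']
  have hGE : μ[G t | m] =ᵐ[μ] 0 := by
    refine (condExp_smul (μ := μ) ((L : ℂ)⁻¹) (F t) m).trans ?_
    filter_upwards [hE] with x hx
    simp [hx]
  have hU := hk _ _ (hGb t) hGE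
  have hGN : ∀ N, MemLp (progAverage φ 1 (k + 1) G N) 2 μ := fun N =>
    (BoundedBy.average zero_le_one
      (boundedBy_progTerm hφ.toMeasurePreserving 1 (k + 1) hGb) N).memLp 2
  have hlim : Tendsto (fun N => ∫ x, ‖progAverage φ 1 (k + 1) G N x‖ ^ 2 ∂μ) atTop (𝓝 0) := by
    rw [Metric.tendsto_atTop']
    intro ε hε
    obtain ⟨n, hn⟩ := eventually_atTop.1 (hbound 1 (Or.inl rfl) G hGb t ht1 htk (ε / 2) (by positivity))
    refine ⟨n, fun N hN => ?_⟩
    have h1 := hn N hN.le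
    rw [hU] at h1
    rw [Real.dist_eq, sub_zero, abs_of_nonneg (integral_nonneg fun _ => by positivity)]
    norm_num at h1
    linarith
  have hFG : ∀ N, progAverage φ 1 (k + 1) F N =
      ((L : ℂ) ^ (k + 1)) • progAverage φ 1 (k + 1) G N := by
    intro N
    funext x
    simp only [Pi.smul_apply, smul_eq_mul, progAverage]
    rw [mul_left_comm]
    congr 1
    rw [Finset.mul_sum]
    refine Finset.sum_congr rfl fun n _ => ?_
    simp only [progTerm, hG, koopman, Finset.prod_mul_distrib, Finset.prod_const, Nat.card_Icc]
    rw [← mul_assoc, add_tsub_cancel_right, ← mul_pow, mul_inv_cancel₀ hLc, one_pow, one_mul]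
  have h2 : Tendsto (fun N => ‖(L : ℂ) ^ (k + 1)‖ₑ *
      ENNReal.ofReal (√(∫ x, ‖progAverage φ 1 (k + 1) G N x‖ ^ 2 ∂μ))) atTop (𝓝 0) := by
    have h3 := ENNReal.tendsto_ofReal ((Real.continuous_sqrt.tendsto 0).comp hlim)
    simp only [Real.sqrt_zero, ENNReal.ofReal_zero] at h3
    have h4 := ENNReal.Tendsto.const_mul (a := ‖(L : ℂ) ^ (k + 1)‖ₑ) h3 (Or.inr enorm_ne_top)
    rw [mul_zero] at h4
    exact h4
  refine h2.congr fun N => ?_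
  rw [hFG, eLpNorm_const_smul, eLpNorm_two_eq (hGN N)]

/-- Telescoping: the functions are replaced by their conditional expectations one at a time, and
each replacement changes the average by a multiple average in which one function has zero
expectation. -/
theorem isCharacteristic_succ [IsProbabilityMeasure μ] (hm : m ≤ m0) (hφ : Ergodic φ μ) {k : ℕ}
    (hk : ∀ (v : X → ℂ) (K : ℝ), BoundedBy μ K v → μ[v | m] =ᵐ[μ] 0 →
      uniformitySeminorm φ μ (k + 1) v = 0) : IsCharacteristic m φ μ (k + 1) := by
  intro f hf
  choose B hB0 hB using fun j => exists_boundedBy_of_memLp_top (hf j)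
  set M := ∑ j, B j with hM
  have hM0 : 0 ≤ M := Finset.sum_nonneg fun j _ => hB0 j
  have hBM : ∀ j, BoundedBy μ M (f j) := fun j =>
    (hB j).mono (Finset.single_le_sum (f := B) (fun j _ => hB0 j) (Finset.mem_univ j))
  -- Progressions start at index `1`, so the truncated subtraction at `i = 0` does not matter.
  set F : ℕ → X → ℂ := fun i => if h : i - 1 < k + 1 then f ⟨i - 1, h⟩ else fun _ => 0 with hF
  have hFb : ∀ i, BoundedBy μ M (F i) := fun i => by
    simp only [hF]
    split_ifs with h
    · exact hBM _
    · exact (BoundedBy.const 0).mono (by simpa using hM0)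
  have hPb : ∀ i, BoundedBy μ M (μ[F i | m]) := fun i => (hFb i).condExp hm
  have hFf : ∀ j : Fin (k + 1), F (j + 1) = f j := fun j => by
    simp only [hF, add_tsub_cancel_right, j.2, dif_pos]
  -- In `H s` the first `s` functions have been projected; `D s` carries the difference between `H
  -- s` and `H (s + 1)` in position `s + 1`.
  set H : ℕ → ℕ → X → ℂ := fun s i => if i ≤ s then μ[F i | m] else F i with hH
  set D : ℕ → ℕ → X → ℂ := fun s i =>
    if i = s + 1 then fun x => F i x - (μ[F i | m]) x else H s i with hD
  have hHb : ∀ s i, BoundedBy μ M (H s i) := fun s i => by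
    simp only [hH]
    split_ifs
    exacts [hPb i, hFb i]
  -- The extra `1` makes the common bound positive even when all the functions vanish.
  have hDb : ∀ s i, BoundedBy μ (M + M + 1) (D s i) := fun s i => by
    simp only [hD]
    split_ifs
    exacts [((hFb i).sub (hPb i)).mono (by linarith), (hHb s i).mono (by linarith)]
  have hstep : ∀ s ∈ Finset.range (k + 1), ∀ N x,
      progAverage φ 1 (k + 1) (H s) N x - progAverage φ 1 (k + 1) (H (s + 1)) N x =
        progAverage φ 1 (k + 1) (D s) N x := by
    intro s hs N x
    rw [Finset.mem_range] at hs
    refine progAverage_sub (t := s + 1) (Finset.mem_Icc.2 ⟨by omega, by omega⟩)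
      (fun i hi => ?_) (fun i hi => ?_) ?_ N x
    · simp only [hD, if_neg hi]
    · simp only [hD, if_neg hi, hH]
      have : i ≤ s + 1 ↔ i ≤ s := by omega
      simp only [this]
    · simp only [hD, hH, if_true, le_refl, show ¬ (s + 1 ≤ s) by omega, if_false]
  have hsum : ∀ N, (fun x => multipleAverage φ f N x -
      multipleAverage φ (fun j => μ[f j | m]) N x) =
        ∑ s ∈ Finset.range (k + 1), progAverage φ 1 (k + 1) (D s) N := by
    intro N
    funext x
    rw [Finset.sum_apply, ← Finset.sum_congr rfl fun s hs => hstep s hs N x,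
      Finset.sum_range_sub' (fun s => progAverage φ 1 (k + 1) (H s) N x)]
    congr 1
    · refine multipleAverage_eq_progAverage (fun j => ?_) N x
      simp only [hH, show ¬ ((j : ℕ) + 1 ≤ 0) by omega, if_false, hFf]
    · refine multipleAverage_eq_progAverage (fun j => ?_) N x
      have := j.2
      simp only [hH, show (j : ℕ) + 1 ≤ k + 1 by omega, if_true, hFf]
  have hDE : ∀ s, μ[D s (s + 1) | m] =ᵐ[μ] 0 := by
    intro s
    simp only [hD, if_true]
    have h2 := condExp_sub (hFb (s + 1)).integrable (hPb (s + 1)).integrable m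
    rw [condExp_of_stronglyMeasurable hm (stronglyMeasurable_condExp (μ := μ))
      integrable_condExp] at h2
    exact h2.trans (ae_of_all _ fun x => by simp)
  have hlim : Tendsto (fun N => ∑ s ∈ Finset.range (k + 1),
      eLpNorm (progAverage φ 1 (k + 1) (D s) N) 2 μ) atTop (𝓝 (∑ _s ∈ Finset.range (k + 1), 0)) :=
    tendsto_finsetSum _ fun s hs => by
      rw [Finset.mem_range] at hs
      exact tendsto_eLpNorm_progAverage hφ hk (by linarith) (hDb s) (t := s + 1) (by omega)
        (by omega) (hDE s)
  rw [Finset.sum_const_zero] at hlim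
  refine tendsto_of_tendsto_of_tendsto_of_le_of_le tendsto_const_nhds hlim (fun _ => zero_le)
    fun N => ?_
  rw [hsum]
  refine eLpNorm_sum_le (fun s _ => ?_) (by norm_num)
  exact aestronglyMeasurable_progAverage hφ.toMeasurePreserving fun i => (hDb s i).1

end

/-! ### The distal tower -/

section

variable {X : Type*} [MeasurableSpace X] {μ : Measure X} {φ : X ≃ᵐ X}

theorem isBddStarAlg_const : IsBddStarAlg μ {f : X → ℂ | ∃ c : ℂ, f =ᵐ[μ] fun _ => c} where
  bdd _ := fun ⟨c, hc⟩ => ⟨‖c‖, (BoundedBy.const c).congr hc.symm⟩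
  congr _ := fun ⟨c, hc⟩ _ h => ⟨c, h.symm.trans hc⟩
  const c := ⟨c, EventuallyEq.rfl⟩
  add _ := fun ⟨c, hc⟩ _ ⟨d, hd⟩ => ⟨c + d, hc.add hd⟩
  mul _ := fun ⟨c, hc⟩ _ ⟨d, hd⟩ => ⟨c * d, hc.mul hd⟩
  conj _ := fun ⟨c, hc⟩ => ⟨starRingEnd ℂ c, hc.fun_comp _⟩

/-- The constants are the range of a linear map from `ℂ`, hence finite-dimensional. Closedness lets
the criterion for closures of algebras apply to `D_0` itself. -/
theorem isClosed_distalSubspace_zero [IsFiniteMeasure μ] : IsClosed (distalSubspace φ μ 0) := by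
  have e : distalSubspace φ μ 0 = (LinearMap.range (Lp.constL 2 μ ℂ : ℂ →L[ℂ] Lp ℂ 2 μ).toLinearMap : Set (Lp ℂ 2 μ)) := by
    ext F
    simp only [distalSubspace, Set.mem_ofPred_eq, LinearMap.coe_range, Set.mem_range]
    constructor
    · rintro ⟨c, hc⟩
      exact ⟨c, Lp.ext ((Lp.coeFn_const 2 μ c).trans hc.symm)⟩
    · rintro ⟨c, rfl⟩
      exact ⟨c, Lp.coeFn_const 2 μ c⟩
  rw [e]
  exact Submodule.closed_of_finiteDimensional _

theorem isInducedByFactor_zero [IsProbabilityMeasure μ] (hφ : MeasurePreserving φ μ μ) :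
    IsInducedByFactor (distalFactor φ μ 0) φ μ (distalSubspace φ μ 0) := by
  have h := (isBddStarAlg_const (μ := μ)).isInducedByFactor hφ
    fun n _ ⟨c, hc⟩ => ⟨c, ae_zpow hφ n hc⟩
  have e : closure {F : Lp ℂ 2 μ | (F : X → ℂ) ∈ {f : X → ℂ | ∃ c : ℂ, f =ᵐ[μ] fun _ => c}} =
      distalSubspace φ μ 0 := (isClosed_distalSubspace_zero (φ := φ)).closure_eq
  rw [e] at h
  exact h

theorem distalSubspace_succ [IsProbabilityMeasure μ] (hφ : MeasurePreserving φ μ μ) {k : ℕ}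
    (hk : IsInducedByFactor (distalFactor φ μ k) φ μ (distalSubspace φ μ k)) :
    distalSubspace φ μ (k + 1) =
      closure {F : Lp ℂ 2 μ | IsBddAlmostPeriodic (distalFactor φ μ k) φ μ F} :=
  closure_isCondAlmostPeriodic hk.1 hk.2.1 hφ

theorem isInducedByFactor_distal [IsProbabilityMeasure μ] (hφ : MeasurePreserving φ μ μ) (k : ℕ) :
    IsInducedByFactor (distalFactor φ μ k) φ μ (distalSubspace φ μ k) := by
  induction k with
  | zero => exact isInducedByFactor_zero hφ
  | succ k ih =>
    have h := isInducedByFactor_almostPeriodic (μ := μ) ih.1 ih.2.1 hφ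
    rw [← distalSubspace_succ hφ ih] at h
    exact h

/-- Bounded functions orthogonal to the distal factor of order `k` have vanishing `U^{k+1}`
seminorm. -/
theorem uniformitySeminorm_eq_zero_of_condExp [IsProbabilityMeasure μ]
    (hφ : MeasurePreserving φ μ μ) (k : ℕ) : ∀ (v : X → ℂ) (K : ℝ), BoundedBy μ K v →
      μ[v | distalFactor φ μ k] =ᵐ[μ] 0 → uniformitySeminorm φ μ (k + 1) v = 0 := by
  induction k with
  | zero =>
    intro v K hv hE
    change ‖∫ x, v x ∂μ‖ = 0
    rw [norm_eq_zero, ← integral_condExp (isInducedByFactor_distal hφ 0).1, integral_congr_ae hE]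
    simp
  | succ k ih =>
    intro v K hv hE
    obtain ⟨hm, hinv, hD⟩ := isInducedByFactor_distal (μ := μ) hφ k
    have e : distalFactor φ μ (k + 1) =
        factorOf (closure {F : Lp ℂ 2 μ | IsBddAlmostPeriodic (distalFactor φ μ k) φ μ F}) :=
      congrArg factorOf (distalSubspace_succ hφ ⟨hm, hinv, hD⟩)
    rw [e] at hE
    -- Zero expectation on `𝒟_{k+1}` gives orthogonality to the almost periodic functions over
    -- `𝒟_k`, hence weak mixing over `𝒟_k`; the induction hypothesis at level `k` does the rest.
    exact uniformitySeminorm_eq_zero_of_isCondWeaklyMixing hm hφ ih hv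
      ((isOrthogonalToAlmostPeriodic_of_condExp hm hinv hφ hv hE).isCondWeaklyMixing hm hinv hφ hv)

/-- Duality: each bounded function with zero expectation on `𝒟_k` is among the vectors to which
`Z_k` is orthogonal by definition, and orthogonality to all of them forces measurability with
respect to `𝒟_k`. -/
theorem hostKraSubspace_subset [IsProbabilityMeasure μ] (hφ : MeasurePreserving φ μ μ) (k : ℕ) :
    (hostKraSubspace φ μ k : Set (Lp ℂ 2 μ)) ⊆ distalSubspace φ μ k := by
  intro F hF
  obtain ⟨hm, _, hD⟩ := isInducedByFactor_distal (μ := μ) hφ k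
  rw [hD]
  refine aestronglyMeasurable_of_orthogonal hm ((Lp.memLp F).integrable (by norm_num))
    fun v K hv hE => ?_
  have hV := (hv.memLp 2).coeFn_toLp
  have hmem : (hv.memLp 2).toLp v ∈ Submodule.span ℂ
      {f : Lp ℂ 2 μ | MemLp f ∞ μ ∧ uniformitySeminorm φ μ (k + 1) f = 0} :=
    Submodule.subset_span ⟨(hv.memLp ∞).ae_eq hV.symm,
      uniformitySeminorm_eq_zero_of_condExp hφ k _ _ (hv.congr hV.symm)
        ((condExp_congr_ae hV).trans hE)⟩
  have h1 := (Submodule.mem_orthogonal _ _).1 hF _ hmem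
  rw [inner_Lp] at h1
  rw [← h1]
  refine integral_congr_ae ?_
  filter_upwards [hV] with x hx
  rw [hx]

end

end DistalHostKra

/-! ### Assembly of the proposition -/

theorem mainTheorem2 {X : Type*} [MeasurableSpace X] (μ : Measure X) [IsProbabilityMeasure μ]
    (φ : X ≃ᵐ X) (hφ : Ergodic φ μ) :
    -- the subspace `D_k` is induced by the factor `𝒟_k`
    (∀ k : ℕ, DistalHostKra.IsInducedByFactor (DistalHostKra.distalFactor φ μ k) φ μ
      (DistalHostKra.distalSubspace φ μ k)) ∧
    -- `Z_k ⊆ D_k`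
    (∀ k : ℕ, (DistalHostKra.hostKraSubspace φ μ k : Set (Lp ℂ 2 μ)) ⊆
      DistalHostKra.distalSubspace φ μ k) ∧
    -- bounded functions in `W(X|𝒟_k)` have vanishing `U^{k+2}` seminorm
    (∀ (k : ℕ) (f : X → ℂ), MemLp f ∞ μ →
      DistalHostKra.IsCondWeaklyMixing (DistalHostKra.distalFactor φ μ k) φ μ f →
      DistalHostKra.uniformitySeminorm φ μ (k + 2) f = 0) ∧
    -- `𝒟_{k-1}` is characteristic for `k`-term averages, `k ≥ 1`
    (∀ k : ℕ, 1 ≤ k → DistalHostKra.IsCharacteristic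
      (DistalHostKra.distalFactor φ μ (k - 1)) φ μ k) := by
  have hmp : MeasurePreserving φ μ μ := hφ.toMeasurePreserving
  refine ⟨DistalHostKra.isInducedByFactor_distal hmp, DistalHostKra.hostKraSubspace_subset hmp,
    fun k f hf hW => ?_, fun k hk => ?_⟩
  · obtain ⟨M, _, hM⟩ := DistalHostKra.exists_boundedBy_of_memLp_top hf
    exact DistalHostKra.uniformitySeminorm_eq_zero_of_isCondWeaklyMixing
      (DistalHostKra.isInducedByFactor_distal hmp k).1 hmp
      (DistalHostKra.uniformitySeminorm_eq_zero_of_condExp hmp k) hM hW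
  · obtain ⟨k, rfl⟩ := Nat.exists_eq_add_of_le' hk
    exact DistalHostKra.isCharacteristic_succ (DistalHostKra.isInducedByFactor_distal hmp k).1 hφ
      (DistalHostKra.uniformitySeminorm_eq_zero_of_condExp hmp k)
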